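/- Let $\pi\colon B\to M$ be a smooth fibre bundle, where $M$, $B$ and the fibre are finite-dimensional smooth Hausdorff manifolds without boundary. **Spaces.** Let $\Gamma_{\mathrm g}(\pi)$ be the set of pairs $(x,[\sigma]^{\mathrm g}_x)$ of a point $x\in M$ and the germ at $x$ of a smooth local section $\sigma$ of $\pi$ defined near $x$. It carries the quotient of the diffeology on the set of pairs $(x,\sigma)$, $x\in\operatorname{dom}\sigma$, in which $u\mapsto(x_u,\sigma_u)$ is a plot iff $u\mapsto x_u$ is smooth and for all $u_0$ and $y_0\in\operatorname{dom}\sigma_{u_0}$ there are open neighbourhoods $V$ of $u_0$ and $O$ of $y_0$ such that $O\subseteq\operatorname{dom}\sigma_u$ for all $u\in V$ and $(u,y)\mapsto\sigma_u(y)$ is smooth on $V\times O$. For $0\le k<\infty$ let $\Gamma_k(\pi)$ be the manifold of $k$-jets $(x,[\sigma]^k_x)$, so that $\Gamma_0(\pi)=B$, and let $\Gamma_\infty(\pi)=\varprojlim_k\Gamma_k(\pi)$. Write $\pi^{k,\mathrm g}\colon\Gamma_{\mathrm g}(\pi)\to\Gamma_k(\pi)$ and $\pi^{l,k}\colon\Gamma_k(\pi)\to\Gamma_l(\pi)$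 ($l\le k\le\infty$) for the canonical projections. Tangent spaces and differentials are taken in the sense of internal tangent spaces of diffeological spaces (which for manifolds are the usual ones); the tangent bundle of $\Gamma_\infty(\pi)$ is $\varprojlim_kT\Gamma_k(\pi)$. **Prolongations.** A (possibly time-dependent) smooth vector field $X$ on $B$ is projectable if there is a smooth vector field $\pi_*X$ on $M$ with $d\pi\circ X=\pi_*X\circ\pi$. Let $\mathrm{Fl}^Z_{t,t_0}$ denote the flow of a vector field $Z$ from time $t_0$ to time $t$. For such $X$, and for $k=\mathrm g$ or $0\le k<\infty$, put $$\mathfrak p^{k}(X)\big(x,[\sigma]^{k}_x\big)=\frac{d}{dt}\Big|_{t=0}\Big(\mathrm{Fl}^{\pi_*X}_{t,0}(x),\ \big[\mathrm{Fl}^X_{t,0}\circ\sigma\circ\mathrm{Fl}^{\pi_*X}_{0,t}\big]^{k}_{\mathrm{Fl}^{\pi_*X}_{t,0}(x)}\Big),$$ and let $\mathfrak p^\infty(X)$ be the pointwise projective limit of the $\mathfrak p^k(X)$, $k<\infty$. Let $\mathfrak X_{\mathrm{proj}}(B)$ be the set of time-independent projectable vector fields and $\mathfrak X_{\mathrm{proj}}(\Gamma_k(\pi))$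 its image under $\mathfrak p^k$, for $k\in\{0,1,\dots,\infty,\mathrm g\}$. **Proposition.** The curves in the definition of $\mathfrak p^k(X)$ are defined and smooth for small $|t|$, $\mathfrak p^k(X)$ does not depend on the choice of $\sigma$, $\mathfrak p^\infty(X)$ is a section of $\varprojlim_kT\Gamma_k(\pi)$, and the maps $\pi^{k,\mathrm g}$ are smooth. For every $k\le\infty$ and every (possibly time-dependent) projectable vector field $X$ on $B$, $$d\pi^{k,\mathrm g}\circ\mathfrak p^{\mathrm g}(X)=\mathfrak p^k(X)\circ\pi^{k,\mathrm g};$$ for $k=0$, under $\Gamma_0(\pi)=B$, this reads $d\pi^{0,\mathrm g}\circ\mathfrak p^{\mathrm g}(X)=X_{t=0}\circ\pi^{0,\mathrm g}$. Consequently the tower of prolongations extends to germs: for all $l\le k\le\infty$ there are maps $$(\pi^{k,\mathrm g})_*\colon\mathfrak X_{\mathrm{proj}}(\Gamma_{\mathrm g}(\pi))\to\mathfrak X_{\mathrm{proj}}(\Gamma_k(\pi)),\qquad(\pi^{l,k})_*\colon\mathfrak X_{\mathrm{proj}}(\Gamma_k(\pi))\to\mathfrak X_{\mathrm{proj}}(\Gamma_l(\pi)),$$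 together with $\mathfrak X_{\mathrm{proj}}(\Gamma_0(\pi))\to\mathfrak X_{\mathrm{proj}}(B)$, each sending a field $V$ to the unique field of its target to which $V$ projects; they are compatible with composition of the projections, and $(\pi^{k,\mathrm g})_*\circ\mathfrak p^{\mathrm g}=\mathfrak p^k$, $(\pi^{l,k})_*\circ\mathfrak p^k=\mathfrak p^l$, while the map to $\mathfrak X_{\mathrm{proj}}(B)$ sends $\mathfrak p^0(X)$ to $X$. -/

import Mathlib

open scoped Manifold ContDiff Topology
open Diffeology

noncomputable section

namespace GermBundle

/-- The parameter spaces of plots. -/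
abbrev Euc (n : ℕ) : Type := EuclideanSpace ℝ (Fin n)

/-! ### Diffeological preliminaries -/

section Plots

variable {X Y : Type*}

/-- A plot of `X` with open domain `U ⊆ ℝⁿ` (the values of `p` outside `U` are irrelevant). Mathlib's
diffeologies only record the plots defined on all of `ℝⁿ`; those defined on `U` are the maps whose
composites with all smooth `ℝᵐ → U` are plots. -/
def IsPlotOn [DiffeologicalSpace X] {n : ℕ} (U : Set (Euc n)) (p : Euc n → X) : Prop :=
  ∀ ⦃m : ℕ⦄ (f : Euc m → Euc n), (∀ x, f x ∈ U) → ContDiff ℝ ∞ f → IsPlot (p ∘ f)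

theorem isPlotOn_univ [DiffeologicalSpace X] {n : ℕ} {p : Euc n → X} :
    IsPlotOn Set.univ p ↔ IsPlot p :=
  ⟨fun h => h id (fun _ => Set.mem_univ _) contDiff_id, fun h _ _ _ hf => isPlot_reparam h hf⟩

theorem IsPlotOn.congr [DiffeologicalSpace X] {n : ℕ} {U : Set (Euc n)} {p q : Euc n → X}
    (hp : IsPlotOn U p) (h : Set.EqOn p q U) : IsPlotOn U q := by
  intro m f hf hs
  have : q ∘ f = p ∘ f := funext fun x => (h (hf x)).symm
  rw [this]
  exact hp f hf hs

theorem IsPlotOn.comp [DiffeologicalSpace X] {n m : ℕ} {U : Set (Euc n)} {V : Set (Euc m)}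
    {p : Euc n → X} {f : Euc m → Euc n} (hp : IsPlotOn U p) (hf : ContDiffOn ℝ ∞ f V)
    (h : Set.MapsTo f V U) : IsPlotOn V (p ∘ f) := by
  intro l g hg hs
  refine hp (f ∘ g) (fun x => h (hg x)) ?_
  exact hf.comp_contDiff hs hg

theorem IsPlotOn.dSmooth_comp [DiffeologicalSpace X] [DiffeologicalSpace Y] {n : ℕ}
    {U : Set (Euc n)} {p : Euc n → X} {f : X → Y} (hp : IsPlotOn U p) (hf : DSmooth f) :
    IsPlotOn U (f ∘ p) :=
  fun _ g hg hs => hf _ _ (hp g hg hs)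

/-- For a diffeology that is given by its plots on open sets, `IsPlotOn` returns these plots. -/
theorem isPlotOn_ofCorePlotsOn (d : DiffeologicalSpace.CorePlotsOn X) {n : ℕ} {U : Set (Euc n)}
    (hU : IsOpen U) {p : Euc n → X} :
    @IsPlotOn X (DiffeologicalSpace.ofCorePlotsOn d) n U p ↔ d.isPlotOn hU p := by
  constructor
  · intro h
    refine d.locality hU fun x hx => ?_
    obtain ⟨ε, hε, hεU⟩ := Metric.isOpen_iff.mp hU x hx
    have h1 : d.isPlot (p ∘ OpenPartialHomeomorph.univBall x ε) := by
      refine h _ (fun y => hεU ?_) OpenPartialHomeomorph.contDiff_univBall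
      have := (OpenPartialHomeomorph.univBall x ε).map_source (x := y)
      rw [OpenPartialHomeomorph.univBall_target x hε] at this
      exact this (by simp)
    have h2 := d.isPlotOn_reparam Metric.isOpen_ball (Set.mapsTo_univ _ _)
      (d.isPlotOn_univ.mpr h1) (OpenPartialHomeomorph.contDiffOn_univBall_symm (c := x) (r := ε))
    refine ⟨_, Metric.isOpen_ball, Metric.mem_ball_self hε, (d.isPlotOn_congr _ ?_).mp h2⟩
    intro y hy
    have : OpenPartialHomeomorph.univBall x ε ((OpenPartialHomeomorph.univBall x ε).symm y) = y :=
      (OpenPartialHomeomorph.univBall x ε).right_inv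
        (by rwa [OpenPartialHomeomorph.univBall_target x hε])
    simp [this]
  · intro h m f hf hs
    exact d.isPlotOn_univ.mp (d.isPlotOn_reparam _ (fun x _ => hf x) h hs.contDiffOn)

/-- The pushforward diffeology along `f : X → Y`: its plots are locally constant or locally of the
form `f ∘ P` for a plot `P` of `X`. -/
@[reducible]
def pushforwardDiffeology [DiffeologicalSpace X] (f : X → Y) : DiffeologicalSpace Y :=
  .ofCorePlotsOn {
    isPlotOn := fun {n} {U} _ p => ∀ u ∈ U, ∃ V : Set (Euc n), IsOpen V ∧ u ∈ V ∧ V ⊆ U ∧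
      ((∃ y, ∀ v ∈ V, p v = y) ∨ ∃ P : Euc n → X, IsPlotOn V P ∧ ∀ v ∈ V, p v = f (P v))
    isPlotOn_congr := by
      have key : ∀ {n : ℕ} {U : Set (Euc n)} {p q : Euc n → Y}, Set.EqOn p q U →
          (∀ u ∈ U, ∃ V : Set (Euc n), IsOpen V ∧ u ∈ V ∧ V ⊆ U ∧
            ((∃ y, ∀ v ∈ V, p v = y) ∨ ∃ P : Euc n → X, IsPlotOn V P ∧ ∀ v ∈ V, p v = f (P v))) →
          (∀ u ∈ U, ∃ V : Set (Euc n), IsOpen V ∧ u ∈ V ∧ V ⊆ U ∧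
            ((∃ y, ∀ v ∈ V, q v = y) ∨
              ∃ P : Euc n → X, IsPlotOn V P ∧ ∀ v ∈ V, q v = f (P v))) := by
        intro n U p q h hp u hu
        obtain ⟨V, hV, huV, hVU, h'⟩ := hp u hu
        refine ⟨V, hV, huV, hVU, ?_⟩
        rcases h' with ⟨y, hy⟩ | ⟨P, hP, hPf⟩
        · exact Or.inl ⟨y, fun v hv => (h (hVU hv)).symm.trans (hy v hv)⟩
        · exact Or.inr ⟨P, hP, fun v hv => (h (hVU hv)).symm.trans (hPf v hv)⟩
      intro n U hU p q h
      exact ⟨key h, key h.symm⟩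
    isPlot_const := fun x u _ =>
      ⟨Set.univ, isOpen_univ, Set.mem_univ _, subset_rfl, Or.inl ⟨x, fun _ _ => rfl⟩⟩
    isPlotOn_reparam := by
      intro n m U V hU hV p g hg hp hs u hu
      obtain ⟨W, hW, huW, hWU, h'⟩ := hp (g u) (hg hu)
      refine ⟨V ∩ g ⁻¹' W, hs.continuousOn.isOpen_inter_preimage hV hW, ⟨hu, huW⟩,
        Set.inter_subset_left, ?_⟩
      rcases h' with ⟨y, hy⟩ | ⟨P, hP, hPf⟩
      · exact Or.inl ⟨y, fun v hv => hy _ hv.2⟩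
      · exact Or.inr ⟨P ∘ g, hP.comp (hs.mono Set.inter_subset_left) (fun v hv => hv.2),
          fun v hv => hPf _ hv.2⟩
    locality := by
      intro n U hU p hp u hu
      obtain ⟨V, hV, huV, h⟩ := hp u hu
      obtain ⟨W, hW, huW, hWV, h'⟩ := h u huV
      refine ⟨W ∩ U, hW.inter hU, ⟨huW, hu⟩, Set.inter_subset_right, ?_⟩
      rcases h' with ⟨y, hy⟩ | ⟨P, hP, hPf⟩
      · exact Or.inl ⟨y, fun v hv => hy _ hv.1⟩
      · exact Or.inr ⟨P, hP.comp (f := id) contDiffOn_id (fun v hv => hv.1),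
          fun v hv => hPf _ hv.1⟩ }

end Plots

/-! ### Internal tangent spaces and differentials -/

section Tangent

variable {X Y : Type*} [DiffeologicalSpace X] [DiffeologicalSpace Y]

/-- A plot of `X` defined on an open neighbourhood `dom` of `0` in some `ℝⁿ` with value `x` at `0`. -/
structure CenteredPlot (x : X) where
  dim : ℕ
  dom : Set (Euc dim)
  isOpen_dom : IsOpen dom
  zero_mem : (0 : Euc dim) ∈ dom
  toFun : Euc dim → X
  isPlotOn : IsPlotOn dom toFun
  map_zero : toFun 0 = x

open Classical in
/-- The direct sum, over all plots centered at `x`, of the tangent spaces at `0` of their domains. -/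
abbrev PlotVectors (x : X) : Type _ := DirectSum (CenteredPlot x) (fun φ => Euc φ.dim)

open Classical in
/-- The vector `v` in the summand of `φ`. -/
def plotVector {x : X} (φ : CenteredPlot x) : Euc φ.dim →ₗ[ℝ] PlotVectors x :=
  DirectSum.lof ℝ (CenteredPlot x) (fun φ => Euc φ.dim) φ

/-- The subspace generated by the vectors `(f_* v)_φ - v_{φ ∘ f}`. -/
def plotRelations (x : X) : Submodule ℝ (PlotVectors x) :=
  Submodule.span ℝ {w | ∃ (φ ψ : CenteredPlot x) (f : Euc ψ.dim → Euc φ.dim) (v : Euc ψ.dim),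
    ContDiffOn ℝ ∞ f ψ.dom ∧ Set.MapsTo f ψ.dom φ.dom ∧ f 0 = 0 ∧
    Set.EqOn ψ.toFun (φ.toFun ∘ f) ψ.dom ∧
    w = plotVector φ (fderiv ℝ f 0 v) - plotVector ψ v}

/-- The internal tangent space of a diffeological space at `x`. -/
abbrev InternalTangentSpace (x : X) : Type _ := PlotVectors x ⧸ plotRelations x

/-- The class `φ_* v` of a vector `v` at the centre of a plot. -/
def plotClass {x : X} (φ : CenteredPlot x) : Euc φ.dim →ₗ[ℝ] InternalTangentSpace x :=
  (plotRelations x).mkQ ∘ₗ plotVector φ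

variable (X) in
/-- The (underlying set of the) internal tangent bundle. -/
abbrev InternalTangentBundle : Type _ := Σ x : X, InternalTangentSpace x

/-- Composition of a centered plot with a smooth map. -/
def CenteredPlot.map {f : X → Y} (hf : DSmooth f) {x : X} (φ : CenteredPlot x) :
    CenteredPlot (f x) where
  dim := φ.dim
  dom := φ.dom
  isOpen_dom := φ.isOpen_dom
  zero_mem := φ.zero_mem
  toFun := f ∘ φ.toFun
  isPlotOn := φ.isPlotOn.dSmooth_comp hf
  map_zero := congrArg f φ.map_zero

open Classical in
/-- The linear extension of `v_φ ↦ (f ∘ φ)_* v`. -/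
def differentialAux {f : X → Y} (hf : DSmooth f) (x : X) :
    PlotVectors x →ₗ[ℝ] InternalTangentSpace (f x) :=
  DirectSum.toModule ℝ (CenteredPlot x) _ (fun φ => plotClass (φ.map hf))

theorem differentialAux_plotVector {f : X → Y} (hf : DSmooth f) {x : X} (φ : CenteredPlot x)
    (v : Euc φ.dim) : differentialAux hf x (plotVector φ v) = plotClass (φ.map hf) v := by
  classical
  simp only [differentialAux, plotVector]
  exact DirectSum.toModule_lof (R := ℝ) (M := fun φ : CenteredPlot _ => Euc φ.dim) φ v

theorem plotRelations_le_ker {f : X → Y} (hf : DSmooth f) (x : X) :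
    plotRelations x ≤ LinearMap.ker (differentialAux hf x) := by
  refine Submodule.span_le.mpr ?_
  rintro _ ⟨φ, ψ, g, v, hg, hm, h0, he, rfl⟩
  simp only [SetLike.mem_coe, LinearMap.mem_ker, map_sub, differentialAux_plotVector]
  have : plotVector (φ.map hf) (fderiv ℝ g 0 v) - plotVector (ψ.map hf) v ∈
      plotRelations (f x) :=
    Submodule.subset_span ⟨φ.map hf, ψ.map hf, g, v, hg, hm, h0,
      fun u hu => congrArg f (he hu), rfl⟩
  have h := (Submodule.Quotient.mk_eq_zero (plotRelations (f x))).mpr this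
  exact h

/-- The differential at `x` of a smooth map of diffeological spaces:
`φ_* v ↦ (f ∘ φ)_* v`, extended linearly. -/
def differential {f : X → Y} (hf : DSmooth f) (x : X) :
    InternalTangentSpace x →ₗ[ℝ] InternalTangentSpace (f x) :=
  (plotRelations x).liftQ (differentialAux hf x) (plotRelations_le_ker hf x)

/-- The differential as a map of internal tangent bundles. -/
def internalTangentMap {f : X → Y} (hf : DSmooth f) : InternalTangentBundle X → InternalTangentBundle Y :=
  fun v => ⟨f v.1, differential hf v.1 v.2⟩

/-- `c` is a smooth curve through `x` at time `0`: its restriction to some interval `(-ε, ε)` is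
a plot, with value `x` at `0`. -/
def IsSmoothCurveAt (c : ℝ → X) (x : X) : Prop :=
  c 0 = x ∧ ∃ ε : ℝ, 0 < ε ∧ IsPlotOn {u : Euc 1 | |u 0| < ε} (fun u => c (u 0))

open Classical in
/-- The tangent vector `d/dt|₀ c(t)` at `x` of a curve through `x` (zero if `c` is not a smooth curve
through `x`). -/
def velocityAt (x : X) (c : ℝ → X) : InternalTangentSpace x :=
  if h : IsSmoothCurveAt c x then
    plotClass (x := x)
      { dim := 1
        dom := {u : Euc 1 | |u 0| < h.2.choose}
        isOpen_dom := isOpen_lt (by fun_prop) continuous_const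
        zero_mem := by simpa using h.2.choose_spec.1
        toFun := fun u => c (u 0)
        isPlotOn := h.2.choose_spec.2
        map_zero := by simpa using h.1 }
      (EuclideanSpace.single 0 1)
  else 0

end Tangent

/-! ### Manifolds as diffeological spaces -/

section Manifold

/-- A manifold `N` (modelled on `E`), regarded as a diffeological space. -/
def AsDiffeological (_E N : Type*) : Type _ := N

instance (E N : Type*) [TopologicalSpace N] : TopologicalSpace (AsDiffeological E N) :=
  inferInstanceAs (TopologicalSpace N)

instance (E N : Type*) [TopologicalSpace E] [TopologicalSpace N] [ChartedSpace E N] :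
    ChartedSpace E (AsDiffeological E N) :=
  inferInstanceAs (ChartedSpace E N)

variable (E : Type*) [NormedAddCommGroup E] [NormedSpace ℝ E]
  (N : Type*) [TopologicalSpace N] [ChartedSpace E N]

/-- The plots of a manifold are the smooth parametrisations. -/
def manifoldCorePlots : DiffeologicalSpace.CorePlotsOn (AsDiffeological E N) where
  isPlotOn := fun {n} {U} _ p =>
    ContMDiffOn 𝓘(ℝ, Euc n) 𝓘(ℝ, E) ∞ p U
  isPlotOn_congr := fun _ _ _ h => ⟨fun hp => hp.congr fun u hu => (h hu).symm,
    fun hq => hq.congr fun _ hu => h hu⟩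
  isPlot_const := fun _ => contMDiffOn_const
  isPlotOn_reparam := fun _ _ _ h hp hf => ContMDiffOn.comp hp hf.contMDiffOn h
  locality := fun _ _ h u hu => by
    obtain ⟨V, hV, huV, hp⟩ := h u hu
    exact (hp.contMDiffAt (hV.mem_nhds huV)).contMDiffWithinAt

instance : DiffeologicalSpace (AsDiffeological E N) := .ofCorePlotsOn (manifoldCorePlots E N)

variable {E N}

/-- The plot `φ` centered at `b` induces the linear map `v ↦ dφ₀ v` into the usual tangent space. -/
def plotDerivative {b : AsDiffeological E N} (φ : CenteredPlot b) :
    Euc φ.dim →ₗ[ℝ] TangentSpace 𝓘(ℝ, E) b :=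
  (show Euc φ.dim →L[ℝ] E from
    mfderiv 𝓘(ℝ, Euc φ.dim) 𝓘(ℝ, E) φ.toFun 0).toLinearMap

open Classical in
/-- The linear extension of `v_φ ↦ dφ₀ v`. -/
def toTangentSpaceAux (b : AsDiffeological E N) :
    PlotVectors b →ₗ[ℝ] TangentSpace 𝓘(ℝ, E) b :=
  DirectSum.toModule ℝ (CenteredPlot b) _ (fun φ => plotDerivative φ)

theorem toTangentSpaceAux_plotVector {b : AsDiffeological E N} (φ : CenteredPlot b)
    (v : Euc φ.dim) : toTangentSpaceAux b (plotVector φ v) = plotDerivative φ v := by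
  classical
  simp only [toTangentSpaceAux, plotVector]
  exact DirectSum.toModule_lof (R := ℝ) (M := fun φ : CenteredPlot _ => Euc φ.dim) φ v

theorem plotDerivative_comp {b : AsDiffeological E N} (φ ψ : CenteredPlot b)
    (f : Euc ψ.dim → Euc φ.dim) (v : Euc ψ.dim) (hf : ContDiffOn ℝ ∞ f ψ.dom)
    (h0 : f 0 = 0) (he : Set.EqOn ψ.toFun (φ.toFun ∘ f) ψ.dom) :
    plotDerivative φ (fderiv ℝ f 0 v) = plotDerivative ψ v := by
  have hψ : ψ.dom ∈ 𝓝 (0 : Euc ψ.dim) := ψ.isOpen_dom.mem_nhds ψ.zero_mem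
  have hφ : MDifferentiableAt 𝓘(ℝ, Euc φ.dim) 𝓘(ℝ, E) φ.toFun (f 0) := by
    have h1 : ContMDiffOn 𝓘(ℝ, Euc φ.dim) 𝓘(ℝ, E) ∞ φ.toFun φ.dom :=
      (isPlotOn_ofCorePlotsOn (manifoldCorePlots E N) φ.isOpen_dom).mp φ.isPlotOn
    rw [h0]
    exact (h1.contMDiffAt (φ.isOpen_dom.mem_nhds φ.zero_mem)).mdifferentiableAt (by simp)
  have hfd : DifferentiableAt ℝ f 0 := (hf.contDiffAt hψ).differentiableAt (by simp)
  have e1 : mfderiv 𝓘(ℝ, Euc ψ.dim) 𝓘(ℝ, E) ψ.toFun 0 =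
      mfderiv 𝓘(ℝ, Euc ψ.dim) 𝓘(ℝ, E) (φ.toFun ∘ f) 0 :=
    Filter.EventuallyEq.mfderiv_eq (Filter.eventuallyEq_of_mem hψ he)
  have e2 := mfderiv_comp (0 : Euc ψ.dim) hφ hfd.mdifferentiableAt
  have e3 : ∀ z : Euc φ.dim, z = 0 → ∀ w : Euc φ.dim,
      (mfderiv 𝓘(ℝ, Euc φ.dim) 𝓘(ℝ, E) φ.toFun z w : E) =
        (mfderiv 𝓘(ℝ, Euc φ.dim) 𝓘(ℝ, E) φ.toFun 0 w : E) := by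
    rintro _ rfl _
    rfl
  have e4 := congrArg (fun L : Euc ψ.dim →L[ℝ] E => L v) (e1.trans e2)
  refine Eq.trans (e3 (f 0) h0 _).symm (Eq.trans ?_ e4.symm)
  rw [mfderiv_eq_fderiv]
  rfl

/-- The canonical linear map (an isomorphism) from the internal tangent space of a manifold, as a
diffeological space, to its usual tangent space: `φ_* v ↦ dφ₀ v`. -/
def toTangentSpace (b : AsDiffeological E N) :
    InternalTangentSpace b →ₗ[ℝ] TangentSpace 𝓘(ℝ, E) b :=
  (plotRelations b).liftQ (toTangentSpaceAux b) <| by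
    refine Submodule.span_le.mpr ?_
    rintro _ ⟨φ, ψ, f, v, hf, -, h0, he, rfl⟩
    simp only [SetLike.mem_coe, LinearMap.mem_ker, map_sub, toTangentSpaceAux_plotVector,
      plotDerivative_comp φ ψ f v hf h0 he, sub_self]

/-- `toTangentSpace` as a map of tangent bundles. -/
def toTangentBundle (v : InternalTangentBundle (AsDiffeological E N)) :
    TangentBundle 𝓘(ℝ, E) N :=
  ⟨v.1, toTangentSpace v.1 v.2⟩

end Manifold

/-! ### Fibre bundles, sections, germs -/

section Bundle

variable (E EB EF : Type*)
  [NormedAddCommGroup E] [NormedSpace ℝ E]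
  [NormedAddCommGroup EB] [NormedSpace ℝ EB]
  [NormedAddCommGroup EF] [NormedSpace ℝ EF]
  {M B : Type*} [TopologicalSpace M] [ChartedSpace E M] [TopologicalSpace B] [ChartedSpace EB B]

/-- `π : B → M` is a smooth fibre bundle with fibre `F`. Here `E`, `EB`, `EF` are the spaces on which
`M`, `B`, `F` are modelled. -/
structure IsFibreBundle (F : Type*) [TopologicalSpace F] [ChartedSpace EF F] (π : B → M) :
    Prop where
  smooth : ContMDiff 𝓘(ℝ, EB) 𝓘(ℝ, E) ∞ π
  surjective : Function.Surjective π
  locally_trivial : ∀ x : M, ∃ e : Bundle.Trivialization F π, x ∈ e.baseSet ∧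
    ContMDiffOn 𝓘(ℝ, EB) (𝓘(ℝ, E).prod 𝓘(ℝ, EF)) ∞ e e.source ∧
    ContMDiffOn (𝓘(ℝ, E).prod 𝓘(ℝ, EF)) 𝓘(ℝ, EB) ∞ e.toOpenPartialHomeomorph.symm e.target

/-- A smooth section of `π` defined on an open set `dom` (its values outside `dom` are
irrelevant). -/
structure LocalSection (π : B → M) where
  dom : Set M
  isOpen_dom : IsOpen dom
  toFun : M → B
  smooth : ContMDiffOn 𝓘(ℝ, E) 𝓘(ℝ, EB) ∞ toFun dom
  proj : ∀ y ∈ dom, π (toFun y) = y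

/-- The space `Γ_loc` of pairs `(x, σ)` of a local section `σ` and a point `x` of its domain. -/
structure PointedSection (π : B → M) where
  pt : M
  sec : LocalSection E EB π
  mem : pt ∈ sec.dom

variable {E EB} in
/-- The value `σ(x)`. -/
def PointedSection.value {π : B → M} (p : PointedSection E EB π) : B := p.sec.toFun p.pt

/-- The diffeology of `Γ_loc` as a subspace of the product of `M` and of the space of local sections
with its functional diffeology. -/
def pointedSectionCorePlots (π : B → M) :
    DiffeologicalSpace.CorePlotsOn (PointedSection E EB π) where
  isPlotOn := fun {n} {U} _ p =>
    ContMDiffOn 𝓘(ℝ, Euc n) 𝓘(ℝ, E) ∞ (fun u => (p u).pt) U ∧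
    ∀ u₀ ∈ U, ∀ x₀ ∈ (p u₀).sec.dom, ∃ (V : Set (Euc n)) (O : Set M),
      IsOpen V ∧ u₀ ∈ V ∧ V ⊆ U ∧ IsOpen O ∧ x₀ ∈ O ∧ (∀ u ∈ V, O ⊆ (p u).sec.dom) ∧
      ContMDiffOn (𝓘(ℝ, Euc n).prod 𝓘(ℝ, E)) 𝓘(ℝ, EB) ∞
        (fun w : Euc n × M => (p w.1).sec.toFun w.2) (V ×ˢ O)
  isPlotOn_congr := by
    have key : ∀ {n : ℕ} {U : Set (Euc n)} {p q : Euc n → PointedSection E EB π},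
        Set.EqOn p q U →
        (ContMDiffOn 𝓘(ℝ, Euc n) 𝓘(ℝ, E) ∞ (fun u => (p u).pt) U ∧
          ∀ u₀ ∈ U, ∀ x₀ ∈ (p u₀).sec.dom, ∃ (V : Set (Euc n)) (O : Set M),
            IsOpen V ∧ u₀ ∈ V ∧ V ⊆ U ∧ IsOpen O ∧ x₀ ∈ O ∧ (∀ u ∈ V, O ⊆ (p u).sec.dom) ∧
            ContMDiffOn (𝓘(ℝ, Euc n).prod 𝓘(ℝ, E)) 𝓘(ℝ, EB) ∞
              (fun w : Euc n × M => (p w.1).sec.toFun w.2) (V ×ˢ O)) →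
        (ContMDiffOn 𝓘(ℝ, Euc n) 𝓘(ℝ, E) ∞ (fun u => (q u).pt) U ∧
          ∀ u₀ ∈ U, ∀ x₀ ∈ (q u₀).sec.dom, ∃ (V : Set (Euc n)) (O : Set M),
            IsOpen V ∧ u₀ ∈ V ∧ V ⊆ U ∧ IsOpen O ∧ x₀ ∈ O ∧ (∀ u ∈ V, O ⊆ (q u).sec.dom) ∧
            ContMDiffOn (𝓘(ℝ, Euc n).prod 𝓘(ℝ, E)) 𝓘(ℝ, EB) ∞
              (fun w : Euc n × M => (q w.1).sec.toFun w.2) (V ×ˢ O)) := by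
      rintro n U p q h ⟨h1, h2⟩
      refine ⟨h1.congr fun u hu => by rw [h hu], fun u₀ hu₀ x₀ hx₀ => ?_⟩
      rw [← h hu₀] at hx₀
      obtain ⟨V, O, hV, hu, hVU, hO, hx, hd, hs⟩ := h2 u₀ hu₀ x₀ hx₀
      refine ⟨V, O, hV, hu, hVU, hO, hx, fun u hu => by rw [← h (hVU hu)]; exact hd u hu,
        hs.congr fun w hw => by rw [h (hVU hw.1)]⟩
    intro n U hU p q h
    exact ⟨key h, key h.symm⟩
  isPlot_const := fun p => ⟨contMDiffOn_const, fun u₀ _ x₀ hx₀ =>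
    ⟨Set.univ, p.sec.dom, isOpen_univ, Set.mem_univ _, subset_rfl, p.sec.isOpen_dom, hx₀,
      fun _ _ => subset_rfl, p.sec.smooth.comp contMDiffOn_snd fun w hw => hw.2⟩⟩
  isPlotOn_reparam := by
    rintro n m U V hU hV p f hf ⟨h1, h2⟩ hs
    refine ⟨h1.comp hs.contMDiffOn hf, fun u₀ hu₀ x₀ hx₀ => ?_⟩
    obtain ⟨W, O, hW, hu, hWU, hO, hx, hd, hsm⟩ := h2 (f u₀) (hf hu₀) x₀ hx₀
    refine ⟨V ∩ f ⁻¹' W, O, hs.continuousOn.isOpen_inter_preimage hV hW, ⟨hu₀, hu⟩,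
      Set.inter_subset_left, hO, hx, fun u hu => hd _ hu.2, ?_⟩
    have hfst : ContMDiffOn (𝓘(ℝ, Euc m).prod 𝓘(ℝ, E)) 𝓘(ℝ, Euc n) ∞
        (fun w : Euc m × M => f w.1) ((V ∩ f ⁻¹' W) ×ˢ O) :=
      hs.contMDiffOn.comp contMDiffOn_fst fun w hw => hw.1.1
    exact hsm.comp (hfst.prodMk contMDiffOn_snd) fun w hw => ⟨hw.1.2, hw.2⟩
  locality := by
    intro n U hU p hp
    refine ⟨fun u hu => ?_, fun u₀ hu₀ x₀ hx₀ => ?_⟩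
    · obtain ⟨V, hV, huV, h⟩ := hp u hu
      exact (h.1.contMDiffAt (hV.mem_nhds huV)).contMDiffWithinAt
    · obtain ⟨V, hV, huV, h⟩ := hp u₀ hu₀
      obtain ⟨W, O, hW, hu, hWV, hO, hx, hd, hs⟩ := h.2 u₀ huV x₀ hx₀
      exact ⟨W ∩ U, O, hW.inter hU, ⟨hu, hu₀⟩, Set.inter_subset_right, hO, hx,
        fun u hu => hd u hu.1, hs.mono (Set.prod_mono Set.inter_subset_left subset_rfl)⟩

instance (π : B → M) : DiffeologicalSpace (PointedSection E EB π) :=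
  .ofCorePlotsOn (pointedSectionCorePlots E EB π)

/-- `(x, σ) ∼ (y, η)` iff `x = y` and `σ`, `η` have the same germ at `x`. -/
def germSetoid (π : B → M) : Setoid (PointedSection E EB π) where
  r p q := p.pt = q.pt ∧ p.sec.toFun =ᶠ[𝓝 p.pt] q.sec.toFun
  iseqv :=
    { refl := fun _ => ⟨rfl, Filter.EventuallyEq.rfl⟩
      symm := fun h => ⟨h.1.symm, h.1 ▸ h.2.symm⟩
      trans := fun h h' => ⟨h.1.trans h'.1, h.2.trans (h.1 ▸ h'.2)⟩ }

/-- The bundle of germs `Γ_g(π)`. -/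
def Germ (π : B → M) : Type _ := Quotient (germSetoid E EB π)

variable {E EB} in
/-- The germ `(x, [σ]ᵍₓ)`. -/
def germ {π : B → M} (p : PointedSection E EB π) : Germ E EB π := Quotient.mk (germSetoid E EB π) p

/-- `Γ_g(π)` carries the quotient diffeology. -/
instance (π : B → M) : DiffeologicalSpace (Germ E EB π) := pushforwardDiffeology germ

/-! ### Jets -/

/-- Fibred local coordinates `b ↦ (x, f)` of `B` with values in `E × EF`, lying over local
coordinates `x` of `M`. -/
structure FibredChart (π : B → M) where
  base : OpenPartialHomeomorph M E
  total : OpenPartialHomeomorph B (E × EF)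
  base_smooth : ContMDiffOn 𝓘(ℝ, E) 𝓘(ℝ, E) ∞ base base.source
  base_symm_smooth : ContMDiffOn 𝓘(ℝ, E) 𝓘(ℝ, E) ∞ base.symm base.target
  total_smooth : ContMDiffOn 𝓘(ℝ, EB) 𝓘(ℝ, E × EF) ∞ total total.source
  total_symm_smooth : ContMDiffOn 𝓘(ℝ, E × EF) 𝓘(ℝ, EB) ∞ total.symm total.target
  proj : ∀ b ∈ total.source, π b ∈ base.source ∧ (total b).1 = base (π b)

variable {E EB EF} in
/-- The collection of all partial derivatives of order `j` at `x` of the coordinate expression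
`f ∘ σ ∘ x⁻¹` of a section `σ`. -/
def FibredChart.deriv {π : B → M} (c : FibredChart E EB EF π) (j : ℕ)
    (p : PointedSection E EB π) : E [×j]→L[ℝ] EF :=
  iteratedFDeriv ℝ j (fun z => (c.total (p.sec.toFun (c.base.symm z))).2) (c.base p.pt)

/-- `(x, σ) ∼ (y, η)` iff `x = y` and `σ`, `η` have the same `k`-jet at `x`. -/
def jetSetoid (π : B → M) (k : ℕ) : Setoid (PointedSection E EB π) where
  r p q := p.pt = q.pt ∧ p.value = q.value ∧
    ∀ c : FibredChart E EB EF π, p.value ∈ c.total.source → ∀ j ≤ k, c.deriv j p = c.deriv j q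
  iseqv :=
    { refl := fun _ => ⟨rfl, rfl, fun _ _ _ _ => rfl⟩
      symm := fun h => ⟨h.1.symm, h.2.1.symm, fun c hc j hj => (h.2.2 c (h.2.1 ▸ hc) j hj).symm⟩
      trans := fun h h' => ⟨h.1.trans h'.1, h.2.1.trans h'.2.1, fun c hc j hj =>
        (h.2.2 c hc j hj).trans (h'.2.2 c (h.2.1 ▸ hc) j hj)⟩ }

/-- The bundle `Γ_k(π)` of `k`-jets of local sections, for finite `k`. -/
def Jet (π : B → M) (k : ℕ) : Type _ := Quotient (jetSetoid E EB EF π k)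

variable {E EB}

/-- The `k`-jet `(x, [σ]ᵏₓ)`. -/
def jet {π : B → M} (k : ℕ) (p : PointedSection E EB π) : Jet E EB EF π k :=
  Quotient.mk (jetSetoid E EB EF π k) p

variable {EF}

/-- The projection `Γ_k(π) → M`. -/
def jetPt {π : B → M} {k : ℕ} (θ : Jet E EB EF π k) : M :=
  Quotient.lift (s := jetSetoid E EB EF π k) (fun p => p.pt) (fun _ _ h => h.1) θ

/-- The projection `Γ_k(π) → B`, `[σ]ᵏₓ ↦ σ(x)`. -/
def jetValue {π : B → M} {k : ℕ} (θ : Jet E EB EF π k) : AsDiffeological EB B :=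
  Quotient.lift (s := jetSetoid E EB EF π k) (fun p => p.value) (fun _ _ h => h.2.1) θ

open Classical in
/-- The jet coordinates of order `j ≤ k` over the domain of a fibred chart (zero over the complement
of this domain). -/
def jetCoord {π : B → M} {k : ℕ} (c : FibredChart E EB EF π) (j : ℕ) (hj : j ≤ k)
    (θ : Jet E EB EF π k) : E [×j]→L[ℝ] EF :=
  Quotient.lift (s := jetSetoid E EB EF π k)
    (fun p => if p.value ∈ c.total.source then c.deriv j p else 0)
    (fun p q h => by
      show (if p.value ∈ c.total.source then c.deriv j p else 0) =
        (if q.value ∈ c.total.source then c.deriv j q else 0)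
      by_cases hp : p.value ∈ c.total.source
      · rw [if_pos hp, if_pos (h.2.1 ▸ hp), h.2.2 c hp j hj]
      · rw [if_neg hp, if_neg (h.2.1 ▸ hp)]) θ

variable (E EB EF)

/-- The manifold diffeology of `Γ_k(π)`: a parametrisation is smooth iff for every fibred chart its
preimage is open and the jet coordinates `(x, f, ∂f, …, ∂ᵏf)` depend smoothly on the parameter
there. -/
def jetCorePlots (π : B → M) (k : ℕ) : DiffeologicalSpace.CorePlotsOn (Jet E EB EF π k) where
  isPlotOn := fun {_} {U} _ p => ∀ c : FibredChart E EB EF π,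
    IsOpen (U ∩ {u | jetValue (p u) ∈ c.total.source}) ∧
    ContDiffOn ℝ ∞ (fun u => c.base (jetPt (p u))) (U ∩ {u | jetValue (p u) ∈ c.total.source}) ∧
    ∀ (j : ℕ) (hj : j ≤ k), ContDiffOn ℝ ∞ (fun u => jetCoord c j hj (p u))
      (U ∩ {u | jetValue (p u) ∈ c.total.source})
  isPlotOn_congr := by
    have key : ∀ {n : ℕ} {U : Set (Euc n)} {p q : Euc n → Jet E EB EF π k}, Set.EqOn p q U →
        (∀ c : FibredChart E EB EF π,
          IsOpen (U ∩ {u | jetValue (p u) ∈ c.total.source}) ∧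
          ContDiffOn ℝ ∞ (fun u => c.base (jetPt (p u)))
            (U ∩ {u | jetValue (p u) ∈ c.total.source}) ∧
          ∀ (j : ℕ) (hj : j ≤ k), ContDiffOn ℝ ∞ (fun u => jetCoord c j hj (p u))
            (U ∩ {u | jetValue (p u) ∈ c.total.source})) →
        (∀ c : FibredChart E EB EF π,
          IsOpen (U ∩ {u | jetValue (q u) ∈ c.total.source}) ∧
          ContDiffOn ℝ ∞ (fun u => c.base (jetPt (q u)))
            (U ∩ {u | jetValue (q u) ∈ c.total.source}) ∧
          ∀ (j : ℕ) (hj : j ≤ k), ContDiffOn ℝ ∞ (fun u => jetCoord c j hj (q u))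
            (U ∩ {u | jetValue (q u) ∈ c.total.source})) := by
      intro n U p q h hp c
      have hset : U ∩ {u | jetValue (q u) ∈ c.total.source} =
          U ∩ {u | jetValue (p u) ∈ c.total.source} := by
        ext u
        refine and_congr_right fun hu => ?_
        rw [Set.mem_ofPred_eq, Set.mem_ofPred_eq, h hu]
      obtain ⟨h1, h2, h3⟩ := hp c
      rw [hset]
      exact ⟨h1, h2.congr fun u hu => by rw [h hu.1],
        fun j hj => (h3 j hj).congr fun u hu => by rw [h hu.1]⟩
    intro n U hU p q h
    exact ⟨key h, key h.symm⟩
  isPlot_const := fun θ c =>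
    ⟨isOpen_univ.inter isOpen_const, contDiffOn_const, fun _ _ => contDiffOn_const⟩
  isPlotOn_reparam := by
    intro n m U V hU hV p f hf hp hs c
    obtain ⟨h1, h2, h3⟩ := hp c
    have hset : V ∩ {u | jetValue ((p ∘ f) u) ∈ c.total.source} =
        V ∩ f ⁻¹' (U ∩ {u | jetValue (p u) ∈ c.total.source}) := by
      ext u
      exact ⟨fun hu => ⟨hu.1, hf hu.1, hu.2⟩, fun hu => ⟨hu.1, hu.2.2⟩⟩
    rw [hset]
    have hs' := hs.mono (Set.inter_subset_left (s := V)
      (t := f ⁻¹' (U ∩ {u | jetValue (p u) ∈ c.total.source})))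
    exact ⟨hs.continuousOn.isOpen_inter_preimage hV h1, h2.comp hs' fun u hu => hu.2,
      fun j hj => (h3 j hj).comp hs' fun u hu => hu.2⟩
  locality := by
    intro n U hU p hp c
    have hnhds : ∀ u ∈ U ∩ {u | jetValue (p u) ∈ c.total.source}, ∃ V : Set (Euc n), IsOpen V ∧
        u ∈ V ∧ V ⊆ {u | jetValue (p u) ∈ c.total.source} ∧
        ContDiffOn ℝ ∞ (fun u => c.base (jetPt (p u))) V ∧
        ∀ (j : ℕ) (hj : j ≤ k), ContDiffOn ℝ ∞ (fun u => jetCoord c j hj (p u)) V := by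
      intro u hu
      obtain ⟨V, hV, huV, h⟩ := hp u hu.1
      exact ⟨_, (h c).1, ⟨huV, hu.2⟩, Set.inter_subset_right, (h c).2⟩
    refine ⟨isOpen_iff_mem_nhds.mpr fun u hu => ?_, fun u hu => ?_, fun j hj u hu => ?_⟩
    · obtain ⟨V, hV, huV, hVs, -⟩ := hnhds u hu
      exact Filter.inter_mem (hU.mem_nhds hu.1) (Filter.mem_of_superset (hV.mem_nhds huV) hVs)
    · obtain ⟨V, hV, huV, -, h, -⟩ := hnhds u hu
      exact (h.contDiffAt (hV.mem_nhds huV)).contDiffWithinAt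
    · obtain ⟨V, hV, huV, -, -, h⟩ := hnhds u hu
      exact ((h j hj).contDiffAt (hV.mem_nhds huV)).contDiffWithinAt

instance (π : B → M) (k : ℕ) : DiffeologicalSpace (Jet E EB EF π k) :=
  .ofCorePlotsOn (jetCorePlots E EB EF π k)

/-- The projection `Γ_k(π) → Γ_l(π)` for `l ≤ k`. -/
def jetProj (π : B → M) {l k : ℕ} (h : l ≤ k) : Jet E EB EF π k → Jet E EB EF π l :=
  Quotient.map' (s₁ := jetSetoid E EB EF π k) (s₂ := jetSetoid E EB EF π l) id
    fun _ _ hpq => ⟨hpq.1, hpq.2.1, fun c hc j hj => hpq.2.2 c hc j (hj.trans h)⟩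

theorem dSmooth_jetProj (π : B → M) {l k : ℕ} (h : l ≤ k) : DSmooth (jetProj E EB EF π h) := by
  intro n p hp c
  have hv : ∀ θ : Jet E EB EF π k, jetValue (jetProj E EB EF π h θ) = jetValue θ := by
    rintro ⟨p⟩
    rfl
  have hx : ∀ θ : Jet E EB EF π k, jetPt (jetProj E EB EF π h θ) = jetPt θ := by
    rintro ⟨p⟩
    rfl
  have hc : ∀ (j : ℕ) (hj : j ≤ l) (θ : Jet E EB EF π k),
      jetCoord c j hj (jetProj E EB EF π h θ) = jetCoord c j (hj.trans h) θ := by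
    rintro j hj ⟨p⟩
    rfl
  obtain ⟨h1, h2, h3⟩ := hp c
  simp only [Function.comp_apply, hv, hx, hc]
  exact ⟨h1, h2, fun j hj => h3 j (hj.trans h)⟩

/-- The infinite jet bundle `Γ_∞(π)`: the projective limit of the `Γ_k(π)`. -/
def JetInf (π : B → M) : Type _ :=
  {θ : ∀ k, Jet E EB EF π k // ∀ (l k : ℕ) (h : l ≤ k), jetProj E EB EF π h (θ k) = θ l}

/-- The projection `Γ_∞(π) → Γ_k(π)`. -/
def jetInfProj (π : B → M) (k : ℕ) (θ : JetInf E EB EF π) : Jet E EB EF π k := θ.1 k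

/-- `Γ_∞(π)` carries the projective limit diffeology. -/
instance (π : B → M) : DiffeologicalSpace (JetInf E EB EF π) where
  plots _ := {p | ∀ k, IsPlot (jetInfProj E EB EF π k ∘ p)}
  constant_plots _ := fun _ => isPlot_const
  plot_reparam hp hf := fun k => isPlot_reparam (hp k) hf
  locality {n p} h := fun k => DiffeologicalSpace.locality fun x => by
    obtain ⟨u, hu, hxu, h'⟩ := h x
    exact ⟨u, hu, hxu, fun hfu hf => h' hfu hf k⟩

theorem dSmooth_jetInfProj (π : B → M) (k : ℕ) : DSmooth (jetInfProj E EB EF π k) :=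
  fun _ _ hp => hp k

/-- Sections with the same germ have the same `k`-jet. -/
theorem jet_eq_of_germ_eq {π : B → M} (k : ℕ) (p q : PointedSection E EB π)
    (h : germSetoid E EB π p q) : jet EF k p = jet EF k q := by
  obtain ⟨hpt, hpq⟩ := h
  have hval : p.value = q.value := by
    unfold PointedSection.value
    rw [← hpt]
    exact hpq.eq_of_nhds
  refine Quotient.sound (s := jetSetoid E EB EF π k) ⟨hpt, hval, fun c hc j _ => ?_⟩
  have hb : p.pt ∈ c.base.source := by
    have := (c.proj _ hc).1
    rwa [PointedSection.value, p.sec.proj _ p.mem] at this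
  have ht : Filter.Tendsto c.base.symm (𝓝 (c.base p.pt)) (𝓝 p.pt) := by
    have := (c.base.continuousAt_symm (c.base.map_source hb)).tendsto
    rwa [c.base.left_inv hb] at this
  unfold FibredChart.deriv
  rw [← hpt]
  refine Filter.EventuallyEq.eq_of_nhds (Filter.EventuallyEq.iteratedFDeriv ℝ ?_ j)
  filter_upwards [ht.eventually hpq] with z hz
  rw [hz]

/-- The projection `π^{k,g} : Γ_g(π) → Γ_k(π)` for finite `k`. -/
def germToJet (π : B → M) (k : ℕ) (γ : Germ E EB π) : Jet E EB EF π k :=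
  Quotient.lift (s := germSetoid E EB π) (jet EF k) (jet_eq_of_germ_eq E EB EF k) γ

/-- The projection `π^{∞,g} : Γ_g(π) → Γ_∞(π)`. -/
def germToJetInf (π : B → M) (γ : Germ E EB π) : JetInf E EB EF π :=
  ⟨fun k => germToJet E EB EF π k γ, fun l k h => by
    obtain ⟨p⟩ := γ
    rfl⟩

/-- The projective limit of the tangent bundles of the `Γ_k(π)`, as a set of families of tangent
vectors. -/
def jetInfTangent (π : B → M) : Set (∀ k, InternalTangentBundle (Jet E EB EF π k)) :=
  {v | ∀ (l k : ℕ) (h : l ≤ k), internalTangentMap (dSmooth_jetProj E EB EF π h) (v k) = v l}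

/-- The canonical map from the internal tangent bundle of `Γ_∞(π)` to the projective limit of the
tangent bundles of the `Γ_k(π)`. -/
def jetInfTangentComparison (π : B → M) (v : InternalTangentBundle (JetInf E EB EF π)) :
    ∀ k, InternalTangentBundle (Jet E EB EF π k) :=
  fun k => internalTangentMap (dSmooth_jetInfProj E EB EF π k) v

/-! ### Flows and prolongations -/

/-- `X` is a smooth time-dependent vector field on the manifold `N`. -/
def IsSmoothField (E : Type*) [NormedAddCommGroup E] [NormedSpace ℝ E] {N : Type*}
    [TopologicalSpace N] [ChartedSpace E N] [IsManifold 𝓘(ℝ, E) ∞ N]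
    (X : ℝ → ∀ y : N, TangentSpace 𝓘(ℝ, E) y) : Prop :=
  ContMDiff (𝓘(ℝ, ℝ).prod 𝓘(ℝ, E)) 𝓘(ℝ, E).tangent ∞
    (fun w : ℝ × N => (⟨w.2, X w.1 w.2⟩ : TangentBundle 𝓘(ℝ, E) N))

/-- `Fl^X_{t,t₀}(x)` is defined and equal to `y`: some integral curve of the time-dependent vector
field `X`, defined on an open interval containing `t₀` and `t`, takes the values `x` at `t₀` and `y`
at `t`. -/
def FlowsTo (E : Type*) [NormedAddCommGroup E] [NormedSpace ℝ E] {N : Type*}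
    [TopologicalSpace N] [ChartedSpace E N] (X : ℝ → ∀ y : N, TangentSpace 𝓘(ℝ, E) y)
    (t₀ : ℝ) (x : N) (t : ℝ) (y : N) : Prop :=
  ∃ (c : ℝ → N) (a b : ℝ), t₀ ∈ Set.Ioo a b ∧ t ∈ Set.Ioo a b ∧ c t₀ = x ∧ c t = y ∧
    ∀ s ∈ Set.Ioo a b, HasMFDerivAt 𝓘(ℝ, ℝ) 𝓘(ℝ, E) c s
      ((1 : ℝ →L[ℝ] ℝ).smulRight (X s (c s) : E))

variable [IsManifold 𝓘(ℝ, E) ∞ M] [IsManifold 𝓘(ℝ, EB) ∞ B]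

/-- A (possibly time-dependent) projectable vector field `total` on `B`, together with the vector
field `base` on `M` to which it projects (`base` is determined by `total`, as `π` is surjective). -/
structure ProjectableField (π : B → M) where
  total : ℝ → ∀ b : B, TangentSpace 𝓘(ℝ, EB) b
  base : ℝ → ∀ x : M, TangentSpace 𝓘(ℝ, E) x
  total_smooth : IsSmoothField EB total
  base_smooth : IsSmoothField E base
  related : ∀ (t : ℝ) (b : B), mfderiv 𝓘(ℝ, EB) 𝓘(ℝ, E) π b (total t b) = base t (π b)

/-- The set `𝔛_proj(B)` of time-independent projectable vector fields. -/
def AutonomousField (π : B → M) : Type _ :=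
  {X : ProjectableField E EB π // ∀ t, X.total t = X.total 0}

variable {E EB}

/-- `(y, τ)` represents the germ of `Fl^X_{t,0} ∘ σ ∘ Fl^{π_*X}_{0,t}` at `y = Fl^{π_*X}_{t,0}(x)`. -/
def IsTransport {π : B → M} (X : ProjectableField E EB π) (p : PointedSection E EB π) (t : ℝ)
    (q : PointedSection E EB π) : Prop :=
  FlowsTo E X.base 0 p.pt t q.pt ∧
  ∀ᶠ y in 𝓝 q.pt, ∃ z ∈ p.sec.dom, FlowsTo E X.base t y 0 z ∧
    FlowsTo EB X.total 0 (p.sec.toFun z) t (q.sec.toFun y)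

open Classical in
/-- A representative of the germ of `Fl^X_{t,0} ∘ σ ∘ Fl^{π_*X}_{0,t}` at `Fl^{π_*X}_{t,0}(x)`, where
it exists (and `(x, σ)` where it does not). -/
def transport {π : B → M} (X : ProjectableField E EB π) (p : PointedSection E EB π) (t : ℝ) :
    PointedSection E EB π :=
  if h : ∃ q, IsTransport X p t q then h.choose else p

/-- The germinal prolongation `𝔭ᵍ(X)`, a section of the internal tangent bundle of `Γ_g(π)`. -/
def germProlongation {π : B → M} (X : ProjectableField E EB π) (γ : Germ E EB π) :
    InternalTangentBundle (Germ E EB π) :=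
  ⟨γ, velocityAt γ (fun t => germ (transport X (Quotient.out γ) t))⟩

variable {EF}

/-- The `k`-jet prolongation `𝔭ᵏ(X)` for finite `k`, a section of the tangent bundle of `Γ_k(π)`. -/
def jetProlongation {π : B → M} (k : ℕ) (X : ProjectableField E EB π) (θ : Jet E EB EF π k) :
    InternalTangentBundle (Jet E EB EF π k) :=
  ⟨θ, velocityAt θ (fun t => jet EF k (transport X (Quotient.out θ) t))⟩

/-- The `∞`-jet prolongation `𝔭^∞(X)`: the pointwise projective limit of the `𝔭ᵏ(X)`. -/
def jetInfProlongation {π : B → M} (X : ProjectableField E EB π) (θ : JetInf E EB EF π) :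
    ∀ k, InternalTangentBundle (Jet E EB EF π k) :=
  fun k => jetProlongation k X (jetInfProj E EB EF π k θ)

variable (E EB EF)

/-- The set `𝔛_proj(Γ_g(π))`: the image of `𝔭ᵍ`. -/
abbrev GermFields (π : B → M) :=
  Set.range (fun X : AutonomousField E EB π => germProlongation X.1)

/-- The set `𝔛_proj(Γ_k(π))`: the image of `𝔭ᵏ`, for finite `k`. -/
abbrev JetFields (π : B → M) (k : ℕ) :=
  Set.range (fun X : AutonomousField E EB π => jetProlongation (EF := EF) k X.1)

/-- The set `𝔛_proj(Γ_∞(π))`: the image of `𝔭^∞`. -/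
abbrev JetInfFields (π : B → M) :=
  Set.range (fun X : AutonomousField E EB π => jetInfProlongation (EF := EF) X.1)

end Bundle

end GermBundle

end

open GermBundle

/-!
The flow of a smooth time-dependent vector field is smooth jointly in times and initial points: in a
chart, Picard's integral equation on the Banach space of curves is a smooth equation whose linear
part is invertible on a short time interval, so the implicit function theorem applies. Flowing a
section `σ` along `π_*X` backwards and then along `X` forwards therefore gives a smooth curve of
germs.

The value of the transported section is `Φ ∘ σ ∘ g` for diffeomorphisms `Φ` and `g` that do not
depend on `σ`, so by the chain rule its germ and its `k`-jet depend only on the germ and the `k`-jet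
of `σ`. Since `π^{k,g}` and `π^{l,k}` carry the curve of transported germs or jets to the curve of
transported jets, functoriality of the internal tangent map gives the commutation relations. As all
finite projections are surjective, a field projects to at most one field, which yields the tower.
-/

namespace GermBundle

/-! ### Smooth dependence of solutions of differential equations on initial values -/

section Superposition

variable {K : Type*} [TopologicalSpace K]

section

variable {E F : Type*} [TopologicalSpace E] [TopologicalSpace F]

variable (K) in
/-- The superposition operator `α ↦ f ∘ α` on continuous maps, for a map `f` which need be
continuous only on an open set; the value is `0` where `f ∘ α` is not continuous. -/
noncomputable def superposition [Zero F] (f : E → F) (α : C(K, E)) : C(K, F) :=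
  ContinuousMap.mkD (f ∘ α) 0

variable (K) in
/-- The continuous maps with values in `Ω`. -/
def mapsInto (Ω : Set E) : Set C(K, E) := {α | ∀ t, α t ∈ Ω}

variable {f : E → F} {Ω : Set E} {α : C(K, E)}

theorem superposition_apply [Zero F] (hf : ContinuousOn f Ω) (hα : α ∈ mapsInto K Ω) (t : K) :
    superposition K f α t = f (α t) :=
  ContinuousMap.mkD_apply_of_continuous (hf.comp_continuous α.continuous hα)

theorem isOpen_mapsInto [CompactSpace K] (hΩ : IsOpen Ω) : IsOpen (mapsInto K Ω) := by
  simpa [mapsInto, Set.MapsTo] using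
    ContinuousMap.isOpen_setOfPred_mapsTo (X := K) isCompact_univ hΩ

end

section

variable [CompactSpace K] {E F : Type*} [NormedAddCommGroup E] [NormedAddCommGroup F]
  {f : E → F} {Ω : Set E} {α : C(K, E)}

theorem continuousOn_superposition (hf : ContinuousOn f Ω) :
    ContinuousOn (superposition K f) (mapsInto K Ω) := by
  rw [continuousOn_iff_continuous_domRestrict]
  refine ContinuousMap.continuous_of_continuous_uncurry _ ?_
  have h : Continuous fun p : mapsInto K Ω × K => f (p.1.1 p.2) :=
    hf.comp_continuous (by fun_prop) fun p => p.1.2 p.2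
  exact h.congr fun p => (superposition_apply hf p.1.2 p.2).symm

variable [NormedSpace ℝ E] [NormedSpace ℝ F]

variable (K E F) in
/-- Pointwise application `(A, h) ↦ (t ↦ A t (h t))` of a continuous family of operators to a
continuous family of vectors. -/
noncomputable def pointwiseApply : C(K, E →L[ℝ] F) →L[ℝ] C(K, E) →L[ℝ] C(K, F) :=
  LinearMap.mkContinuous₂
    (LinearMap.mk₂ ℝ
      (fun (A : C(K, E →L[ℝ] F)) (h : C(K, E)) =>
        (⟨fun t => A t (h t), A.continuous.clm_apply h.continuous⟩ : C(K, F)))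
      (fun _ _ _ => by ext; simp) (fun _ _ _ => by ext; simp)
      (fun _ _ _ => by ext; simp) (fun _ _ _ => by ext; simp)) 1
    (fun A h => by
      rw [one_mul, ContinuousMap.norm_le _ (by positivity)]
      intro t
      exact ((A t).le_opNorm _).trans
        (mul_le_mul (A.norm_coe_le_norm t) (h.norm_coe_le_norm t) (norm_nonneg _) (norm_nonneg A)))

variable (K E) in
/-- The inclusion of the constant maps. -/
noncomputable def constMap : E →L[ℝ] C(K, E) :=
  LinearMap.mkContinuous
    { toFun := fun z => ContinuousMap.const _ z
      map_add' := fun _ _ => rfl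
      map_smul' := fun _ _ => rfl } 1
    (fun z => by
      rw [one_mul, ContinuousMap.norm_le _ (norm_nonneg _)]
      exact fun _ => le_rfl)

theorem hasFDerivAt_superposition {f' : E → E →L[ℝ] F} (hΩ : IsOpen Ω)
    (hf' : ContinuousOn f' Ω) (hf : ∀ x ∈ Ω, HasFDerivAt f (f' x) x) (hα : α ∈ mapsInto K Ω) :
    HasFDerivAt (superposition K f) (pointwiseApply K E F (superposition K f' α)) α := by
  have hfc : ContinuousOn f Ω := fun x hx => (hf x hx).continuousAt.continuousWithinAt
  have hO := isOpen_mapsInto (K := K) hΩ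
  rw [hasFDerivAt_iff_isLittleO_nhds_zero, Asymptotics.isLittleO_iff]
  intro c hc
  have hnear : ∀ᶠ β in 𝓝 α, β ∈ mapsInto K Ω ∧
      dist (superposition K f' β) (superposition K f' α) < c :=
    (hO.eventually_mem hα).and <|
      ((continuousOn_superposition hf').continuousAt (hO.mem_nhds hα)).eventually
        (Metric.ball_mem_nhds _ hc)
  obtain ⟨δ, hδ, hball⟩ := Metric.eventually_nhds_iff_ball.mp hnear
  filter_upwards [Metric.ball_mem_nhds (0 : C(K, E)) hδ] with h hh
  rw [mem_ball_zero_iff] at hh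
  have hseg : ∀ s ∈ Set.Icc (0 : ℝ) 1, α + s • h ∈ Metric.ball α δ := fun s hs => by
    rw [mem_ball_iff_norm, add_sub_cancel_left, norm_smul, Real.norm_of_nonneg hs.1]
    exact (mul_le_of_le_one_left (norm_nonneg _) hs.2).trans_lt hh
  rw [ContinuousMap.norm_le _ (by positivity)]
  intro t
  have hderiv : ∀ x ∈ segment ℝ (α t) (α t + h t), x ∈ Ω ∧ ‖f' x - f' (α t)‖ ≤ c := by
    rw [segment_eq_image']
    rintro _ ⟨s, hs, rfl⟩
    obtain ⟨hmem, hdist⟩ := hball _ (hseg s hs)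
    have := (ContinuousMap.dist_lt_iff hc).mp hdist t
    rw [superposition_apply hf' hmem, superposition_apply hf' hα, dist_eq_norm] at this
    exact ⟨by simpa using hmem t, by simpa using this.le⟩
  have hmean := (convex_segment (α t) (α t + h t)).norm_image_sub_le_of_norm_hasFDerivWithin_le'
    (φ := f' (α t)) (fun x hx => (hf x (hderiv x hx).1).hasFDerivWithinAt)
    (fun x hx => (hderiv x hx).2) (left_mem_segment ℝ _ _) (right_mem_segment ℝ _ _)
  have hmem : α + h ∈ mapsInto K Ω := by
    simpa using (hball _ (hseg 1 (by simp))).1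
  have heq : (superposition K f (α + h) - superposition K f α -
      pointwiseApply K E F (superposition K f' α) h) t =
      f (α t + h t) - f (α t) - f' (α t) (α t + h t - α t) := by
    rw [add_sub_cancel_left, ← superposition_apply hf' hα, ← superposition_apply hfc hα,
      ← ContinuousMap.add_apply, ← superposition_apply hfc hmem]
    rfl
  rw [heq]
  refine hmean.trans (mul_le_mul_of_nonneg_left ?_ hc.le)
  simpa using h.norm_coe_le_norm t

end

-- The induction replaces `F` by `E →L[ℝ] F`, so `E` and `F` have to lie in one universe.
theorem contDiffOn_superposition.{u} [CompactSpace K] {E F : Type u}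
    [NormedAddCommGroup E] [NormedSpace ℝ E] [NormedAddCommGroup F] [NormedSpace ℝ F]
    {f : E → F} {Ω : Set E} (hΩ : IsOpen Ω) (hf : ContDiffOn ℝ ∞ f Ω) :
    ContDiffOn ℝ ∞ (superposition K f) (mapsInto K Ω) := by
  rw [contDiffOn_infty]
  intro n
  induction n generalizing F with
  | zero => exact contDiffOn_zero.mpr (continuousOn_superposition hf.continuousOn)
  | succ n ih =>
    have hf' : ContDiffOn ℝ ∞ (fderiv ℝ f) Ω := hf.fderiv_of_isOpen hΩ (by simp)
    have hd : ∀ α ∈ mapsInto K Ω, HasFDerivAt (superposition K f)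
        (pointwiseApply K E F (superposition K (fderiv ℝ f) α)) α := fun α hα =>
      hasFDerivAt_superposition hΩ hf'.continuousOn
        (fun x hx => ((hf.contDiffAt (hΩ.mem_nhds hx)).differentiableAt (by simp)).hasFDerivAt) hα
    push_cast
    rw [contDiffOn_succ_iff_fderiv_of_isOpen (isOpen_mapsInto hΩ)]
    have hcomp : ContDiffOn ℝ n
        (fun α => pointwiseApply K E F (superposition K (fderiv ℝ f) α)) (mapsInto K Ω) :=
      ContDiff.comp_contDiffOn (g := pointwiseApply K E F)
        (ContinuousLinearMap.contDiff _) (ih hf')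
    exact ⟨fun α hα => (hd α hα).differentiableAt.differentiableWithinAt, by simp,
      hcomp.congr fun α hα => (hd α hα).fderiv⟩

end Superposition

section ImplicitFunction

variable {E₁ E₂ F : Type*} [NormedAddCommGroup E₁] [NormedSpace ℝ E₁] [CompleteSpace E₁]
  [NormedAddCommGroup E₂] [NormedSpace ℝ E₂] [CompleteSpace E₂]
  [NormedAddCommGroup F] [NormedSpace ℝ F] [CompleteSpace F]

-- Smoothness at a single point of the implicit function is not enough: at `n = ∞` it does not
-- spread to a neighbourhood. By uniqueness, the implicit functions at nearby points agree.
theorem exists_contDiffOn_implicitFunction {f : E₁ × E₂ → F} {Ω : Set (E₁ × E₂)}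
    (hΩ : IsOpen Ω) (hf : ContDiffOn ℝ ∞ f Ω) {u : E₁ × E₂} (hu : u ∈ Ω) (hu0 : f u = 0)
    (hinv : (fderiv ℝ f u ∘L .inr ℝ E₁ E₂).IsInvertible) :
    ∃ (ψ : E₁ → E₂) (W : Set (E₁ × E₂)) (A : Set E₁), IsOpen W ∧ u ∈ W ∧ IsOpen A ∧ u.1 ∈ A ∧
      ContDiffOn ℝ ∞ ψ A ∧ (∀ x ∈ A, (x, ψ x) ∈ W ∩ Ω ∧ f (x, ψ x) = 0) ∧
      ∀ v ∈ W, f v = 0 → ψ v.1 = v.2 := by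
  have hne : (∞ : WithTop ℕ∞) ≠ 0 := by simp
  have hsmooth : ∀ v ∈ Ω, ContDiffAt ℝ ∞ f v := fun v hv => hf.contDiffAt (hΩ.mem_nhds hv)
  let ψ := (hsmooth u hu).implicitFunction hne hinv
  have hψu : ψ u.1 = u.2 := (hsmooth u hu).implicitFunction_apply_self hne hinv
  have hψc : ContinuousAt ψ u.1 :=
    ((hsmooth u hu).contDiffAt_implicitFunction hne hinv).continuousAt
  have hinv_near : ∀ᶠ v in 𝓝 u, (fderiv ℝ f v ∘L .inr ℝ E₁ E₂).IsInvertible := by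
    have hcont : ContinuousAt (fun v => fderiv ℝ f v ∘L .inr ℝ E₁ E₂) u :=
      (((hsmooth u hu).fderiv_right (m := ∞) (by simp)).continuousAt).clm_comp continuousAt_const
    exact hcont.eventually (ContinuousLinearEquiv.isOpen.mem_nhds hinv)
  obtain ⟨W, hW, hWo, huW⟩ := eventually_nhds_iff.mp <|
    ((hsmooth u hu).eventually_apply_eq_iff_implicitFunction hne hinv).and <|
      hinv_near.and (hΩ.eventually_mem hu)
  rw [hu0] at hW
  have hgraph : Filter.Tendsto (fun x => (x, ψ x)) (𝓝 u.1) (𝓝 u) := by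
    have := (continuousAt_id (x := u.1)).prodMk hψc
    rwa [ContinuousAt, hψu] at this
  obtain ⟨A, hA, hAo, huA⟩ := eventually_nhds_iff.mp (hgraph.eventually (hWo.eventually_mem huW))
  have hzero : ∀ x ∈ A, f (x, ψ x) = 0 := fun x hx => (hW _ (hA x hx)).1.mpr rfl
  refine ⟨ψ, W, A, hWo, huW, hAo, huA, fun x hx => ContDiffAt.contDiffWithinAt ?_,
    fun x hx => ⟨⟨hA x hx, (hW _ (hA x hx)).2.2⟩, hzero x hx⟩, fun v hv => (hW v hv).1.mp⟩
  obtain ⟨-, hinvx, hxΩ⟩ := hW _ (hA x hx)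
  have hfx := hsmooth _ hxΩ
  have hφ := hfx.contDiffAt_implicitFunction hne hinvx
  have hgraph' := (continuousAt_id (x := x)).prodMk hφ.continuousAt
  rw [ContinuousAt, hfx.implicitFunction_apply_self hne hinvx] at hgraph'
  refine hφ.congr_of_eventuallyEq ?_
  filter_upwards [hgraph'.eventually (hWo.eventually_mem (hA x hx)),
    hfx.eventually_apply_implicitFunction hne hinvx] with y hy hy0
  exact (hW _ hy).1.mp (hy0.trans (hzero x hx))

end ImplicitFunction

section Picard

/-- The time interval on which the rescaled equation `α' = s • f α` is solved. -/
abbrev TimeInterval : Type := Set.Icc (-1 : ℝ) 1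

variable {E : Type*} [NormedAddCommGroup E]

/-- The extension of a curve on `TimeInterval` to all times, constant outside the interval. -/
noncomputable def extendTime (α : C(TimeInterval, E)) : ℝ → E := Set.IccExtend (by norm_num) α

theorem continuous_extendTime (α : C(TimeInterval, E)) : Continuous (extendTime α) :=
  α.continuous.Icc_extend'

theorem extendTime_of_mem (α : C(TimeInterval, E)) {t : ℝ} (ht : t ∈ Set.Icc (-1 : ℝ) 1) :
    extendTime α t = α ⟨t, ht⟩ :=
  Set.IccExtend_of_mem _ _ ht

/-- The curve `t ↦ α (c * t)`. -/
noncomputable def rescale (c : ℝ) (α : C(TimeInterval, E)) : C(TimeInterval, E) where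
  toFun t := extendTime α (c * t)
  continuous_toFun := (continuous_extendTime α).comp (by fun_prop)

theorem extendTime_rescale (c : ℝ) (α : C(TimeInterval, E)) {t : ℝ}
    (ht : t ∈ Set.Icc (-1 : ℝ) 1) : extendTime (rescale c α) t = extendTime α (c * t) :=
  extendTime_of_mem (rescale c α) ht

theorem rescale_mem_ball (c : ℝ) {z : E} {α : C(TimeInterval, E)} {r : ℝ} (hr : 0 < r)
    (hα : α ∈ Metric.ball (ContinuousMap.const _ z) r) :
    rescale c α ∈ Metric.ball (ContinuousMap.const _ z) r := by
  rw [Metric.mem_ball, ContinuousMap.dist_lt_iff hr] at hα ⊢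
  exact fun t => hα _

variable [NormedSpace ℝ E]

variable (E) in
/-- Integration from time `0`, as an operator on curves. -/
noncomputable def integralFromZero : C(TimeInterval, E) →L[ℝ] C(TimeInterval, E) :=
  LinearMap.mkContinuous
    { toFun := fun α => ⟨fun t => ∫ r in (0 : ℝ)..t, extendTime α r,
        (intervalIntegral.continuous_primitive
          (fun _ _ => (continuous_extendTime α).intervalIntegrable _ _) 0).comp
          continuous_subtype_val⟩
      map_add' := fun α β => by
        ext t
        exact intervalIntegral.integral_add ((continuous_extendTime α).intervalIntegrable _ _)
          ((continuous_extendTime β).intervalIntegrable _ _)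
      map_smul' := fun c α => by
        ext t
        exact intervalIntegral.integral_smul c _ } 1
    (fun α => by
      rw [ContinuousMap.norm_le _ (by positivity), mul_comm]
      intro t
      refine (intervalIntegral.norm_integral_le_of_norm_le_const
        (C := ‖α‖) fun _ _ => α.norm_coe_le_norm _).trans ?_
      rw [sub_zero]
      exact mul_le_mul_of_nonneg_left (abs_le.mpr t.2) (norm_nonneg _))

/-- The map `((s, z), α) ↦ α - z - s • ∫ f ∘ α`, whose zeros are the solutions of the initial value
problem `α' = s • f α`, `α 0 = z`. -/
noncomputable def picardDefect (f : E → E) (p : (ℝ × E) × C(TimeInterval, E)) :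
    C(TimeInterval, E) :=
  p.2 - constMap TimeInterval E p.1.2 -
    p.1.1 • integralFromZero E (superposition TimeInterval f p.2)

variable {f : E → E} {Ω : Set E}

theorem picardDefect_apply (hf : ContinuousOn f Ω) {α : C(TimeInterval, E)}
    (hα : α ∈ mapsInto TimeInterval Ω) (s : ℝ) (z : E) (t : TimeInterval) :
    picardDefect f ((s, z), α) t = α t - z - s • ∫ r in (0 : ℝ)..t, f (extendTime α r) := by
  have hr : extendTime (superposition TimeInterval f α) = fun r => f (extendTime α r) :=
    funext fun r => superposition_apply hf hα _
  rw [← hr]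
  rfl

theorem picardDefect_rescale (hf : ContinuousOn f Ω) {α : C(TimeInterval, E)}
    (hα : α ∈ mapsInto TimeInterval Ω) {s : ℝ} {z : E} (h : picardDefect f ((s, z), α) = 0)
    {c : ℝ} (hc : c ∈ Set.Icc (-1 : ℝ) 1) :
    picardDefect f ((c * s, z), rescale c α) = 0 := by
  have hmul : ∀ t ∈ Set.Icc (-1 : ℝ) 1, c * t ∈ Set.Icc (-1 : ℝ) 1 := fun t ht => by
    rw [Set.mem_Icc, ← abs_le] at hc ht ⊢
    rw [abs_mul]
    exact mul_le_one₀ hc (abs_nonneg t) ht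
  ext t
  have hsub : Set.uIcc 0 (t : ℝ) ⊆ Set.Icc (-1) 1 :=
    Set.OrdConnected.uIcc_subset inferInstance (by norm_num) t.2
  have hint : c • ∫ r in (0 : ℝ)..t, f (extendTime (rescale c α) r) =
      ∫ r in (0 : ℝ)..c * t, f (extendTime α r) := by
    rw [intervalIntegral.integral_congr fun r hr =>
        congrArg f (extendTime_rescale c α (hsub hr)),
      intervalIntegral.smul_integral_comp_mul_left (fun r => f (extendTime α r)), mul_zero]
  have hct := DFunLike.congr_fun h ⟨c * t, hmul t t.2⟩
  rw [picardDefect_apply hf hα, ← extendTime_of_mem] at hct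
  rw [picardDefect_apply (α := rescale c α) hf fun t => hα _, mul_comm c, mul_smul, hint]
  exact hct

theorem hasDerivAt_of_picardDefect_eq_zero [CompleteSpace E] (hf : ContinuousOn f Ω)
    {α : C(TimeInterval, E)} (hα : α ∈ mapsInto TimeInterval Ω) {s : ℝ} {z : E}
    (h : picardDefect f ((s, z), α) = 0) {t : ℝ} (ht : t ∈ Set.Ioo (-1 : ℝ) 1) :
    HasDerivAt (extendTime α) (s • f (extendTime α t)) t := by
  have hc : Continuous fun r => f (extendTime α r) :=
    hf.comp_continuous (continuous_extendTime α) fun r => hα _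
  have hint : HasDerivAt (fun t => z + s • ∫ r in (0 : ℝ)..t, f (extendTime α r))
      (s • f (extendTime α t)) t :=
    ((intervalIntegral.integral_hasDerivAt_right (hc.intervalIntegrable _ _)
      (hc.stronglyMeasurableAtFilter _ _) hc.continuousAt).const_smul s).const_add z
  refine hint.congr_of_eventuallyEq ?_
  filter_upwards [Icc_mem_nhds ht.1 ht.2] with r hr
  have := DFunLike.congr_fun h ⟨r, hr⟩
  rw [picardDefect_apply hf hα, ContinuousMap.zero_apply, sub_eq_zero, sub_eq_iff_eq_add'] at this
  rw [extendTime_of_mem α hr, this]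

theorem hasFDerivAt_picardDefect_inr (z : E) (α : C(TimeInterval, E)) :
    HasFDerivAt (fun β => picardDefect f ((0, z), β)) (.id ℝ C(TimeInterval, E)) α := by
  simpa only [picardDefect, zero_smul, sub_zero, id_eq] using
    (hasFDerivAt_id α).sub_const (constMap TimeInterval E z)

end Picard

theorem eq_add_of_hasDerivAt_one {g : ℝ → ℝ} {δ t : ℝ}
    (hg : ∀ s ∈ Set.Ioo (-δ) δ, HasDerivAt g 1 s) (ht : t ∈ Set.Ioo (-δ) δ) : g t = g 0 + t := by
  have hd : ∀ s ∈ Set.Ioo (-δ) δ, HasDerivAt (fun s => g s - s) 0 s := fun s hs =>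
    ((hg s hs).sub (hasDerivAt_id s)).congr_deriv (sub_self _)
  have hδ : 0 < δ := by linarith [ht.1, ht.2]
  have hconst := isOpen_Ioo.is_const_of_deriv_eq_zero isPreconnected_Ioo
    (fun s hs => (hd s hs).differentiableAt.differentiableWithinAt)
    (fun s hs => (hd s hs).deriv) ht ⟨neg_neg_of_pos hδ, hδ⟩
  rw [sub_zero] at hconst
  exact sub_eq_iff_eq_add.mp hconst

section LocalFlow

universe u

variable {E : Type u} [NormedAddCommGroup E] [NormedSpace ℝ E] {f : E → E} {Ω : Set E}

theorem contDiffOn_picardDefect (hΩ : IsOpen Ω) (hf : ContDiffOn ℝ ∞ f Ω) :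
    ContDiffOn ℝ ∞ (picardDefect f) {p | p.2 ∈ mapsInto TimeInterval Ω} := by
  have hsup : ContDiffOn ℝ ∞ (fun p : (ℝ × E) × C(TimeInterval, E) =>
      integralFromZero E (superposition TimeInterval f p.2)) {p | p.2 ∈ mapsInto TimeInterval Ω} :=
    (integralFromZero E).contDiff.comp_contDiffOn
      ((contDiffOn_superposition hΩ hf).comp contDiffOn_snd fun _ h => h)
  have hconst : ContDiff ℝ ∞ fun p : (ℝ × E) × C(TimeInterval, E) =>
      constMap TimeInterval E p.1.2 :=
    (constMap TimeInterval E).contDiff.comp (contDiff_snd.comp contDiff_fst)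
  exact (contDiff_snd.sub hconst).contDiffOn.sub
    ((contDiff_fst.comp contDiff_fst).contDiffOn.smul hsup)

variable {z₀ : E}

theorem fderiv_picardDefect_comp_inr (hΩ : IsOpen Ω) (hf : ContDiffOn ℝ ∞ f Ω) (hz₀ : z₀ ∈ Ω) :
    fderiv ℝ (picardDefect f) ((0, z₀), constMap TimeInterval E z₀) ∘L
      .inr ℝ (ℝ × E) C(TimeInterval, E) = .id ℝ _ := by
  have hnhds : {p : (ℝ × E) × C(TimeInterval, E) | p.2 ∈ mapsInto TimeInterval Ω} ∈
      𝓝 (((0 : ℝ), z₀), constMap TimeInterval E z₀) :=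
    ((isOpen_mapsInto hΩ).preimage continuous_snd).mem_nhds fun _ => hz₀
  have hd := ((contDiffOn_picardDefect hΩ hf).contDiffAt hnhds).differentiableAt (by simp)
  exact (hd.hasFDerivAt.comp _ (hasFDerivAt_prodMk_right _ _)).unique
    (hasFDerivAt_picardDefect_inr z₀ _)

variable [CompleteSpace E]

theorem exists_smooth_picard_solution (hΩ : IsOpen Ω) (hf : ContDiffOn ℝ ∞ f Ω) (hz₀ : z₀ ∈ Ω) :
    ∃ (δ : ℝ) (U : Set E) (S : ℝ × E → C(TimeInterval, E)), 0 < δ ∧ IsOpen U ∧ z₀ ∈ U ∧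
      ContDiffOn ℝ ∞ S (Set.Ioo (-δ) δ ×ˢ U) ∧ ∀ s ∈ Set.Ioo (-δ) δ, ∀ z ∈ U,
        S (s, z) ∈ mapsInto TimeInterval Ω ∧ picardDefect f ((s, z), S (s, z)) = 0 ∧
        ∀ c ∈ Set.Icc (-1 : ℝ) 1, S (c * s, z) = rescale c (S (s, z)) := by
  let α₀ := constMap TimeInterval E z₀
  have hopen : IsOpen {p : (ℝ × E) × C(TimeInterval, E) | p.2 ∈ mapsInto TimeInterval Ω} :=
    (isOpen_mapsInto hΩ).preimage continuous_snd
  have hα₀ : ((0, z₀), α₀) ∈ {p : (ℝ × E) × C(TimeInterval, E) | p.2 ∈ mapsInto _ Ω} :=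
    fun _ => hz₀
  have hdefect := contDiffOn_picardDefect hΩ hf
  obtain ⟨S, W, A, hW, huW, hA, huA, hS, hgraph, huniq⟩ :=
    exists_contDiffOn_implicitFunction hopen hdefect hα₀ (by simp [picardDefect, α₀])
      (fderiv_picardDefect_comp_inr hΩ hf hz₀ ▸
        ContinuousLinearMap.isInvertible_equiv (f := .refl ℝ _))
  have hS₀ : S (0, z₀) = α₀ := huniq _ huW (by simp [picardDefect, α₀])
  obtain ⟨r, hr, hrW⟩ := Metric.isOpen_iff.mp hW _ huW
  have hnear : ∀ᶠ p in 𝓝 ((0 : ℝ), z₀), p ∈ A ∧ S p ∈ Metric.ball α₀ r ∧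
      p ∈ Metric.ball ((0 : ℝ), z₀) r := by
    have hball := ((hS.contDiffAt (hA.mem_nhds huA)).continuousAt).eventually
      (Metric.ball_mem_nhds _ hr)
    rw [hS₀] at hball
    exact (hA.eventually_mem huA).and (hball.and (Metric.ball_mem_nhds _ hr))
  obtain ⟨δ, hδ, hδS⟩ := Metric.eventually_nhds_iff_ball.mp hnear
  rw [← ball_prod_same, Real.ball_zero_eq_Ioo] at hδS
  refine ⟨δ, Metric.ball z₀ δ, S, hδ, Metric.isOpen_ball, Metric.mem_ball_self hδ,
    hS.mono fun p hp => (hδS p hp).1, fun s hs z hz => ?_⟩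
  obtain ⟨hsA, hSball, hball⟩ := hδS (s, z) ⟨hs, hz⟩
  refine ⟨(hgraph _ hsA).1.2, (hgraph _ hsA).2, fun c hc => ?_⟩
  have hcs : (c * s, z) ∈ Metric.ball ((0 : ℝ), z₀) r := by
    rw [← ball_prod_same] at hball ⊢
    refine ⟨?_, hball.2⟩
    rw [mem_ball_zero_iff, norm_mul]
    exact (mul_le_of_le_one_left (norm_nonneg s) (abs_le.mpr hc)).trans_lt
      (mem_ball_zero_iff.mp hball.1)
  exact huniq ((c * s, z), rescale c (S (s, z)))
    (hrW (by rw [← ball_prod_same]; exact ⟨hcs, rescale_mem_ball c hr hSball⟩))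
    (picardDefect_rescale hf.continuousOn (hgraph _ hsA).1.2 (hgraph _ hsA).2 hc)

theorem exists_smooth_local_flow (hΩ : IsOpen Ω) (hf : ContDiffOn ℝ ∞ f Ω) (hz₀ : z₀ ∈ Ω) :
    ∃ (ε : ℝ) (U : Set E) (Θ : ℝ × E → E), 0 < ε ∧ IsOpen U ∧ z₀ ∈ U ∧
      ContDiffOn ℝ ∞ Θ (Set.Ioo (-ε) ε ×ˢ U) ∧ ∀ z ∈ U, Θ (0, z) = z ∧
        ∀ t ∈ Set.Ioo (-ε) ε, Θ (t, z) ∈ Ω ∧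
          HasDerivAt (fun t => Θ (t, z)) (f (Θ (t, z))) t := by
  obtain ⟨δ, U, S, hδ, hU, hzU, hS, hsol⟩ := exists_smooth_picard_solution hΩ hf hz₀
  have hε : 0 < δ / 2 := half_pos hδ
  have hmemδ : ∀ t ∈ Set.Ioo (-(δ / 2)) (δ / 2), t ∈ Set.Ioo (-δ) δ := fun t ht =>
    ⟨by linarith [ht.1], by linarith [ht.2]⟩
  have hquot : ∀ t ∈ Set.Ioo (-(δ / 2)) (δ / 2), t / (δ / 2) ∈ Set.Ioo (-1 : ℝ) 1 := fun t ht =>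
    ⟨by rw [lt_div_iff₀ hε]; linarith [ht.1], by rw [div_lt_iff₀ hε]; linarith [ht.2]⟩
  have hscale : ∀ z ∈ U, ∀ t ∈ Set.Ioo (-(δ / 2)) (δ / 2),
      extendTime (S (t, z)) 1 = extendTime (S (δ / 2, z)) (t / (δ / 2)) := fun z hz t ht => by
    have hc := (hsol (δ / 2) ⟨by linarith, by linarith⟩ z hz).2.2 _
      (Set.Ioo_subset_Icc_self (hquot t ht))
    rw [div_mul_cancel₀ t hε.ne'] at hc
    rw [hc, extendTime_rescale _ _ (by norm_num), mul_one]
  refine ⟨δ / 2, U, fun p => extendTime (S p) 1, hε, hU, hzU, ?_,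
    fun z hz => ⟨?_, fun t ht => ⟨?_, ?_⟩⟩⟩
  · exact (ContinuousMap.evalCLM ℝ
      (Set.projIcc (-1 : ℝ) 1 (by norm_num) 1)).contDiff.comp_contDiffOn
        (hS.mono (Set.prod_mono_left hmemδ))
  · obtain ⟨hΩ₀, h₀, -⟩ := hsol 0 ⟨by linarith, hδ⟩ z hz
    have := DFunLike.congr_fun h₀ (Set.projIcc (-1 : ℝ) 1 (by norm_num) 1)
    rw [picardDefect_apply hf.continuousOn hΩ₀, zero_smul, sub_zero] at this
    exact sub_eq_zero.mp this
  · exact (hsol t (hmemδ t ht) z hz).1 _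
  · obtain ⟨hΩε, hε₀, -⟩ := hsol (δ / 2) ⟨by linarith, by linarith⟩ z hz
    have hd := (hasDerivAt_of_picardDefect_eq_zero hf.continuousOn hΩε hε₀ (hquot t ht)).scomp t
      ((hasDerivAt_id t).div_const (δ / 2))
    rw [smul_smul, one_div, inv_mul_cancel₀ hε.ne', one_smul, ← hscale z hz t ht] at hd
    refine hd.congr_of_eventuallyEq ?_
    filter_upwards [Ioo_mem_nhds ht.1 ht.2] with r hr
    exact hscale z hz r hr

theorem exists_smooth_local_evolution {f : ℝ × E → E} (hΩ : IsOpen Ω)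
    (hf : ContDiffOn ℝ ∞ f (Set.univ ×ˢ Ω)) (hz₀ : z₀ ∈ Ω) :
    ∃ (ε : ℝ) (U : Set E) (Ψ : (ℝ × ℝ) × E → E), 0 < ε ∧ IsOpen U ∧ z₀ ∈ U ∧
      ContDiffOn ℝ ∞ Ψ ((Set.Ioo (-ε) ε ×ˢ Set.Ioo (-ε) ε) ×ˢ U) ∧
      ∀ t₀ ∈ Set.Ioo (-ε) ε, ∀ z ∈ U, Ψ ((t₀, t₀), z) = z ∧ ∀ t ∈ Set.Ioo (-ε) ε,
        Ψ ((t₀, t), z) ∈ Ω ∧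
          HasDerivAt (fun t => Ψ ((t₀, t), z)) (f (t, Ψ ((t₀, t), z))) t := by
  obtain ⟨δ, U, Θ, hδ, hU, hzU, hΘ, hflow⟩ :=
    exists_smooth_local_flow (f := fun w => ((1 : ℝ), f w)) (z₀ := ((0 : ℝ), z₀))
      (isOpen_univ.prod hΩ) (contDiffOn_const.prodMk hf) ⟨Set.mem_univ _, hz₀⟩
  have htime : ∀ z ∈ U, ∀ t ∈ Set.Ioo (-δ) δ, (Θ (t, z)).1 = z.1 + t := fun z hz t ht => by
    have hd : ∀ s ∈ Set.Ioo (-δ) δ, HasDerivAt (fun s => (Θ (s, z)).1) 1 s := fun s hs =>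
      (hasFDerivAt_fst (𝕜 := ℝ) (E := ℝ) (F := E)).comp_hasDerivAt s ((hflow z hz).2 s hs).2
    rw [eq_add_of_hasDerivAt_one hd ht, (hflow z hz).1]
  obtain ⟨r, hr, hrU⟩ := Metric.isOpen_iff.mp hU _ hzU
  rw [← ball_prod_same, Real.ball_zero_eq_Ioo] at hrU
  obtain ⟨ε, hε, hεrδ⟩ := exists_between (lt_min hr (half_pos hδ))
  have hεr : ε ≤ r := (hεrδ.trans_le (min_le_left _ _)).le
  have hεδ : ε ≤ δ / 2 := (hεrδ.trans_le (min_le_right _ _)).le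
  have hmem : ∀ t₀ ∈ Set.Ioo (-ε) ε, ∀ z ∈ Metric.ball z₀ r, (t₀, z) ∈ U := fun t₀ ht₀ z hz =>
    hrU ⟨⟨by linarith [ht₀.1], ht₀.2.trans_le hεr⟩, hz⟩
  have hdiff : ∀ t₀ ∈ Set.Ioo (-ε) ε, ∀ t ∈ Set.Ioo (-ε) ε, t - t₀ ∈ Set.Ioo (-δ) δ :=
    fun t₀ ht₀ t ht => ⟨by linarith [ht.1, ht₀.2], by linarith [ht.2, ht₀.1]⟩
  refine ⟨ε, Metric.ball z₀ r, fun w => (Θ (w.1.2 - w.1.1, (w.1.1, w.2))).2, hε,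
    Metric.isOpen_ball, Metric.mem_ball_self hr, ?_, fun t₀ ht₀ z hz => ⟨?_, fun t ht => ?_⟩⟩
  · exact contDiff_snd.comp_contDiffOn (hΘ.comp (by fun_prop) fun w hw =>
      ⟨hdiff _ hw.1.1 _ hw.1.2, hmem _ hw.1.1 _ hw.2⟩)
  · simp only [sub_self, (hflow _ (hmem t₀ ht₀ z hz)).1]
  · obtain ⟨hΩt, hd⟩ := (hflow _ (hmem t₀ ht₀ z hz)).2 _ (hdiff t₀ ht₀ t ht)
    have hpair : Θ (t - t₀, (t₀, z)) = (t, (Θ (t - t₀, (t₀, z))).2) :=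
      Prod.ext ((htime _ (hmem t₀ ht₀ z hz) _ (hdiff t₀ ht₀ t ht)).trans (by ring)) rfl
    have hd₂ := HasDerivAt.comp_sub_const t t₀ (hasFDerivAt_snd.comp_hasDerivAt _ hd)
    rw [hpair] at hd₂
    exact ⟨hΩt.2, hd₂⟩

end LocalFlow

/-! ### Evolution of time-dependent vector fields on manifolds -/

section ManifoldFlow

variable {E : Type*} [NormedAddCommGroup E] [NormedSpace ℝ E] {N : Type*}
  [TopologicalSpace N] [ChartedSpace E N] {X : ℝ → ∀ y : N, TangentSpace 𝓘(ℝ, E) y}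

variable (E) in
/-- `c` is an integral curve of the time-dependent field `X` on `(a, b)`. -/
def IsTimeCurveOn (X : ℝ → ∀ y : N, TangentSpace 𝓘(ℝ, E) y) (c : ℝ → N) (a b : ℝ) : Prop :=
  ∀ s ∈ Set.Ioo a b, HasMFDerivAt 𝓘(ℝ, ℝ) 𝓘(ℝ, E) c s
    ((1 : ℝ →L[ℝ] ℝ).smulRight (X s (c s) : E))

theorem IsTimeCurveOn.mono {c : ℝ → N} {a b a' b' : ℝ} (hc : IsTimeCurveOn E X c a b)
    (ha : a ≤ a') (hb : b' ≤ b) : IsTimeCurveOn E X c a' b' :=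
  fun s hs => hc s (Set.Ioo_subset_Ioo ha hb hs)

theorem IsTimeCurveOn.flowsTo {c : ℝ → N} {a b t₀ t : ℝ} (hc : IsTimeCurveOn E X c a b)
    (ht₀ : t₀ ∈ Set.Ioo a b) (ht : t ∈ Set.Ioo a b) : FlowsTo E X t₀ (c t₀) t (c t) :=
  ⟨c, a, b, ht₀, ht, rfl, rfl, hc⟩

theorem FlowsTo.symm {t₀ t : ℝ} {x y : N} (h : FlowsTo E X t₀ x t y) : FlowsTo E X t y t₀ x := by
  obtain ⟨c, a, b, ht₀, ht, hx, hy, hc⟩ := h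
  exact ⟨c, a, b, ht, ht₀, hy, hx, hc⟩

variable (E) in
/-- `Ψ t₀ t x` is the smooth evolution of `X` from time `t₀` to time `t`, for times in `(-ε, ε)` and
initial values in `O`. -/
structure IsLocalEvolution (X : ℝ → ∀ y : N, TangentSpace 𝓘(ℝ, E) y) (ε : ℝ) (O : Set N)
    (Ψ : ℝ → ℝ → N → N) : Prop where
  pos : 0 < ε
  isOpen : IsOpen O
  smooth : ContMDiffOn ((𝓘(ℝ, ℝ).prod 𝓘(ℝ, ℝ)).prod 𝓘(ℝ, E)) 𝓘(ℝ, E) ∞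
    (fun w : (ℝ × ℝ) × N => Ψ w.1.1 w.1.2 w.2) ((Set.Ioo (-ε) ε ×ˢ Set.Ioo (-ε) ε) ×ˢ O)
  init : ∀ t₀ ∈ Set.Ioo (-ε) ε, ∀ x ∈ O, Ψ t₀ t₀ x = x
  curve : ∀ t₀ ∈ Set.Ioo (-ε) ε, ∀ x ∈ O, IsTimeCurveOn E X (fun t => Ψ t₀ t x) (-ε) ε

namespace IsLocalEvolution

variable {ε : ℝ} {O : Set N} {Ψ : ℝ → ℝ → N → N}

theorem mono (h : IsLocalEvolution E X ε O Ψ) {ε' : ℝ} {O' : Set N} (hε' : 0 < ε')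
    (hle : ε' ≤ ε) (hO' : IsOpen O') (hsub : O' ⊆ O) : IsLocalEvolution E X ε' O' Ψ := by
  have hIoo : Set.Ioo (-ε') ε' ⊆ Set.Ioo (-ε) ε := Set.Ioo_subset_Ioo (neg_le_neg hle) hle
  exact ⟨hε', hO', h.smooth.mono (Set.prod_mono (Set.prod_mono hIoo hIoo) hsub),
    fun t₀ ht₀ x hx => h.init t₀ (hIoo ht₀) x (hsub hx),
    fun t₀ ht₀ x hx => (h.curve t₀ (hIoo ht₀) x (hsub hx)).mono (neg_le_neg hle) hle⟩

theorem zero_mem (h : IsLocalEvolution E X ε O Ψ) : (0 : ℝ) ∈ Set.Ioo (-ε) ε :=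
  ⟨neg_neg_of_pos h.pos, h.pos⟩

theorem flowsTo (h : IsLocalEvolution E X ε O Ψ) {t₀ t : ℝ} (ht₀ : t₀ ∈ Set.Ioo (-ε) ε)
    (ht : t ∈ Set.Ioo (-ε) ε) {x : N} (hx : x ∈ O) : FlowsTo E X t₀ x t (Ψ t₀ t x) := by
  have := (h.curve t₀ ht₀ x hx).flowsTo ht₀ ht
  rwa [h.init t₀ ht₀ x hx] at this

theorem contMDiffAt (h : IsLocalEvolution E X ε O Ψ) {t₀ t : ℝ} (ht₀ : t₀ ∈ Set.Ioo (-ε) ε)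
    (ht : t ∈ Set.Ioo (-ε) ε) {x : N} (hx : x ∈ O) :
    ContMDiffAt ((𝓘(ℝ, ℝ).prod 𝓘(ℝ, ℝ)).prod 𝓘(ℝ, E)) 𝓘(ℝ, E) ∞
      (fun w : (ℝ × ℝ) × N => Ψ w.1.1 w.1.2 w.2) ((t₀, t), x) :=
  h.smooth.contMDiffAt (((isOpen_Ioo.prod isOpen_Ioo).prod h.isOpen).mem_nhds ⟨⟨ht₀, ht⟩, hx⟩)

theorem contMDiffAt_apply (h : IsLocalEvolution E X ε O Ψ) {t₀ t : ℝ} (ht₀ : t₀ ∈ Set.Ioo (-ε) ε)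
    (ht : t ∈ Set.Ioo (-ε) ε) {x : N} (hx : x ∈ O) :
    ContMDiffAt 𝓘(ℝ, E) 𝓘(ℝ, E) ∞ (Ψ t₀ t) x :=
  ContMDiffAt.comp (g := fun w : (ℝ × ℝ) × N => Ψ w.1.1 w.1.2 w.2) (f := fun x => ((t₀, t), x)) x
    (h.contMDiffAt ht₀ ht hx) (contMDiffAt_const.prodMk contMDiffAt_id)

theorem hasMFDerivAt_zero (h : IsLocalEvolution E X ε O Ψ) {x : N} (hx : x ∈ O) :
    HasMFDerivAt 𝓘(ℝ, ℝ) 𝓘(ℝ, E) (fun t => Ψ 0 t x) 0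
      ((1 : ℝ →L[ℝ] ℝ).smulRight (X 0 x : E)) := by
  have hvelocity : (X 0 (Ψ 0 0 x) : E) = X 0 x :=
    congrArg (fun y => (X 0 y : E)) (h.init 0 h.zero_mem x hx)
  exact hvelocity ▸ h.curve 0 h.zero_mem x hx 0 h.zero_mem

theorem exists_mapsTo (h : IsLocalEvolution E X ε O Ψ) {x : N} (hx : x ∈ O) {D : Set N}
    (hD : D ∈ 𝓝 x) : ∃ (δ : ℝ) (O' : Set N), 0 < δ ∧ δ ≤ ε ∧ IsOpen O' ∧ x ∈ O' ∧ O' ⊆ O ∧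
      ∀ t ∈ Set.Ioo (-δ) δ, Ψ 0 t x ∈ O' ∧ Set.MapsTo (Ψ t 0) O' D := by
  have hinit : Ψ 0 0 x = x := h.init 0 h.zero_mem x hx
  have hsmooth := (h.contMDiffAt h.zero_mem h.zero_mem hx).continuousAt
  have hback : ∀ᶠ w : ℝ × N in 𝓝 (0, x), Ψ w.1 0 w.2 ∈ D :=
    (hsmooth.comp_of_eq (f := fun w : ℝ × N => ((w.1, (0 : ℝ)), w.2))
      (by fun_prop) rfl).eventually_mem (by simpa only [Function.comp_apply, hinit] using hD)
  obtain ⟨T, O', hT, h0, hO', hxO', hsub⟩ := mem_nhds_prod_iff'.mp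
    (hback.and (continuousAt_snd.eventually_mem (h.isOpen.mem_nhds hx)))
  have hforward : ∀ᶠ t in 𝓝 (0 : ℝ), t ∈ T ∧ Ψ 0 t x ∈ O' :=
    Filter.inter_mem (hT.mem_nhds h0) <|
      (hsmooth.comp_of_eq (f := fun t : ℝ => (((0 : ℝ), t), x))
        (by fun_prop) rfl).preimage_mem_nhds
        (hO'.mem_nhds (by simpa only [Function.comp_apply, hinit] using hxO'))
  obtain ⟨δ, hδ, hball⟩ := Metric.eventually_nhds_iff_ball.mp hforward
  refine ⟨min δ ε, O', lt_min hδ h.pos, min_le_right _ _, hO', hxO',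
    fun y hy => (hsub (Set.mk_mem_prod h0 hy)).2, fun t ht => ?_⟩
  obtain ⟨htT, htO'⟩ := hball t <| mem_ball_zero_iff.mpr <|
    (abs_lt.mpr ht).trans_le (min_le_left _ _)
  exact ⟨htO', fun y hy => (hsub (Set.mk_mem_prod htT hy)).1⟩

end IsLocalEvolution

/-- The autonomous field `(1, X)` on `ℝ × N`, whose integral curves are the graphs of those
of `X`. -/
def suspendedField (X : ℝ → ∀ y : N, TangentSpace 𝓘(ℝ, E) y) (w : ℝ × N) :
    TangentSpace (𝓘(ℝ, ℝ).prod 𝓘(ℝ, E)) w := ((1 : ℝ), (X w.1 w.2 : E))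

theorem IsTimeCurveOn.isMIntegralCurveOn_suspendedField {c : ℝ → N} {a b : ℝ}
    (hc : IsTimeCurveOn E X c a b) :
    IsMIntegralCurveOn (I := 𝓘(ℝ, ℝ).prod 𝓘(ℝ, E)) (fun s => (s, c s)) (suspendedField X)
      (Set.Ioo a b) := by
  intro s hs
  refine (((hasMFDerivAt_id (I := 𝓘(ℝ, ℝ)) s).prodMk (hc s hs)).congr_mfderiv
    (ContinuousLinearMap.ext fun r : ℝ => ?_)).hasMFDerivWithinAt
  exact congrArg (fun q : ℝ => (q, r • (X s (c s) : E))) (mul_one r).symm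

/-- The coordinate expression of a time-dependent field in the chart at `x₀`. -/
noncomputable def chartField (X : ℝ → ∀ y : N, TangentSpace 𝓘(ℝ, E) y) [IsManifold 𝓘(ℝ, E) ∞ N]
    (x₀ : N) (w : ℝ × E) : E :=
  (trivializationAt E (TangentSpace 𝓘(ℝ, E)) x₀
    (⟨(extChartAt 𝓘(ℝ, E) x₀).symm w.2, X w.1 ((extChartAt 𝓘(ℝ, E) x₀).symm w.2)⟩ :
      TangentBundle 𝓘(ℝ, E) N)).2

variable [IsManifold 𝓘(ℝ, E) ∞ N]

theorem contMDiff_suspendedField (hX : IsSmoothField E X) :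
    ContMDiff (𝓘(ℝ, ℝ).prod 𝓘(ℝ, E)) (𝓘(ℝ, ℝ).prod 𝓘(ℝ, E)).tangent ∞
      (fun w : ℝ × N => (⟨w, suspendedField X w⟩ :
        TangentBundle (𝓘(ℝ, ℝ).prod 𝓘(ℝ, E)) (ℝ × N))) := by
  have htime : ContMDiff 𝓘(ℝ, ℝ) 𝓘(ℝ, ℝ).tangent ∞
      (fun t : ℝ => (⟨t, (1 : ℝ)⟩ : TangentBundle 𝓘(ℝ, ℝ) ℝ)) := fun _ =>
    contMDiffAt_vectorSpace_iff_contDiffAt.mpr contDiffAt_const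
  exact (contMDiff_equivTangentBundleProd_symm (I := 𝓘(ℝ, ℝ)) (I' := 𝓘(ℝ, E)) (M := ℝ) (M' := N)
    (n := ∞)).comp ((htime.comp contMDiff_fst).prodMk hX)

theorem contDiffOn_chartField (hX : IsSmoothField E X) (x₀ : N) :
    ContDiffOn ℝ ∞ (chartField X x₀) (Set.univ ×ˢ (extChartAt 𝓘(ℝ, E) x₀).target) := by
  rw [← contMDiffOn_iff_contDiffOn]
  have hchart : ContMDiffOn 𝓘(ℝ, ℝ × E) (𝓘(ℝ, ℝ).prod 𝓘(ℝ, E)) ∞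
      (fun w : ℝ × E => (w.1, (extChartAt 𝓘(ℝ, E) x₀).symm w.2))
      (Set.univ ×ˢ (extChartAt 𝓘(ℝ, E) x₀).target) :=
    contDiff_fst.contMDiff.contMDiffOn.prodMk
      ((contMDiffOn_extChartAt_symm x₀).comp contDiff_snd.contMDiff.contMDiffOn fun w hw => hw.2)
  refine contMDiff_snd.comp_contMDiffOn <|
    (Bundle.Trivialization.contMDiffOn (n := ∞) (IB := 𝓘(ℝ, E))
      (trivializationAt E (TangentSpace 𝓘(ℝ, E)) x₀)).comp (hX.comp_contMDiffOn hchart) ?_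
  intro w hw
  simpa using (extChartAt 𝓘(ℝ, E) x₀).map_target hw.2

theorem chartField_eq_mfderiv {x₀ : N} {s : ℝ} {v : E}
    (hv : v ∈ (extChartAt 𝓘(ℝ, E) x₀).target) :
    chartField X x₀ (s, v) =
      (mfderiv 𝓘(ℝ, E) 𝓘(ℝ, E) (extChartAt 𝓘(ℝ, E) x₀) ((extChartAt 𝓘(ℝ, E) x₀).symm v)
        (X s ((extChartAt 𝓘(ℝ, E) x₀).symm v)) : E) := by
  have hsource : (extChartAt 𝓘(ℝ, E) x₀).symm v ∈ (chartAt E x₀).source := by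
    simpa only [extChartAt_source] using (extChartAt 𝓘(ℝ, E) x₀).map_target hv
  refine Eq.trans ?_ (DFunLike.congr_fun
    (TangentBundle.continuousLinearMapAt_trivializationAt (I := 𝓘(ℝ, E)) hsource)
    (X s ((extChartAt 𝓘(ℝ, E) x₀).symm v)))
  rw [Bundle.Trivialization.continuousLinearMapAt_apply,
    Bundle.Trivialization.coe_linearMapAt_of_mem _ (by simpa using hsource)]
  rfl

theorem hasMFDerivAt_of_chartField {x₀ : N} {γ : ℝ → E} {s : ℝ}
    (hs : γ s ∈ (extChartAt 𝓘(ℝ, E) x₀).target)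
    (h : HasDerivAt γ (chartField X x₀ (s, γ s)) s) :
    HasMFDerivAt 𝓘(ℝ, ℝ) 𝓘(ℝ, E) (fun t => (extChartAt 𝓘(ℝ, E) x₀).symm (γ t)) s
      ((1 : ℝ →L[ℝ] ℝ).smulRight (X s ((extChartAt 𝓘(ℝ, E) x₀).symm (γ s)) : E)) := by
  have hsymm : MDifferentiableAt 𝓘(ℝ, E) 𝓘(ℝ, E) (extChartAt 𝓘(ℝ, E) x₀).symm (γ s) :=
    ((contMDiffOn_extChartAt_symm x₀).contMDiffAt
      ((isOpen_extChartAt_target x₀).mem_nhds hs)).mdifferentiableAt (n := ∞) (by simp)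
  refine (hsymm.hasMFDerivAt.comp s h.hasFDerivAt.hasMFDerivAt).congr_mfderiv
    (ContinuousLinearMap.ext fun r : ℝ => ?_)
  have hinv := mfderivWithin_extChartAt_symm_comp_mfderiv_extChartAt (I := 𝓘(ℝ, E)) hs
  rw [modelWithCornersSelf_coe, Set.range_id, mfderivWithin_univ] at hinv
  let L : E →L[ℝ] E := mfderiv 𝓘(ℝ, E) 𝓘(ℝ, E) (extChartAt 𝓘(ℝ, E) x₀).symm (γ s)
  change L (r • (chartField X x₀ (s, γ s) : E)) =
    r • (X s ((extChartAt 𝓘(ℝ, E) x₀).symm (γ s)) : E)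
  rw [map_smul, chartField_eq_mfderiv hs]
  exact congrArg (r • ·) (DFunLike.congr_fun hinv (X s ((extChartAt 𝓘(ℝ, E) x₀).symm (γ s))))

theorem IsTimeCurveOn.eqOn [T2Space N] (hX : IsSmoothField E X) {c c' : ℝ → N} {a b t₀ : ℝ}
    (hc : IsTimeCurveOn E X c a b) (hc' : IsTimeCurveOn E X c' a b) (ht₀ : t₀ ∈ Set.Ioo a b)
    (h : c t₀ = c' t₀) : Set.EqOn c c' (Set.Ioo a b) := fun _ hs =>
  congrArg Prod.snd <| isMIntegralCurveOn_Ioo_eqOn_of_contMDiff_boundaryless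
    (I := 𝓘(ℝ, ℝ).prod 𝓘(ℝ, E)) ht₀ ((contMDiff_suspendedField hX).of_le (by simp))
    hc.isMIntegralCurveOn_suspendedField hc'.isMIntegralCurveOn_suspendedField
    (congrArg (Prod.mk t₀) h) hs

theorem FlowsTo.unique [T2Space N] (hX : IsSmoothField E X) {t₀ t : ℝ} {x y y' : N}
    (h : FlowsTo E X t₀ x t y) (h' : FlowsTo E X t₀ x t y') : y = y' := by
  obtain ⟨c, a, b, ht₀, ht, rfl, rfl, hc⟩ := h
  obtain ⟨c', a', b', ht₀', ht', hcc', rfl, hc'⟩ := h'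
  have hc : IsTimeCurveOn E X c a b := hc
  have hc' : IsTimeCurveOn E X c' a' b' := hc'
  exact (hc.mono (le_max_left a a') (min_le_left b b')).eqOn hX
    (hc'.mono (le_max_right a a') (min_le_right b b'))
    ⟨max_lt ht₀.1 ht₀'.1, lt_min ht₀.2 ht₀'.2⟩ hcc'.symm ⟨max_lt ht.1 ht'.1, lt_min ht.2 ht'.2⟩

theorem IsLocalEvolution.apply_apply [T2Space N] {ε : ℝ} {O : Set N} {Ψ : ℝ → ℝ → N → N}
    (h : IsLocalEvolution E X ε O Ψ) (hX : IsSmoothField E X) {t₀ t : ℝ}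
    (ht₀ : t₀ ∈ Set.Ioo (-ε) ε) (ht : t ∈ Set.Ioo (-ε) ε) {x : N} (hx : x ∈ O)
    (hx' : Ψ t₀ t x ∈ O) : Ψ t t₀ (Ψ t₀ t x) = x :=
  (h.flowsTo ht ht₀ hx').unique hX (h.flowsTo ht₀ ht hx).symm

variable [CompleteSpace E]

theorem exists_isLocalEvolution (hX : IsSmoothField E X) (x₀ : N) :
    ∃ (ε : ℝ) (O : Set N) (Ψ : ℝ → ℝ → N → N), x₀ ∈ O ∧ IsLocalEvolution E X ε O Ψ := by
  set φ := extChartAt 𝓘(ℝ, E) x₀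
  obtain ⟨ε, U, Ψ, hε, hU, hx₀U, hΨ, hflow⟩ :=
    exists_smooth_local_evolution (isOpen_extChartAt_target x₀) (contDiffOn_chartField hX x₀)
      (mem_extChartAt_target x₀)
  refine ⟨ε, φ.source ∩ φ ⁻¹' U, fun t₀ t x => φ.symm (Ψ ((t₀, t), φ x)),
    ⟨mem_extChartAt_source x₀, hx₀U⟩, hε,
    (continuousOn_extChartAt x₀).isOpen_inter_preimage (isOpen_extChartAt_source x₀) hU,
    ?_, fun t₀ ht₀ x hx => ?_, fun t₀ ht₀ x hx t ht => ?_⟩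
  · have hφ : ContMDiffOn ((𝓘(ℝ, ℝ).prod 𝓘(ℝ, ℝ)).prod 𝓘(ℝ, E)) 𝓘(ℝ, (ℝ × ℝ) × E) ∞
        (fun w : (ℝ × ℝ) × N => (w.1, φ w.2))
        ((Set.Ioo (-ε) ε ×ˢ Set.Ioo (-ε) ε) ×ˢ (φ.source ∩ φ ⁻¹' U)) := by
      have htimes : ContMDiff ((𝓘(ℝ, ℝ).prod 𝓘(ℝ, ℝ)).prod 𝓘(ℝ, E)) 𝓘(ℝ, ℝ × ℝ) ∞
          (fun w : (ℝ × ℝ) × N => w.1) :=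
        (contMDiff_fst.comp contMDiff_fst).prodMk_space (contMDiff_snd.comp contMDiff_fst)
      exact htimes.contMDiffOn.prodMk_space <|
        (contMDiffOn_extChartAt (x := x₀)).comp contMDiff_snd.contMDiffOn fun w hw => by
          simpa only [φ, extChartAt_source, Set.mem_preimage] using hw.2.1
    exact (contMDiffOn_extChartAt_symm x₀).comp (hΨ.contMDiffOn.comp hφ fun w hw => ⟨hw.1, hw.2.2⟩)
      fun w hw => ((hflow _ hw.1.1 _ hw.2.2).2 _ hw.1.2).1
  · simp only [(hflow t₀ ht₀ _ hx.2).1]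
    exact φ.left_inv hx.1
  · obtain ⟨hmem, hd⟩ := (hflow t₀ ht₀ _ hx.2).2 t ht
    exact hasMFDerivAt_of_chartField hmem hd

theorem FlowsTo.refl_zero (hX : IsSmoothField E X) (x : N) : FlowsTo E X 0 x 0 x := by
  obtain ⟨ε, O, Ψ, hx, h⟩ := exists_isLocalEvolution hX x
  have := h.flowsTo h.zero_mem h.zero_mem hx
  rwa [h.init 0 h.zero_mem x hx] at this

end ManifoldFlow

/-! ### Velocities of smooth curves -/

section Velocity

variable {X Y : Type*} [DiffeologicalSpace X] [DiffeologicalSpace Y]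

theorem IsPlotOn.mono {n : ℕ} {U V : Set (Euc n)} {p : Euc n → X} (hp : IsPlotOn U p)
    (h : V ⊆ U) : IsPlotOn V p :=
  hp.comp (f := id) contDiffOn_id h

theorem plotClass_comp {x : X} (φ ψ : CenteredPlot x) (f : Euc ψ.dim → Euc φ.dim) (v : Euc ψ.dim)
    (hf : ContDiffOn ℝ ∞ f ψ.dom) (hm : Set.MapsTo f ψ.dom φ.dom) (h0 : f 0 = 0)
    (he : Set.EqOn ψ.toFun (φ.toFun ∘ f) ψ.dom) :
    plotClass φ (fderiv ℝ f 0 v) = plotClass ψ v :=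
  (Submodule.Quotient.eq (plotRelations x)).mpr
    (Submodule.subset_span ⟨φ, ψ, f, v, hf, hm, h0, he, rfl⟩)

/-- The centered plot given by a curve on `(-ε, ε)` through `x`, whose class of the unit vector is
the velocity of the curve. -/
def curvePlot {x : X} {c : ℝ → X} {ε : ℝ} (hε : 0 < ε) (hc : c 0 = x)
    (hp : IsPlotOn {u : Euc 1 | |u 0| < ε} (fun u => c (u 0))) : CenteredPlot x where
  dim := 1
  dom := {u : Euc 1 | |u 0| < ε}
  isOpen_dom := isOpen_lt (by fun_prop) continuous_const
  zero_mem := by simpa using hε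
  toFun := fun u => c (u 0)
  isPlotOn := hp
  map_zero := by simpa using hc

theorem plotClass_curvePlot_of_le {x : X} {c c' : ℝ → X} {ε η : ℝ} (hε : 0 < ε) (hη : 0 < η)
    (hc : c 0 = x) (hc' : c' 0 = x) (hp : IsPlotOn {u : Euc 1 | |u 0| < ε} (fun u => c (u 0)))
    (hp' : IsPlotOn {u : Euc 1 | |u 0| < η} (fun u => c' (u 0))) (hle : η ≤ ε)
    (h : ∀ t, |t| < η → c t = c' t) (v : Euc 1) :
    plotClass (curvePlot hε hc hp) v = plotClass (curvePlot hη hc' hp') v := by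
  have hid : fderiv ℝ (id : Euc 1 → Euc 1) 0 v = v := by
    rw [fderiv_id, ContinuousLinearMap.id_apply]
  exact (congrArg (plotClass (curvePlot hε hc hp)) hid).symm.trans
    (plotClass_comp (curvePlot hε hc hp) (curvePlot hη hc' hp') id v contDiffOn_id
      (fun (u : Euc 1) hu => (show |u 0| < η from hu).trans_le hle) rfl
      fun (u : Euc 1) hu => (h (u 0) hu).symm)

theorem exists_pos_eq_of_eventuallyEq {α : Type*} {c c' : ℝ → α} (h : c =ᶠ[𝓝 0] c') :
    ∃ δ > 0, ∀ t, |t| < δ → c t = c' t := by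
  simpa only [dist_zero_right, Real.norm_eq_abs] using Metric.eventually_nhds_iff.mp h

theorem velocityAt_eq_plotClass {x : X} {c : ℝ → X} {ε : ℝ} (hε : 0 < ε) (hc : c 0 = x)
    (hp : IsPlotOn {u : Euc 1 | |u 0| < ε} (fun u => c (u 0))) :
    velocityAt x c =
      plotClass (curvePlot hε hc hp) (EuclideanSpace.single (0 : Fin 1) (1 : ℝ)) := by
  have h : IsSmoothCurveAt c x := ⟨hc, ε, hε, hp⟩
  obtain ⟨hε', hp'⟩ := h.2.choose_spec
  have hη : 0 < min h.2.choose ε := lt_min hε' hε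
  have hpη : IsPlotOn {u : Euc 1 | |u 0| < min h.2.choose ε} (fun u => c (u 0)) :=
    hp.mono fun u (hu : |u 0| < _) => hu.trans_le (min_le_right _ _)
  rw [velocityAt, dif_pos h]
  exact (plotClass_curvePlot_of_le hε' hη hc hc hp' hpη (min_le_left _ _) (fun _ _ => rfl) _).trans
    (plotClass_curvePlot_of_le hε hη hc hc hp hpη (min_le_right _ _) (fun _ _ => rfl) _).symm

theorem IsSmoothCurveAt.congr {x : X} {c c' : ℝ → X} (hc : IsSmoothCurveAt c x)
    (h : c =ᶠ[𝓝 0] c') : IsSmoothCurveAt c' x := by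
  obtain ⟨h0, ε, hε, hp⟩ := hc
  obtain ⟨δ, hδ, hδc⟩ := exists_pos_eq_of_eventuallyEq h
  refine ⟨h.eq_of_nhds.symm.trans h0, min δ ε, lt_min hδ hε, ?_⟩
  refine (hp.mono fun u (hu : |u 0| < min δ ε) => hu.trans_le (min_le_right _ _)).congr ?_
  exact fun u (hu : |u 0| < min δ ε) => hδc (u 0) (hu.trans_le (min_le_left _ _))

theorem velocityAt_congr {x : X} {c c' : ℝ → X} (hc : IsSmoothCurveAt c x) (h : c =ᶠ[𝓝 0] c') :
    velocityAt x c = velocityAt x c' := by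
  obtain ⟨h0', ε', hε', hp'⟩ := hc.congr h
  obtain ⟨h0, ε, hε, hp⟩ := hc
  obtain ⟨δ, hδ, hδc⟩ := exists_pos_eq_of_eventuallyEq h
  have hη : 0 < min δ (min ε ε') := lt_min hδ (lt_min hε hε')
  have hle : min δ (min ε ε') ≤ ε := (min_le_right _ _).trans (min_le_left _ _)
  have hle' : min δ (min ε ε') ≤ ε' := (min_le_right _ _).trans (min_le_right _ _)
  have hpη : IsPlotOn {u : Euc 1 | |u 0| < min δ (min ε ε')} (fun u => c (u 0)) :=
    hp.mono fun u (hu : |u 0| < _) => hu.trans_le hle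
  rw [velocityAt_eq_plotClass hε h0 hp, velocityAt_eq_plotClass hε' h0' hp']
  exact (plotClass_curvePlot_of_le hε hη h0 h0 hp hpη hle (fun _ _ => rfl) _).trans
    (plotClass_curvePlot_of_le hε' hη h0' h0 hp' hpη hle'
      (fun t ht => (hδc t (ht.trans_le (min_le_left _ _))).symm) _).symm

theorem IsSmoothCurveAt.map {x : X} {c : ℝ → X} (hc : IsSmoothCurveAt c x) {f : X → Y}
    (hf : DSmooth f) : IsSmoothCurveAt (f ∘ c) (f x) := by
  obtain ⟨h0, ε, hε, hp⟩ := hc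
  exact ⟨congrArg f h0, ε, hε, hp.dSmooth_comp hf⟩

theorem differential_plotClass {f : X → Y} (hf : DSmooth f) {x : X} (φ : CenteredPlot x)
    (v : Euc φ.dim) : differential hf x (plotClass φ v) = plotClass (φ.map hf) v :=
  differentialAux_plotVector hf φ v

theorem differential_velocityAt {x : X} {c : ℝ → X} (hc : IsSmoothCurveAt c x) {f : X → Y}
    (hf : DSmooth f) : differential hf x (velocityAt x c) = velocityAt (f x) (f ∘ c) := by
  obtain ⟨h0, ε, hε, hp⟩ := hc
  rw [velocityAt_eq_plotClass hε h0 hp,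
    velocityAt_eq_plotClass (c := f ∘ c) hε (congrArg f h0) (hp.dSmooth_comp hf)]
  exact differential_plotClass hf _ _

theorem internalTangentMap_velocityAt {x : X} {y : Y} {c : ℝ → X} {c' : ℝ → Y}
    (hc : IsSmoothCurveAt c x) {f : X → Y} (hf : DSmooth f) (hxy : f x = y)
    (h : f ∘ c =ᶠ[𝓝 0] c') :
    internalTangentMap hf ⟨x, velocityAt x c⟩ = ⟨y, velocityAt y c'⟩ := by
  subst hxy
  rw [← velocityAt_congr (hc.map hf) h, ← differential_velocityAt hc hf]
  rfl

theorem toTangentSpace_velocityAt {E N : Type*} [NormedAddCommGroup E] [NormedSpace ℝ E]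
    [TopologicalSpace N] [ChartedSpace E N] {b : AsDiffeological E N} {c : ℝ → AsDiffeological E N}
    (hc : IsSmoothCurveAt c b) {v : E}
    (h : HasMFDerivAt 𝓘(ℝ, ℝ) 𝓘(ℝ, E) c 0 ((1 : ℝ →L[ℝ] ℝ).smulRight v)) :
    (toTangentSpace b (velocityAt b c) : E) = v := by
  obtain ⟨h0, ε, hε, hp⟩ := hc
  rw [velocityAt_eq_plotClass hε h0 hp]
  refine (toTangentSpaceAux_plotVector (curvePlot hε h0 hp) _).trans ?_
  let ev : Euc 1 →L[ℝ] ℝ := EuclideanSpace.proj (0 : Fin 1)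
  have hcomp : HasMFDerivAt 𝓘(ℝ, Euc 1) 𝓘(ℝ, E) (c ∘ ev) 0
      (((1 : ℝ →L[ℝ] ℝ).smulRight v).comp ev) :=
    HasMFDerivAt.comp (I' := 𝓘(ℝ, ℝ)) (0 : Euc 1) (f := ev) (g := c) (by rwa [map_zero])
      ev.hasFDerivAt.hasMFDerivAt
  have hderiv : (mfderiv 𝓘(ℝ, Euc 1) 𝓘(ℝ, E) (fun u : Euc 1 => c (u 0)) 0 : Euc 1 →L[ℝ] E) =
      ((1 : ℝ →L[ℝ] ℝ).smulRight v).comp ev := hcomp.mfderiv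
  change (mfderiv 𝓘(ℝ, Euc 1) 𝓘(ℝ, E) (fun u : Euc 1 => c (u 0)) 0 : Euc 1 →L[ℝ] E)
    (EuclideanSpace.single (0 : Fin 1) (1 : ℝ)) = v
  rw [hderiv]
  change (EuclideanSpace.single (0 : Fin 1) (1 : ℝ) : Euc 1) 0 • v = v
  rw [PiLp.single_apply, if_pos rfl, one_smul]

end Velocity

/-! ### Jets of compositions and of families -/

section Jets

variable {𝕜 : Type*} [NontriviallyNormedField 𝕜] {E F G : Type*}
  [NormedAddCommGroup E] [NormedSpace 𝕜 E] [NormedAddCommGroup F] [NormedSpace 𝕜 F]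
  [NormedAddCommGroup G] [NormedSpace 𝕜 G]

theorem contDiffAt_iteratedFDeriv_snd {g : F → E → G} {w : F × E}
    (hg : ContDiffAt 𝕜 ∞ (Function.uncurry g) w) (j : ℕ) :
    ContDiffAt 𝕜 ∞ (fun w : F × E => iteratedFDeriv 𝕜 j (g w.1) w.2) w := by
  induction j with
  | zero => exact (continuousMultilinearCurryFin0 𝕜 E G).symm.contDiff.contDiffAt.comp w hg
  | succ j ih =>
    have hparam : ContDiffAt 𝕜 ∞
        (Function.uncurry fun (w : F × E) (z : E) => iteratedFDeriv 𝕜 j (g w.1) z) (w, w.2) :=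
      ContDiffAt.comp (w, w.2) (g := fun w : F × E => iteratedFDeriv 𝕜 j (g w.1) w.2)
        (f := fun q : (F × E) × E => (q.1.1, q.2)) ih
        (contDiffAt_fst.fst.prodMk contDiffAt_snd)
    exact (continuousMultilinearCurryLeftEquiv 𝕜 (fun _ : Fin (j + 1) => E) G).symm.contDiff
      |>.contDiffAt.comp w (hparam.fderiv (m := ∞) contDiffAt_snd (by simp))

theorem iteratedFDeriv_comp_congr {g g' : F → G} {f f' : E → F} {x : E} {n : ℕ}
    (hg : ContDiffAt 𝕜 n g (f x)) (hg' : ContDiffAt 𝕜 n g' (f' x))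
    (hf : ContDiffAt 𝕜 n f x) (hf' : ContDiffAt 𝕜 n f' x)
    (hgg' : ∀ j ≤ n, iteratedFDeriv 𝕜 j g (f x) = iteratedFDeriv 𝕜 j g' (f' x))
    (hff' : ∀ j ≤ n, iteratedFDeriv 𝕜 j f x = iteratedFDeriv 𝕜 j f' x) :
    ∀ j ≤ n, iteratedFDeriv 𝕜 j (g ∘ f) x = iteratedFDeriv 𝕜 j (g' ∘ f') x := by
  intro j hj
  have hjn : (j : WithTop ℕ∞) ≤ n := by exact_mod_cast hj
  rw [iteratedFDeriv_comp hg hf hjn, iteratedFDeriv_comp hg' hf' hjn]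
  refine Finset.sum_congr rfl fun c _ => ?_
  simp only [FormalMultilinearSeries.compAlongOrderedFinpartition, ftaylorSeries]
  rw [hgg' c.length (c.length_le.trans hj),
    funext fun m => hff' (c.partSize m) ((c.partSize_le m).trans hj)]

end Jets

/-! ### Smoothness of the projections from germs to jets -/

section Pushforward

variable {X Y Z : Type*} [DiffeologicalSpace X] [DiffeologicalSpace Z]

theorem isPlot_of_forall_exists_isPlotOn {n : ℕ} {p : Euc n → Z}
    (h : ∀ u, ∃ V : Set (Euc n), IsOpen V ∧ u ∈ V ∧ IsPlotOn V p) : IsPlot p :=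
  DiffeologicalSpace.locality fun u => by
    obtain ⟨V, hV, hu, hp⟩ := h u
    exact ⟨V, hV, hu, fun hfV hf => hp _ hfV hf⟩

theorem dSmooth_pushforwardDiffeology (f : X → Y) : @DSmooth X Y _ (pushforwardDiffeology f) f :=
  fun _ p hp _ _ => ⟨Set.univ, isOpen_univ, Set.mem_univ _, subset_rfl,
    Or.inr ⟨p, isPlotOn_univ.mpr hp, fun _ _ => rfl⟩⟩

theorem dSmooth_of_dSmooth_comp {f : X → Y} {g : Y → Z} (h : DSmooth (g ∘ f)) :
    @DSmooth Y Z (pushforwardDiffeology f) _ g := by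
  intro n p hp
  refine isPlot_of_forall_exists_isPlotOn fun u => ?_
  obtain ⟨V, hV, huV, -, hconst | ⟨P, hP, hPf⟩⟩ := hp u (Set.mem_univ u)
  · obtain ⟨y, hy⟩ := hconst
    have hgy : IsPlotOn V fun _ : Euc n => g y := fun _ _ _ _ => isPlot_const
    exact ⟨V, hV, huV, hgy.congr fun v hv => congrArg g (hy v hv).symm⟩
  · exact ⟨V, hV, huV, (hP.dSmooth_comp h).congr fun v hv => congrArg g (hPf v hv).symm⟩

end Pushforward

section Projections

variable {E EB EF M B : Type*}
  [NormedAddCommGroup E] [NormedSpace ℝ E] [NormedAddCommGroup EB] [NormedSpace ℝ EB]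
  [NormedAddCommGroup EF] [NormedSpace ℝ EF]
  [TopologicalSpace M] [ChartedSpace E M] [TopologicalSpace B] [ChartedSpace EB B] {π : B → M}

theorem germ_eq_iff {p q : PointedSection E EB π} :
    germ p = germ q ↔ p.pt = q.pt ∧ p.sec.toFun =ᶠ[𝓝 p.pt] q.sec.toFun :=
  Quotient.eq (r := germSetoid E EB π)

theorem jet_eq_iff {k : ℕ} {p q : PointedSection E EB π} :
    jet EF k p = jet EF k q ↔ p.pt = q.pt ∧ p.value = q.value ∧ ∀ c : FibredChart E EB EF π,
      p.value ∈ c.total.source → ∀ j ≤ k, c.deriv j p = c.deriv j q :=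
  Quotient.eq (r := jetSetoid E EB EF π k)

theorem PointedSection.proj_value (p : PointedSection E EB π) : π p.value = p.pt :=
  p.sec.proj _ p.mem

theorem PointedSection.contMDiffAt_sec (p : PointedSection E EB π) :
    ContMDiffAt 𝓘(ℝ, E) 𝓘(ℝ, EB) ∞ p.sec.toFun p.pt :=
  p.sec.smooth.contMDiffAt (p.sec.isOpen_dom.mem_nhds p.mem)

theorem PointedSection.eventually_mem_dom (p : PointedSection E EB π) :
    ∀ᶠ y in 𝓝 p.pt, y ∈ p.sec.dom :=
  p.sec.isOpen_dom.mem_nhds p.mem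

namespace FibredChart

theorem pt_mem_base_source (c : FibredChart E EB EF π) {p : PointedSection E EB π}
    (h : p.value ∈ c.total.source) : p.pt ∈ c.base.source :=
  p.proj_value ▸ (c.proj _ h).1

theorem contMDiffAt_base (c : FibredChart E EB EF π) {x : M} (hx : x ∈ c.base.source) :
    ContMDiffAt 𝓘(ℝ, E) 𝓘(ℝ, E) ∞ c.base x :=
  c.base_smooth.contMDiffAt (c.base.open_source.mem_nhds hx)

theorem contMDiffAt_total (c : FibredChart E EB EF π) {b : B} (hb : b ∈ c.total.source) :
    ContMDiffAt 𝓘(ℝ, EB) 𝓘(ℝ, E × EF) ∞ c.total b :=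
  c.total_smooth.contMDiffAt (c.total.open_source.mem_nhds hb)

theorem contMDiffAt_base_symm (c : FibredChart E EB EF π) {x : M} (hx : x ∈ c.base.source) :
    ContMDiffAt 𝓘(ℝ, E) 𝓘(ℝ, E) ∞ c.base.symm (c.base x) :=
  c.base_symm_smooth.contMDiffAt (c.base.open_target.mem_nhds (c.base.map_source hx))

theorem contMDiffAt_total_symm (c : FibredChart E EB EF π) {z : E × EF}
    (hz : z ∈ c.total.target) : ContMDiffAt 𝓘(ℝ, E × EF) 𝓘(ℝ, EB) ∞ c.total.symm z :=
  c.total_symm_smooth.contMDiffAt (c.total.open_target.mem_nhds hz)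

theorem tendsto_base_symm (c : FibredChart E EB EF π) {x : M} (hx : x ∈ c.base.source) :
    Filter.Tendsto c.base.symm (𝓝 (c.base x)) (𝓝 x) := by
  simpa only [c.base.left_inv hx] using (c.contMDiffAt_base_symm hx).continuousAt.tendsto

/-- The expression of a section `σ` in fibred coordinates of both source and target; its second
component is the function whose derivatives are the jet coordinates `FibredChart.deriv`. -/
def localRep (c : FibredChart E EB EF π) (σ : M → B) (z : E) : E × EF :=
  c.total (σ (c.base.symm z))

theorem contDiffAt_localRep_family (c : FibredChart E EB EF π) {A : Type*}
    [NormedAddCommGroup A] [NormedSpace ℝ A] {S : A × M → B} {u : A} {x : M}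
    (hS : ContMDiffAt (𝓘(ℝ, A).prod 𝓘(ℝ, E)) 𝓘(ℝ, EB) ∞ S (u, x)) (hx : x ∈ c.base.source)
    (hc : S (u, x) ∈ c.total.source) :
    ContDiffAt ℝ ∞ (fun w : A × E => c.localRep (fun y => S (w.1, y)) w.2) (u, c.base x) := by
  have hcoord : ContMDiffAt 𝓘(ℝ, A × E) (𝓘(ℝ, A).prod 𝓘(ℝ, E)) ∞
      (fun w : A × E => (w.1, c.base.symm w.2)) (u, c.base x) :=
    contDiffAt_fst.contMDiffAt.prodMk
      ((c.contMDiffAt_base_symm hx).comp (u, c.base x) contDiffAt_snd.contMDiffAt)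
  have hcomp : ContMDiffAt 𝓘(ℝ, A × E) 𝓘(ℝ, EB) ∞
      (fun w : A × E => S (w.1, c.base.symm w.2)) (u, c.base x) :=
    hS.comp_of_eq hcoord (by simp only [c.base.left_inv hx])
  exact contMDiffAt_iff_contDiffAt.mp
    ((c.contMDiffAt_total hc).comp_of_eq hcomp (by simp only [c.base.left_inv hx]))

theorem contDiffAt_localRep (c : FibredChart E EB EF π) {p : PointedSection E EB π}
    (h : p.value ∈ c.total.source) :
    ContDiffAt ℝ ∞ (c.localRep p.sec.toFun) (c.base p.pt) := by
  have hx := c.pt_mem_base_source h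
  have hcomp : ContMDiffAt 𝓘(ℝ, E) 𝓘(ℝ, EB) ∞ (fun z => p.sec.toFun (c.base.symm z))
      (c.base p.pt) :=
    p.contMDiffAt_sec.comp_of_eq (c.contMDiffAt_base_symm hx) (c.base.left_inv hx)
  exact contMDiffAt_iff_contDiffAt.mp
    ((c.contMDiffAt_total h).comp_of_eq hcomp (congrArg p.sec.toFun (c.base.left_inv hx)))

theorem localRep_base_pt (c : FibredChart E EB EF π) {p : PointedSection E EB π}
    (h : p.value ∈ c.total.source) : c.localRep p.sec.toFun (c.base p.pt) = c.total p.value :=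
  congrArg (fun x => c.total (p.sec.toFun x)) (c.base.left_inv (c.pt_mem_base_source h))

theorem eventually_mem_total_source (c : FibredChart E EB EF π) {p : PointedSection E EB π}
    (h : p.value ∈ c.total.source) : ∀ᶠ y in 𝓝 p.pt, p.sec.toFun y ∈ c.total.source :=
  p.contMDiffAt_sec.continuousAt.eventually_mem (c.total.open_source.mem_nhds h)

theorem localRep_eventuallyEq (c : FibredChart E EB EF π) {p : PointedSection E EB π}
    (h : p.value ∈ c.total.source) :
    c.localRep p.sec.toFun =ᶠ[𝓝 (c.base p.pt)] fun z => (z, (c.localRep p.sec.toFun z).2) := by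
  have hx := c.pt_mem_base_source h
  filter_upwards [(c.tendsto_base_symm hx).eventually (c.eventually_mem_total_source h),
    (c.tendsto_base_symm hx).eventually p.eventually_mem_dom,
    c.base.open_target.mem_nhds (c.base.map_source hx)] with z hsource hdom hz
  refine Prod.ext ?_ rfl
  calc (c.total (p.sec.toFun (c.base.symm z))).1
      = c.base (π (p.sec.toFun (c.base.symm z))) := (c.proj _ hsource).2
    _ = c.base (c.base.symm z) := congrArg c.base (p.sec.proj _ hdom)
    _ = z := c.base.right_inv hz

theorem iteratedFDeriv_localRep (c : FibredChart E EB EF π) {p : PointedSection E EB π}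
    (h : p.value ∈ c.total.source) (j : ℕ) :
    iteratedFDeriv ℝ j (c.localRep p.sec.toFun) (c.base p.pt) =
      (iteratedFDeriv ℝ j id (c.base p.pt)).prod (c.deriv j p) :=
  ((c.localRep_eventuallyEq h).iteratedFDeriv ℝ j).eq_of_nhds.trans
    (iteratedFDeriv_prodMk contDiffAt_id (c.contDiffAt_localRep h).snd
      (by exact_mod_cast le_top))

end FibredChart

theorem iteratedFDeriv_localRep_congr {k : ℕ} {p q : PointedSection E EB π}
    (h : jet EF k p = jet EF k q) (c : FibredChart E EB EF π) (hp : p.value ∈ c.total.source) :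
    ∀ j ≤ k, iteratedFDeriv ℝ j (c.localRep p.sec.toFun) (c.base p.pt) =
      iteratedFDeriv ℝ j (c.localRep q.sec.toFun) (c.base q.pt) := by
  obtain ⟨hpt, hval, hderiv⟩ := jet_eq_iff.mp h
  intro j hj
  rw [c.iteratedFDeriv_localRep hp, c.iteratedFDeriv_localRep (hval ▸ hp), hderiv c hp j hj, hpt]

section Plots

variable {n : ℕ} {V : Set (Euc n)} {P : Euc n → PointedSection E EB π} {u : Euc n}

theorem IsPlotOn.contMDiffAt_pt (hP : IsPlotOn V P) (hV : IsOpen V) (hu : u ∈ V) :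
    ContMDiffAt 𝓘(ℝ, Euc n) 𝓘(ℝ, E) ∞ (fun u => (P u).pt) u :=
  ((isPlotOn_ofCorePlotsOn (pointedSectionCorePlots E EB π) hV).mp hP).1.contMDiffAt
    (hV.mem_nhds hu)

theorem IsPlotOn.contMDiffAt_sec (hP : IsPlotOn V P) (hV : IsOpen V) (hu : u ∈ V) :
    ContMDiffAt (𝓘(ℝ, Euc n).prod 𝓘(ℝ, E)) 𝓘(ℝ, EB) ∞
      (fun w : Euc n × M => (P w.1).sec.toFun w.2) (u, (P u).pt) := by
  obtain ⟨-, hsec⟩ := (isPlotOn_ofCorePlotsOn (pointedSectionCorePlots E EB π) hV).mp hP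
  obtain ⟨W, O, hW, huW, -, hO, hxO, -, hs⟩ := hsec u hu _ (P u).mem
  exact hs.contMDiffAt ((hW.prod hO).mem_nhds ⟨huW, hxO⟩)

theorem IsPlotOn.contMDiffAt_value (hP : IsPlotOn V P) (hV : IsOpen V) (hu : u ∈ V) :
    ContMDiffAt 𝓘(ℝ, Euc n) 𝓘(ℝ, EB) ∞ (fun u => (P u).value) u :=
  ContMDiffAt.comp (g := fun w : Euc n × M => (P w.1).sec.toFun w.2)
    (f := fun u => (u, (P u).pt)) u (hP.contMDiffAt_sec hV hu)
    (contMDiffAt_id.prodMk (hP.contMDiffAt_pt hV hu))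

theorem IsPlotOn.contDiffAt_base_pt (hP : IsPlotOn V P) (hV : IsOpen V) (hu : u ∈ V)
    (c : FibredChart E EB EF π) (hc : (P u).value ∈ c.total.source) :
    ContDiffAt ℝ ∞ (fun u => c.base (P u).pt) u :=
  contMDiffAt_iff_contDiffAt.mp
    ((c.contMDiffAt_base (c.pt_mem_base_source hc)).comp u (hP.contMDiffAt_pt hV hu))

theorem IsPlotOn.contDiffAt_deriv (hP : IsPlotOn V P) (hV : IsOpen V) (hu : u ∈ V)
    (c : FibredChart E EB EF π) (hc : (P u).value ∈ c.total.source) (j : ℕ) :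
    ContDiffAt ℝ ∞ (fun u => c.deriv j (P u)) u :=
  ContDiffAt.comp (f := fun u => (u, c.base (P u).pt)) u
    (contDiffAt_iteratedFDeriv_snd (g := fun v z => (c.localRep (P v).sec.toFun z).2)
      (c.contDiffAt_localRep_family (hP.contMDiffAt_sec hV hu) (c.pt_mem_base_source hc) hc).snd j)
    (contDiffAt_id.prodMk (hP.contDiffAt_base_pt hV hu c hc))

theorem IsPlotOn.jet (hP : IsPlotOn V P) (hV : IsOpen V) (k : ℕ) :
    IsPlotOn V (fun u => GermBundle.jet EF k (P u)) := by
  refine (isPlotOn_ofCorePlotsOn (jetCorePlots E EB EF π k) hV).mpr fun c => ⟨?_, ?_, ?_⟩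
  · exact isOpen_iff_mem_nhds.mpr fun u hu => Filter.inter_mem (hV.mem_nhds hu.1)
      ((hP.contMDiffAt_value hV hu.1).continuousAt.preimage_mem_nhds
        (c.total.open_source.mem_nhds hu.2))
  · exact fun u hu => (hP.contDiffAt_base_pt hV hu.1 c hu.2).contDiffWithinAt
  · exact fun j _ u hu => (hP.contDiffAt_deriv hV hu.1 c hu.2 j).contDiffWithinAt.congr
      (fun v hv => if_pos hv.2) (if_pos hu.2)

end Plots

theorem dSmooth_germ : DSmooth (germ : PointedSection E EB π → Germ E EB π) :=
  dSmooth_pushforwardDiffeology germ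

theorem dSmooth_jet (k : ℕ) : DSmooth (jet EF k : PointedSection E EB π → Jet E EB EF π k) :=
  fun _ _ hp => isPlotOn_univ.mp ((isPlotOn_univ.mpr hp).jet isOpen_univ k)

theorem dSmooth_germToJet (k : ℕ) : DSmooth (germToJet E EB EF π k) :=
  dSmooth_of_dSmooth_comp (f := germ) (dSmooth_jet k)

theorem dSmooth_germToJetInf : DSmooth (germToJetInf E EB EF π) :=
  fun n p hp k => dSmooth_germToJet k n p hp

theorem FibredChart.total_jetValue (c : FibredChart E EB EF π) {k : ℕ} {θ : Jet E EB EF π k}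
    (h : (jetValue θ : B) ∈ c.total.source) :
    c.total (jetValue θ : B) = (c.base (jetPt θ), jetCoord c 0 (Nat.zero_le k) θ 0) := by
  obtain ⟨p⟩ := θ
  have hp : p.value ∈ c.total.source := h
  have hcoord : jetCoord c 0 (Nat.zero_le k) (jet EF k p) = c.deriv 0 p := if_pos hp
  have hderiv : c.deriv 0 p 0 = (c.localRep p.sec.toFun (c.base p.pt)).2 :=
    iteratedFDeriv_zero_apply _
  refine Prod.ext ?_ ?_
  · exact ((c.proj _ hp).2).trans (congrArg c.base p.proj_value)
  · exact ((DFunLike.congr_fun hcoord 0).trans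
      (hderiv.trans (congrArg Prod.snd (c.localRep_base_pt hp)))).symm

theorem FibredChart.exists_value_eq (c : FibredChart E EB EF π) {b : B}
    (hb : b ∈ c.total.source) : ∃ p : PointedSection E EB π, p.value = b := by
  have hpt : c.total b = (c.base (π b), (c.total b).2) := Prod.ext (c.proj b hb).2 rfl
  let D : Set M := c.base.source ∩ (fun y => (c.base y, (c.total b).2)) ⁻¹' c.total.target
  have hD : IsOpen D := ContinuousOn.isOpen_inter_preimage
    (c.base.continuousOn.prodMk continuousOn_const) c.base.open_source c.total.open_target
  have hmem : π b ∈ D := ⟨(c.proj b hb).1, by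
    simpa only [Set.mem_preimage, ← hpt] using c.total.map_source hb⟩
  refine ⟨⟨π b, ⟨D, hD, fun y => c.total.symm (c.base y, (c.total b).2), ?_, ?_⟩, hmem⟩, ?_⟩
  · exact c.total_symm_smooth.comp
      ((c.base_smooth.mono Set.inter_subset_left).prodMk_space contMDiffOn_const) fun y hy => hy.2
  · intro y hy
    obtain ⟨hsource, hbase⟩ := c.proj _ (c.total.map_target hy.2)
    rw [c.total.right_inv hy.2] at hbase
    exact (c.base.injOn hy.1 hsource hbase).symm
  · exact (congrArg c.total.symm hpt.symm).trans (c.total.left_inv hb)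

namespace IsFibreBundle

variable [IsManifold 𝓘(ℝ, E) ∞ M] {F : Type*} [TopologicalSpace F] [ChartedSpace EF F]
  [IsManifold 𝓘(ℝ, EF) ∞ F]

theorem exists_fibredChart (hπ : IsFibreBundle E EB EF F π) (b : B) :
    ∃ c : FibredChart E EB EF π, b ∈ c.total.source := by
  obtain ⟨e, hx, he, he'⟩ := hπ.locally_trivial (π b)
  have hb : b ∈ e.source := e.mem_source.mpr hx
  let φ := chartAt E (π b)
  let ψ := chartAt EF (e b).2
  have htotal : ContMDiffOn 𝓘(ℝ, EB) (𝓘(ℝ, E).prod 𝓘(ℝ, EF)) ∞ e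
      (e.toOpenPartialHomeomorph.trans (φ.prod ψ)).source := he.mono fun z hz => hz.1
  have hsymm : ContMDiffOn 𝓘(ℝ, E × EF) (𝓘(ℝ, E).prod 𝓘(ℝ, EF)) ∞
      (fun w : E × EF => (φ.symm w.1, ψ.symm w.2)) (φ.target ×ˢ ψ.target) :=
    ((contMDiffOn_chart_symm (x := π b)).comp contDiff_fst.contMDiff.contMDiffOn
      fun w hw => hw.1).prodMk
    ((contMDiffOn_chart_symm (x := (e b).2)).comp contDiff_snd.contMDiff.contMDiffOn
      fun w hw => hw.2)
  have hproj : ∀ z ∈ (e.toOpenPartialHomeomorph.trans (φ.prod ψ)).source,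
      π z ∈ φ.source ∧ φ (e z).1 = φ (π z) := fun z hz =>
    ⟨e.coe_fst hz.1 ▸ hz.2.1, congrArg φ (e.coe_fst hz.1)⟩
  refine ⟨⟨φ, e.toOpenPartialHomeomorph.trans (φ.prod ψ), contMDiffOn_chart, contMDiffOn_chart_symm,
    ?_, he'.comp (hsymm.mono fun w hw => hw.1) fun w hw => hw.2, hproj⟩, hb, ?_,
    mem_chart_source EF (e b).2⟩
  · exact ContMDiffOn.prodMk_space (f := fun z => φ (e z).1) (g := fun z => ψ (e z).2)
      ((contMDiffOn_chart (x := π b)).comp (contMDiff_fst.comp_contMDiffOn htotal)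
        fun z hz => hz.2.1)
      ((contMDiffOn_chart (x := (e b).2)).comp (contMDiff_snd.comp_contMDiffOn htotal)
        fun z hz => hz.2.2)
  · exact (e.coe_fst hb).symm ▸ mem_chart_source E (π b)

theorem exists_value_eq (hπ : IsFibreBundle E EB EF F π) (b : B) :
    ∃ p : PointedSection E EB π, p.value = b := by
  obtain ⟨c, hc⟩ := hπ.exists_fibredChart b
  exact c.exists_value_eq hc

theorem dSmooth_jetValue (hπ : IsFibreBundle E EB EF F π) (k : ℕ) :
    DSmooth (jetValue : Jet E EB EF π k → AsDiffeological EB B) := by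
  intro n p hp
  rw [← isPlotOn_univ] at hp ⊢
  refine (isPlotOn_ofCorePlotsOn (manifoldCorePlots EB B) isOpen_univ).mpr fun u _ => ?_
  obtain ⟨c, hc⟩ := hπ.exists_fibredChart (jetValue (p u) : B)
  obtain ⟨hopen, hbase, hcoord⟩ :=
    (isPlotOn_ofCorePlotsOn (jetCorePlots E EB EF π k) isOpen_univ).mp hp c
  have hnhds := hopen.mem_nhds ⟨Set.mem_univ u, hc⟩
  have hvalue : ContDiffAt ℝ ∞ (fun u => (c.base (jetPt (p u)),
      jetCoord c 0 (Nat.zero_le k) (p u) 0)) u :=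
    (hbase.contDiffAt hnhds).prodMk
      ((ContinuousMultilinearMap.apply ℝ (fun _ : Fin 0 => E) EF 0).contDiff.contDiffAt.comp u
        ((hcoord 0 (Nat.zero_le k)).contDiffAt hnhds))
  have hsymm : ContMDiffAt 𝓘(ℝ, Euc n) 𝓘(ℝ, EB) ∞ (fun u => c.total.symm (c.base (jetPt (p u)),
      jetCoord c 0 (Nat.zero_le k) (p u) 0)) u :=
    (c.contMDiffAt_total_symm (c.total_jetValue hc ▸ c.total.map_source hc)).comp u
      hvalue.contMDiffAt
  refine (hsymm.congr_of_eventuallyEq ?_).contMDiffWithinAt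
  filter_upwards [hnhds] with v hv
  rw [← c.total_jetValue hv.2]
  exact (c.total.left_inv hv.2).symm

end IsFibreBundle

end Projections

/-! ### Pushing germs and jets forward along maps of the base and the total space -/

section Pushforward

variable {E EB EF M B : Type*}
  [NormedAddCommGroup E] [NormedSpace ℝ E] [NormedAddCommGroup EB] [NormedSpace ℝ EB]
  [NormedAddCommGroup EF] [NormedSpace ℝ EF]
  [TopologicalSpace M] [ChartedSpace E M] [TopologicalSpace B] [ChartedSpace EB B] {π : B → M}

theorem value_eq_of_germ_eq {p q : PointedSection E EB π} (h : germ p = germ q) :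
    p.value = q.value := by
  obtain ⟨hpt, hsec⟩ := germ_eq_iff.mp h
  exact hsec.eq_of_nhds.trans (congrArg q.sec.toFun hpt)

theorem FibredChart.deriv_congr (c : FibredChart E EB EF π) {p q : PointedSection E EB π} {j : ℕ}
    (hp : p.value ∈ c.total.source) (hq : q.value ∈ c.total.source)
    (h : iteratedFDeriv ℝ j (c.localRep p.sec.toFun) (c.base p.pt) =
      iteratedFDeriv ℝ j (c.localRep q.sec.toFun) (c.base q.pt)) : c.deriv j p = c.deriv j q := by
  rw [c.iteratedFDeriv_localRep hp, c.iteratedFDeriv_localRep hq] at h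
  exact ContinuousMultilinearMap.ext fun m => congrArg Prod.snd (DFunLike.congr_fun h m)

theorem FibredChart.iteratedFDeriv_comp_localRep_comp_congr (c : FibredChart E EB EF π)
    {p p' : PointedSection E EB π} (hp : p.value ∈ c.total.source) {k : ℕ}
    (h : jet EF k p = jet EF k p') {G : Type*} [NormedAddCommGroup G] [NormedSpace ℝ G]
    {Ξ : E × EF → G} {γ : E → E} {z : E} (hγz : γ z = c.base p.pt) (hγ : ContDiffAt ℝ ∞ γ z)
    (hΞ : ContDiffAt ℝ ∞ Ξ (c.total p.value)) :
    ∀ j ≤ k, iteratedFDeriv ℝ j (Ξ ∘ c.localRep p.sec.toFun ∘ γ) z =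
      iteratedFDeriv ℝ j (Ξ ∘ c.localRep p'.sec.toFun ∘ γ) z := by
  obtain ⟨hpt, hval, -⟩ := jet_eq_iff.mp h
  have hp' : p'.value ∈ c.total.source := hval ▸ hp
  have hγz' : γ z = c.base p'.pt := hpt ▸ hγz
  have hle : (k : WithTop ℕ∞) ≤ ∞ := by exact_mod_cast le_top
  have hσ : ContDiffAt ℝ k (c.localRep p.sec.toFun) (γ z) :=
    hγz ▸ (c.contDiffAt_localRep hp).of_le hle
  have hσ' : ContDiffAt ℝ k (c.localRep p'.sec.toFun) (γ z) :=
    hγz' ▸ (c.contDiffAt_localRep hp').of_le hle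
  have hσγ : (c.localRep p.sec.toFun ∘ γ) z = c.total p.value := by
    rw [Function.comp_apply, hγz, c.localRep_base_pt hp]
  have hσγ' : (c.localRep p'.sec.toFun ∘ γ) z = c.total p.value := by
    rw [Function.comp_apply, hγz', c.localRep_base_pt hp', hval]
  have hinner : ∀ j ≤ k, iteratedFDeriv ℝ j (c.localRep p.sec.toFun ∘ γ) z =
      iteratedFDeriv ℝ j (c.localRep p'.sec.toFun ∘ γ) z :=
    iteratedFDeriv_comp_congr hσ hσ' (hγ.of_le hle) (hγ.of_le hle)
      (fun j hj => by rw [hγz, iteratedFDeriv_localRep_congr h c hp j hj, hpt]) fun _ _ => rfl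
  exact iteratedFDeriv_comp_congr (hσγ ▸ hΞ.of_le hle) (hσγ' ▸ hΞ.of_le hle)
    (hσ.comp z (hγ.of_le hle)) (hσ'.comp z (hγ.of_le hle)) (fun j _ => by rw [hσγ, hσγ']) hinner

/-- The germ represented by `q` is that of `Φ ∘ σ ∘ g`, where `p = (x, σ)`, at a point which `g`
maps to `x`. -/
structure IsPushforward (Φ : B → B) (g : M → M) (p q : PointedSection E EB π) : Prop where
  map_pt : g q.pt = p.pt
  smooth_base : ContMDiffAt 𝓘(ℝ, E) 𝓘(ℝ, E) ∞ g q.pt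
  smooth_total : ContMDiffAt 𝓘(ℝ, EB) 𝓘(ℝ, EB) ∞ Φ p.value
  eventuallyEq : q.sec.toFun =ᶠ[𝓝 q.pt] fun y => Φ (p.sec.toFun (g y))

namespace IsPushforward

variable {Φ : B → B} {g : M → M} {p p' q q' : PointedSection E EB π}

theorem value (h : IsPushforward Φ g p q) : q.value = Φ p.value :=
  h.eventuallyEq.eq_of_nhds.trans (congrArg (fun x => Φ (p.sec.toFun x)) h.map_pt)

theorem tendsto (h : IsPushforward Φ g p q) : Filter.Tendsto g (𝓝 q.pt) (𝓝 p.pt) :=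
  h.map_pt ▸ h.smooth_base.continuousAt.tendsto

theorem germ_congr (h : IsPushforward Φ g p q) (h' : IsPushforward Φ g p' q')
    (hpt : q.pt = q'.pt) (hpp' : germ p = germ p') : germ q = germ q' := by
  refine germ_eq_iff.mpr ⟨hpt, ?_⟩
  filter_upwards [h.eventuallyEq, hpt ▸ h'.eventuallyEq,
    h.tendsto.eventually (germ_eq_iff.mp hpp').2] with y hy hy' hyy'
  rw [hy, hy', hyy']

theorem localRep_eventuallyEq (h : IsPushforward Φ g p q) (c c₀ : FibredChart E EB EF π)
    (hc : q.value ∈ c.total.source) (hc₀ : p.value ∈ c₀.total.source) :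
    c.localRep q.sec.toFun =ᶠ[𝓝 (c.base q.pt)] (c.total ∘ Φ ∘ c₀.total.symm) ∘
      c₀.localRep p.sec.toFun ∘ (c₀.base ∘ g ∘ c.base.symm) := by
  have hsymm := c.tendsto_base_symm (c.pt_mem_base_source hc)
  have hback := h.tendsto.comp hsymm
  filter_upwards [hsymm.eventually h.eventuallyEq,
    hback.eventually (c₀.base.open_source.mem_nhds (c₀.pt_mem_base_source hc₀)),
    hback.eventually (c₀.eventually_mem_total_source hc₀)] with z hz hbase htotal
  simp only [Function.comp_apply] at hbase htotal ⊢
  rw [FibredChart.localRep, hz, FibredChart.localRep, c₀.base.left_inv hbase,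
    c₀.total.left_inv htotal]

theorem contDiffAt_baseCoord (h : IsPushforward Φ g p q) (c c₀ : FibredChart E EB EF π)
    (hc : q.value ∈ c.total.source) (hc₀ : p.value ∈ c₀.total.source) :
    ContDiffAt ℝ ∞ (c₀.base ∘ g ∘ c.base.symm) (c.base q.pt) := by
  have hq := c.pt_mem_base_source hc
  have hsymm := c.base.left_inv hq
  refine contMDiffAt_iff_contDiffAt.mp <| ContMDiffAt.comp_of_eq
    (c₀.contMDiffAt_base (c₀.pt_mem_base_source hc₀))
    (h.smooth_base.comp_of_eq (c.contMDiffAt_base_symm hq) hsymm) ?_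
  rw [Function.comp_apply, hsymm, h.map_pt]

theorem contDiffAt_totalCoord (h : IsPushforward Φ g p q) (c c₀ : FibredChart E EB EF π)
    (hc : q.value ∈ c.total.source) (hc₀ : p.value ∈ c₀.total.source) :
    ContDiffAt ℝ ∞ (c.total ∘ Φ ∘ c₀.total.symm) (c₀.total p.value) := by
  have hsymm := c₀.total.left_inv hc₀
  refine contMDiffAt_iff_contDiffAt.mp <| ContMDiffAt.comp_of_eq (c.contMDiffAt_total hc)
    (h.smooth_total.comp_of_eq (c₀.contMDiffAt_total_symm (c₀.total.map_source hc₀)) hsymm) ?_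
  rw [Function.comp_apply, hsymm, h.value]

theorem baseCoord_apply (h : IsPushforward Φ g p q) (c c₀ : FibredChart E EB EF π)
    (hc : q.value ∈ c.total.source) :
    (c₀.base ∘ g ∘ c.base.symm) (c.base q.pt) = c₀.base p.pt := by
  simp only [Function.comp_apply, c.base.left_inv (c.pt_mem_base_source hc), h.map_pt]

theorem jet_congr (h : IsPushforward Φ g p q) (h' : IsPushforward Φ g p' q')
    (hpt : q.pt = q'.pt) (c₀ : FibredChart E EB EF π) (hc₀ : p.value ∈ c₀.total.source) {k : ℕ}
    (hpp' : jet EF k p = jet EF k p') : jet EF k q = jet EF k q' := by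
  obtain ⟨-, hpval, -⟩ := jet_eq_iff.mp hpp'
  have hval : q.value = q'.value := by rw [h.value, h'.value, hpval]
  refine jet_eq_iff.mpr ⟨hpt, hval, fun c hc j hj => c.deriv_congr hc (hval ▸ hc) ?_⟩
  let γ : E → E := c₀.base ∘ g ∘ c.base.symm
  let Ξ : E × EF → E × EF := c.total ∘ Φ ∘ c₀.total.symm
  calc iteratedFDeriv ℝ j (c.localRep q.sec.toFun) (c.base q.pt)
      = iteratedFDeriv ℝ j (Ξ ∘ c₀.localRep p.sec.toFun ∘ γ) (c.base q.pt) :=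
        ((h.localRep_eventuallyEq c c₀ hc hc₀).iteratedFDeriv ℝ j).eq_of_nhds
    _ = iteratedFDeriv ℝ j (Ξ ∘ c₀.localRep p'.sec.toFun ∘ γ) (c.base q.pt) :=
        c₀.iteratedFDeriv_comp_localRep_comp_congr hc₀ hpp'
          (h.baseCoord_apply c c₀ hc) (h.contDiffAt_baseCoord c c₀ hc hc₀)
          (h.contDiffAt_totalCoord c c₀ hc hc₀) j hj
    _ = iteratedFDeriv ℝ j (c.localRep q'.sec.toFun) (c.base q'.pt) :=
        hpt ▸ (((h'.localRep_eventuallyEq c c₀ (hval ▸ hc) (hpval ▸ hc₀)).iteratedFDeriv ℝ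
          j).eq_of_nhds).symm

end IsPushforward

end Pushforward

/-! ### Transport of sections along projectable fields -/

section Transport

variable {E EB M B : Type*}
  [NormedAddCommGroup E] [NormedSpace ℝ E] [NormedAddCommGroup EB] [NormedSpace ℝ EB]
  [TopologicalSpace M] [ChartedSpace E M] [TopologicalSpace B] [ChartedSpace EB B] {π : B → M}

theorem isPlotOn_of_contMDiffOn {n : ℕ} {V : Set (Euc n)} (hV : IsOpen V) {O : Set M}
    (hO : IsOpen O) {P : Euc n → PointedSection E EB π} (hdom : ∀ u ∈ V, (P u).sec.dom = O)
    (hpt : ContMDiffOn 𝓘(ℝ, Euc n) 𝓘(ℝ, E) ∞ (fun u => (P u).pt) V)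
    (hsec : ContMDiffOn (𝓘(ℝ, Euc n).prod 𝓘(ℝ, E)) 𝓘(ℝ, EB) ∞
      (fun w : Euc n × M => (P w.1).sec.toFun w.2) (V ×ˢ O)) : IsPlotOn V P :=
  (isPlotOn_ofCorePlotsOn (pointedSectionCorePlots E EB π) hV).mpr
    ⟨hpt, fun u hu _ hx => ⟨V, O, hV, hu, subset_rfl, hO, hdom u hu ▸ hx,
      fun v hv => (hdom v hv).ge, hsec⟩⟩

theorem isSmoothCurveAt_of_contMDiffOn {ε : ℝ} (hε : 0 < ε) {O : Set M} (hO : IsOpen O)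
    {Q : ℝ → PointedSection E EB π} (hdom : ∀ t ∈ Set.Ioo (-ε) ε, (Q t).sec.dom = O)
    (hpt : ContMDiffOn 𝓘(ℝ, ℝ) 𝓘(ℝ, E) ∞ (fun t => (Q t).pt) (Set.Ioo (-ε) ε))
    (hsec : ContMDiffOn (𝓘(ℝ, ℝ).prod 𝓘(ℝ, E)) 𝓘(ℝ, EB) ∞
      (fun w : ℝ × M => (Q w.1).sec.toFun w.2) (Set.Ioo (-ε) ε ×ˢ O)) :
    IsSmoothCurveAt Q (Q 0) := by
  have hcoord : ContMDiff 𝓘(ℝ, Euc 1) 𝓘(ℝ, ℝ) ∞ (fun u : Euc 1 => u 0) :=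
    ((EuclideanSpace.proj (0 : Fin 1) : Euc 1 →L[ℝ] ℝ).contDiff).contMDiff
  refine ⟨rfl, ε, hε, isPlotOn_of_contMDiffOn (isOpen_lt (by fun_prop) continuous_const) hO
    (fun u hu => hdom _ (abs_lt.mp hu)) (hpt.comp hcoord.contMDiffOn fun u hu => abs_lt.mp hu) ?_⟩
  exact hsec.comp (f := fun w : Euc 1 × M => (w.1 0, w.2))
    ((hcoord.comp contMDiff_fst).prodMk contMDiff_snd).contMDiffOn
    fun w hw => ⟨abs_lt.mp hw.1, hw.2⟩

variable [IsManifold 𝓘(ℝ, E) ∞ M] [IsManifold 𝓘(ℝ, EB) ∞ B]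

namespace ProjectableField

variable (X : ProjectableField E EB π)

theorem isTimeCurveOn_base (hπ : ContMDiff 𝓘(ℝ, EB) 𝓘(ℝ, E) ∞ π) {c : ℝ → B} {a b : ℝ}
    (hc : IsTimeCurveOn EB X.total c a b) : IsTimeCurveOn E X.base (π ∘ c) a b := by
  intro s hs
  refine (((hπ (c s)).mdifferentiableAt (by simp)).hasMFDerivAt.comp s (hc s hs)).congr_mfderiv
    (ContinuousLinearMap.ext fun r : ℝ => ?_)
  let L : EB →L[ℝ] E := mfderiv 𝓘(ℝ, EB) 𝓘(ℝ, E) π (c s)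
  exact (L.map_smul r (X.total s (c s))).trans (congrArg (fun v : E => r • v) (X.related s (c s)))

theorem flowsTo_base (hπ : ContMDiff 𝓘(ℝ, EB) 𝓘(ℝ, E) ∞ π) {t₀ t : ℝ} {b b' : B}
    (h : FlowsTo EB X.total t₀ b t b') : FlowsTo E X.base t₀ (π b) t (π b') := by
  obtain ⟨c, a, a', ht₀, ht, rfl, rfl, hc⟩ := h
  exact (X.isTimeCurveOn_base hπ hc).flowsTo ht₀ ht

end ProjectableField

variable {X : ProjectableField E EB π} {p q q' : PointedSection E EB π}

theorem IsTransport.germ_eq [T2Space M] [T2Space B] {t : ℝ} (h : IsTransport X p t q)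
    (h' : IsTransport X p t q') : germ q = germ q' := by
  obtain ⟨hflow, hsec⟩ := h
  obtain ⟨hflow', hsec'⟩ := h'
  have hpt := hflow.unique X.base_smooth hflow'
  refine germ_eq_iff.mpr ⟨hpt, ?_⟩
  filter_upwards [hsec, hpt ▸ hsec'] with y ⟨z, _, hback, hforth⟩ ⟨z', _, hback', hforth'⟩
  obtain rfl := hback.unique X.base_smooth hback'
  exact hforth.unique X.total_smooth hforth'

theorem isTransport_zero [CompleteSpace E] [CompleteSpace EB] (X : ProjectableField E EB π)
    (p : PointedSection E EB π) : IsTransport X p 0 p :=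
  ⟨FlowsTo.refl_zero X.base_smooth _, p.eventually_mem_dom.mono fun y hy =>
    ⟨y, hy, FlowsTo.refl_zero X.base_smooth _, FlowsTo.refl_zero X.total_smooth _⟩⟩

theorem IsTransport.transport {t : ℝ} (h : IsTransport X p t q) :
    IsTransport X p t (transport X p t) := by
  have hex : ∃ q, IsTransport X p t q := ⟨q, h⟩
  rw [GermBundle.transport, dif_pos hex]
  exact hex.choose_spec

/-- Local evolutions of `π_*X` on `O ⊆ M` and of `X` on `OB ⊆ B`, for times in `(-ε, ε)`, through
which the section `σ` of `p = (x, σ)` can be transported over all of `O`. -/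
structure IsTransportDomain (X : ProjectableField E EB π) (p : PointedSection E EB π) (ε : ℝ)
    (O : Set M) (OB : Set B) (ΨM : ℝ → ℝ → M → M) (ΨB : ℝ → ℝ → B → B) : Prop where
  base : IsLocalEvolution E X.base ε O ΨM
  total : IsLocalEvolution EB X.total ε OB ΨB
  pt_mem : p.pt ∈ O
  forward_mem : ∀ t ∈ Set.Ioo (-ε) ε, ΨM 0 t p.pt ∈ O
  mapsTo_dom : ∀ t ∈ Set.Ioo (-ε) ε, Set.MapsTo (ΨM t 0) O (p.sec.dom ∩ p.sec.toFun ⁻¹' OB)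

theorem exists_isTransportDomain {εM εB : ℝ} {OM : Set M} {OB : Set B} {ΨM : ℝ → ℝ → M → M}
    {ΨB : ℝ → ℝ → B → B} (hM : IsLocalEvolution E X.base εM OM ΨM)
    (hB : IsLocalEvolution EB X.total εB OB ΨB) (hpM : p.pt ∈ OM) (hpB : p.value ∈ OB) :
    ∃ ε O, IsTransportDomain X p ε O OB ΨM ΨB := by
  obtain ⟨δ, O, hδ, hle, hO, hpO, hsub, hmem⟩ := hM.exists_mapsTo hpM <|
    Filter.inter_mem p.eventually_mem_dom
      (p.contMDiffAt_sec.continuousAt.preimage_mem_nhds (hB.isOpen.mem_nhds hpB))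
  have hpos : 0 < min δ εB := lt_min hδ hB.pos
  have hIoo : Set.Ioo (-min δ εB) (min δ εB) ⊆ Set.Ioo (-δ) δ :=
    Set.Ioo_subset_Ioo (neg_le_neg (min_le_left _ _)) (min_le_left _ _)
  exact ⟨min δ εB, O, hM.mono hpos ((min_le_left _ _).trans hle) hO hsub,
    hB.mono hpos (min_le_right _ _) hB.isOpen subset_rfl, hpO,
    fun t ht => (hmem t (hIoo ht)).1, fun t ht => (hmem t (hIoo ht)).2⟩

namespace IsTransportDomain

variable {ε : ℝ} {O : Set M} {OB : Set B} {ΨM : ℝ → ℝ → M → M} {ΨB : ℝ → ℝ → B → B}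

theorem contMDiffOn_pt (h : IsTransportDomain X p ε O OB ΨM ΨB) :
    ContMDiffOn 𝓘(ℝ, ℝ) 𝓘(ℝ, E) ∞ (fun t => ΨM 0 t p.pt) (Set.Ioo (-ε) ε) :=
  h.base.smooth.comp (f := fun t : ℝ => (((0 : ℝ), t), p.pt))
    ((contMDiff_const.prodMk contMDiff_id).prodMk contMDiff_const).contMDiffOn
    fun _ ht => ⟨⟨h.base.zero_mem, ht⟩, h.pt_mem⟩

theorem contMDiffOn_section (h : IsTransportDomain X p ε O OB ΨM ΨB) :
    ContMDiffOn (𝓘(ℝ, ℝ).prod 𝓘(ℝ, E)) 𝓘(ℝ, EB) ∞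
      (fun w : ℝ × M => ΨB 0 w.1 (p.sec.toFun (ΨM w.1 0 w.2))) (Set.Ioo (-ε) ε ×ˢ O) := by
  have hback : ContMDiffOn (𝓘(ℝ, ℝ).prod 𝓘(ℝ, E)) 𝓘(ℝ, E) ∞
      (fun w : ℝ × M => ΨM w.1 0 w.2) (Set.Ioo (-ε) ε ×ˢ O) :=
    h.base.smooth.comp (f := fun w : ℝ × M => ((w.1, (0 : ℝ)), w.2))
      ((contMDiff_fst.prodMk contMDiff_const).prodMk contMDiff_snd).contMDiffOn
      fun w hw => ⟨⟨hw.1, h.base.zero_mem⟩, hw.2⟩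
  exact h.total.smooth.comp
    (f := fun w : ℝ × M => (((0 : ℝ), w.1), p.sec.toFun (ΨM w.1 0 w.2)))
    ((contMDiff_const.prodMk contMDiff_fst).contMDiffOn.prodMk
      (p.sec.smooth.comp hback fun w hw => (h.mapsTo_dom _ hw.1 hw.2).1))
    fun w hw => ⟨⟨h.total.zero_mem, hw.1⟩, (h.mapsTo_dom _ hw.1 hw.2).2⟩

theorem flowsTo_section (h : IsTransportDomain X p ε O OB ΨM ΨB) {t : ℝ}
    (ht : t ∈ Set.Ioo (-ε) ε) {y : M} (hy : y ∈ O) :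
    FlowsTo EB X.total 0 (p.sec.toFun (ΨM t 0 y)) t (ΨB 0 t (p.sec.toFun (ΨM t 0 y))) :=
  h.total.flowsTo h.total.zero_mem ht (h.mapsTo_dom t ht hy).2

theorem isTransport (h : IsTransportDomain X p ε O OB ΨM ΨB) {t : ℝ} (ht : t ∈ Set.Ioo (-ε) ε)
    (hpt : q.pt = ΨM 0 t p.pt)
    (hsec : ∀ y, q.sec.toFun y = ΨB 0 t (p.sec.toFun (ΨM t 0 y))) : IsTransport X p t q := by
  refine ⟨hpt ▸ h.base.flowsTo h.base.zero_mem ht h.pt_mem, ?_⟩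
  filter_upwards [h.base.isOpen.mem_nhds (hpt ▸ h.forward_mem t ht)] with y hy
  exact ⟨_, (h.mapsTo_dom t ht hy).1, h.base.flowsTo ht h.base.zero_mem hy,
    hsec y ▸ h.flowsTo_section ht hy⟩

variable [T2Space M]

theorem isPushforward (h : IsTransportDomain X p ε O OB ΨM ΨB) {t : ℝ} (ht : t ∈ Set.Ioo (-ε) ε)
    (hpt : q.pt = ΨM 0 t p.pt)
    (hsec : ∀ y, q.sec.toFun y = ΨB 0 t (p.sec.toFun (ΨM t 0 y))) :
    IsPushforward (ΨB 0 t) (ΨM t 0) p q := by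
  have hback : ΨM t 0 (ΨM 0 t p.pt) = p.pt :=
    h.base.apply_apply X.base_smooth h.base.zero_mem ht h.pt_mem (h.forward_mem t ht)
  have hvalue := (h.mapsTo_dom t ht (h.forward_mem t ht)).2
  rw [Set.mem_preimage, hback] at hvalue
  exact ⟨hpt ▸ hback, h.base.contMDiffAt_apply ht h.base.zero_mem (hpt ▸ h.forward_mem t ht),
    h.total.contMDiffAt_apply h.total.zero_mem ht hvalue, .of_forall hsec⟩

theorem exists_section (hπ : ContMDiff 𝓘(ℝ, EB) 𝓘(ℝ, E) ∞ π)
    (h : IsTransportDomain X p ε O OB ΨM ΨB) {t : ℝ} (ht : t ∈ Set.Ioo (-ε) ε) :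
    ∃ q : PointedSection E EB π, q.pt = ΨM 0 t p.pt ∧ q.sec.dom = O ∧
      ∀ y, q.sec.toFun y = ΨB 0 t (p.sec.toFun (ΨM t 0 y)) := by
  refine ⟨⟨ΨM 0 t p.pt, ⟨O, h.base.isOpen, fun y => ΨB 0 t (p.sec.toFun (ΨM t 0 y)),
    h.contMDiffOn_section.comp (contMDiff_const.prodMk contMDiff_id).contMDiffOn
      fun y hy => ⟨ht, hy⟩, fun y hy => ?_⟩, h.forward_mem t ht⟩, rfl, rfl, fun _ => rfl⟩
  have hproj := X.flowsTo_base hπ (h.flowsTo_section ht hy)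
  rw [p.sec.proj _ (h.mapsTo_dom t ht hy).1] at hproj
  exact hproj.unique X.base_smooth (h.base.flowsTo ht h.base.zero_mem hy).symm

theorem exists_curve (hπ : ContMDiff 𝓘(ℝ, EB) 𝓘(ℝ, E) ∞ π)
    (h : IsTransportDomain X p ε O OB ΨM ΨB) :
    ∃ Q : ℝ → PointedSection E EB π, IsSmoothCurveAt Q (Q 0) ∧ ∀ t ∈ Set.Ioo (-ε) ε,
      IsTransport X p t (Q t) ∧ IsPushforward (ΨB 0 t) (ΨM t 0) p (Q t) := by
  have : Nonempty (PointedSection E EB π) := ⟨p⟩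
  choose! Q hpt hdom hsec using fun t ht => h.exists_section hπ (t := t) ht
  refine ⟨Q, ?_, fun t ht => ⟨h.isTransport ht (hpt t ht) (hsec t ht),
    h.isPushforward ht (hpt t ht) (hsec t ht)⟩⟩
  exact isSmoothCurveAt_of_contMDiffOn h.base.pos h.base.isOpen hdom (h.contMDiffOn_pt.congr hpt)
    (h.contMDiffOn_section.congr fun w hw => hsec w.1 hw.1 w.2)

end IsTransportDomain

theorem ProjectableField.exists_transportCurve [CompleteSpace E] [CompleteSpace EB] [T2Space M]
    (X : ProjectableField E EB π) (hπ : ContMDiff 𝓘(ℝ, EB) 𝓘(ℝ, E) ∞ π) (b : B) :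
    ∃ (Φ : ℝ → B → B) (g : ℝ → M → M),
      HasMFDerivAt 𝓘(ℝ, ℝ) 𝓘(ℝ, EB) (fun t => Φ t b) 0
        ((1 : ℝ →L[ℝ] ℝ).smulRight (X.total 0 b : EB)) ∧
      ∀ p : PointedSection E EB π, p.value = b →
        ∃ Q : ℝ → PointedSection E EB π, IsSmoothCurveAt Q (Q 0) ∧
          ∀ᶠ t in 𝓝 (0 : ℝ), IsTransport X p t (Q t) ∧ IsPushforward (Φ t) (g t) p (Q t) := by
  obtain ⟨εM, OM, ΨM, hbM, hM⟩ := exists_isLocalEvolution X.base_smooth (π b)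
  obtain ⟨εB, OB, ΨB, hbB, hB⟩ := exists_isLocalEvolution X.total_smooth b
  refine ⟨ΨB 0, fun t => ΨM t 0, hB.hasMFDerivAt_zero hbB, ?_⟩
  rintro p rfl
  obtain ⟨ε, O, h⟩ := exists_isTransportDomain hM hB (p.proj_value ▸ hbM) hbB
  obtain ⟨Q, hQ, hmem⟩ := h.exists_curve hπ
  exact ⟨Q, hQ, Filter.eventually_of_mem (Ioo_mem_nhds h.base.zero_mem.1 h.base.zero_mem.2) hmem⟩

theorem eventually_isTransport_transport [CompleteSpace E] [CompleteSpace EB] [T2Space M]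
    (hπ : ContMDiff 𝓘(ℝ, EB) 𝓘(ℝ, E) ∞ π)
    (X : ProjectableField E EB π) (p : PointedSection E EB π) :
    ∀ᶠ t in 𝓝 (0 : ℝ), IsTransport X p t (transport X p t) := by
  obtain ⟨Φ, g, -, hcurve⟩ := X.exists_transportCurve hπ p.value
  obtain ⟨Q, -, hmem⟩ := hcurve p rfl
  exact hmem.mono fun t ht => ht.1.transport

end Transport

/-! ### Prolongations -/

section Prolongation

variable {E EB EF M B F : Type*}
  [NormedAddCommGroup E] [NormedSpace ℝ E] [NormedAddCommGroup EB] [NormedSpace ℝ EB]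
  [NormedAddCommGroup EF] [NormedSpace ℝ EF]
  [TopologicalSpace M] [ChartedSpace E M] [TopologicalSpace B] [ChartedSpace EB B]
  [TopologicalSpace F] [ChartedSpace EF F] {π : B → M}

theorem germToJet_surjective (k : ℕ) : Function.Surjective (germToJet E EB EF π k) := fun θ =>
  θ.inductionOn fun p => ⟨germ p, rfl⟩

variable [IsManifold 𝓘(ℝ, E) ∞ M]

theorem IsFibreBundle.jetValue_surjective [IsManifold 𝓘(ℝ, EF) ∞ F]
    (hπ : IsFibreBundle E EB EF F π) (k : ℕ) :
    Function.Surjective (jetValue : Jet E EB EF π k → AsDiffeological EB B) := fun b =>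
  have ⟨p, hp⟩ := hπ.exists_value_eq b
  ⟨jet EF k p, hp⟩

variable [IsManifold 𝓘(ℝ, EB) ∞ B]

theorem AutonomousField.ext_total_zero (hπ : Function.Surjective π)
    {X Y : AutonomousField E EB π} (h : X.1.total 0 = Y.1.total 0) : X = Y := by
  obtain ⟨⟨XT, XB, hXT, hXB, hX⟩, hX0⟩ := X
  obtain ⟨⟨YT, YB, hYT, hYB, hY⟩, hY0⟩ := Y
  obtain rfl : XT = YT := funext fun t => (hX0 t).trans (h.trans (hY0 t).symm)
  obtain rfl : XB = YB := funext fun t => funext fun x => by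
    obtain ⟨b, rfl⟩ := hπ x
    exact (hX t b).symm.trans (hY t b)
  rfl

variable [T2Space M] [T2Space B] {X : ProjectableField E EB π} {p p' q : PointedSection E EB π}
  {t : ℝ}

theorem IsTransport.germ_transport (h : IsTransport X p t q) :
    germ (GermBundle.transport X p t) = germ q :=
  h.transport.germ_eq h

theorem IsTransport.jet_transport (h : IsTransport X p t q) (k : ℕ) :
    jet EF k (GermBundle.transport X p t) = jet EF k q :=
  congrArg (germToJet E EB EF π k) h.germ_transport

variable [CompleteSpace E] [CompleteSpace EB]

theorem isSmoothCurveAt_germ_transport (hπ : ContMDiff 𝓘(ℝ, EB) 𝓘(ℝ, E) ∞ π)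
    (X : ProjectableField E EB π) (p : PointedSection E EB π) :
    IsSmoothCurveAt (fun t => germ (transport X p t)) (germ p) := by
  obtain ⟨Φ, g, -, hcurve⟩ := X.exists_transportCurve hπ p.value
  obtain ⟨Q, hQ, hmem⟩ := hcurve p rfl
  rw [(isTransport_zero X p).germ_eq hmem.self_of_nhds.1]
  exact (hQ.map dSmooth_germ).congr (hmem.mono fun t ht => ht.1.germ_transport.symm)

theorem hasMFDerivAt_value_transport (hπ : ContMDiff 𝓘(ℝ, EB) 𝓘(ℝ, E) ∞ π)
    (X : ProjectableField E EB π) (p : PointedSection E EB π) :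
    HasMFDerivAt 𝓘(ℝ, ℝ) 𝓘(ℝ, EB) (fun t => (transport X p t).value) 0
      ((1 : ℝ →L[ℝ] ℝ).smulRight (X.total 0 p.value : EB)) := by
  obtain ⟨Φ, g, hΦ, hcurve⟩ := X.exists_transportCurve hπ p.value
  obtain ⟨Q, -, hmem⟩ := hcurve p rfl
  refine hΦ.congr_of_eventuallyEq (hmem.mono fun t ht => ?_)
  exact (value_eq_of_germ_eq ht.1.germ_transport).trans ht.2.value

theorem germ_transport_congr (hπ : ContMDiff 𝓘(ℝ, EB) 𝓘(ℝ, E) ∞ π)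
    (X : ProjectableField E EB π) (h : germ p = germ p') :
    (fun t => germ (transport X p t)) =ᶠ[𝓝 0] fun t => germ (transport X p' t) := by
  obtain ⟨Φ, g, -, hcurve⟩ := X.exists_transportCurve hπ p.value
  obtain ⟨Q, -, hmem⟩ := hcurve p rfl
  obtain ⟨Q', -, hmem'⟩ := hcurve p' (value_eq_of_germ_eq h).symm
  filter_upwards [hmem, hmem'] with t ⟨hT, hP⟩ ⟨hT', hP'⟩
  rw [hT.germ_transport, hT'.germ_transport]
  exact hP.germ_congr hP' (hT.1.unique X.base_smooth ((germ_eq_iff.mp h).1 ▸ hT'.1)) h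

theorem isSmoothCurveAt_jet_transport (hπ : ContMDiff 𝓘(ℝ, EB) 𝓘(ℝ, E) ∞ π)
    (X : ProjectableField E EB π) (k : ℕ) (p : PointedSection E EB π) :
    IsSmoothCurveAt (fun t => jet EF k (transport X p t)) (jet EF k p) :=
  (isSmoothCurveAt_germ_transport hπ X p).map (dSmooth_germToJet k)

theorem germProlongation_germ (hπ : ContMDiff 𝓘(ℝ, EB) 𝓘(ℝ, E) ∞ π)
    (X : ProjectableField E EB π) (p : PointedSection E EB π) :
    germProlongation X (germ p) =
      ⟨germ p, velocityAt (germ p) (fun t => germ (transport X p t))⟩ :=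
  congrArg (Sigma.mk (germ p)) (velocityAt_congr (isSmoothCurveAt_germ_transport hπ X p)
    (germ_transport_congr hπ X (Quotient.out_eq (germ p)).symm)).symm

variable [IsManifold 𝓘(ℝ, EF) ∞ F]

theorem jet_transport_congr (hπ : IsFibreBundle E EB EF F π) (X : ProjectableField E EB π)
    {k : ℕ} (h : jet EF k p = jet EF k p') :
    (fun t => jet EF k (transport X p t)) =ᶠ[𝓝 0] fun t => jet EF k (transport X p' t) := by
  obtain ⟨Φ, g, -, hcurve⟩ := X.exists_transportCurve hπ.smooth p.value
  obtain ⟨Q, -, hmem⟩ := hcurve p rfl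
  obtain ⟨Q', -, hmem'⟩ := hcurve p' (jet_eq_iff.mp h).2.1.symm
  obtain ⟨c, hc⟩ := hπ.exists_fibredChart p.value
  filter_upwards [hmem, hmem'] with t ⟨hT, hP⟩ ⟨hT', hP'⟩
  rw [hT.jet_transport, hT'.jet_transport]
  exact hP.jet_congr hP' (hT.1.unique X.base_smooth ((jet_eq_iff.mp h).1 ▸ hT'.1)) c hc h

theorem jetProlongation_jet (hπ : IsFibreBundle E EB EF F π) (X : ProjectableField E EB π)
    (k : ℕ) (p : PointedSection E EB π) :
    jetProlongation k X (jet EF k p) =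
      ⟨jet EF k p, velocityAt (jet EF k p) (fun t => jet EF k (transport X p t))⟩ :=
  congrArg (Sigma.mk (jet EF k p)) (velocityAt_congr
    (isSmoothCurveAt_jet_transport hπ.smooth X k p)
    (jet_transport_congr hπ X (Quotient.out_eq (jet EF k p)).symm)).symm

theorem internalTangentMap_germToJet (hπ : IsFibreBundle E EB EF F π)
    (X : ProjectableField E EB π) (k : ℕ) (γ : Germ E EB π) :
    internalTangentMap (dSmooth_germToJet k) (germProlongation X γ) =
      jetProlongation k X (germToJet E EB EF π k γ) := by
  obtain ⟨p, rfl⟩ : ∃ p, germ p = γ := ⟨_, Quotient.out_eq γ⟩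
  rw [germProlongation_germ hπ.smooth, internalTangentMap_velocityAt
    (isSmoothCurveAt_germ_transport hπ.smooth X p) (dSmooth_germToJet k)
    (y := jet EF k p) (c' := fun t => jet EF k (transport X p t)) rfl (by rfl)]
  exact (jetProlongation_jet hπ X k p).symm

theorem internalTangentMap_jetProj (hπ : IsFibreBundle E EB EF F π)
    (X : ProjectableField E EB π) {l k : ℕ} (h : l ≤ k) (θ : Jet E EB EF π k) :
    internalTangentMap (dSmooth_jetProj E EB EF π h) (jetProlongation k X θ) =
      jetProlongation l X (jetProj E EB EF π h θ) := by
  obtain ⟨p, rfl⟩ : ∃ p, jet EF k p = θ := ⟨_, Quotient.out_eq θ⟩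
  rw [jetProlongation_jet hπ, internalTangentMap_velocityAt
    (isSmoothCurveAt_jet_transport hπ.smooth X k p) (dSmooth_jetProj E EB EF π h)
    (y := jet EF l p) (c' := fun t => jet EF l (transport X p t)) rfl (by rfl)]
  exact (jetProlongation_jet hπ X l p).symm

theorem toTangentBundle_jetProlongation (hπ : IsFibreBundle E EB EF F π)
    (X : ProjectableField E EB π) (k : ℕ) (θ : Jet E EB EF π k) :
    toTangentBundle (internalTangentMap (hπ.dSmooth_jetValue k) (jetProlongation k X θ)) =
      (⟨jetValue θ, X.total 0 (jetValue θ)⟩ : TangentBundle 𝓘(ℝ, EB) B) := by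
  obtain ⟨p, rfl⟩ : ∃ p, jet EF k p = θ := ⟨_, Quotient.out_eq θ⟩
  have hc := isSmoothCurveAt_jet_transport (EF := EF) hπ.smooth X k p
  rw [jetProlongation_jet hπ, internalTangentMap_velocityAt hc (hπ.dSmooth_jetValue k)
    (Y := AsDiffeological EB B) (y := p.value) (c' := fun t => (transport X p t).value) rfl
    (by rfl)]
  exact congrArg (Bundle.TotalSpace.mk p.value) (toTangentSpace_velocityAt
    (hc.map (hπ.dSmooth_jetValue k)) (hasMFDerivAt_value_transport hπ.smooth X p))

end Prolongation

/-! ### The tower of prolongations -/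

section Functoriality

variable {X Y Z : Type*} [DiffeologicalSpace X] [DiffeologicalSpace Y] [DiffeologicalSpace Z]
  {f : X → Y} {g : Y → Z}

theorem differential_comp (hg : DSmooth g) (hf : DSmooth f) (x : X) :
    differential (hg.comp hf) x = differential hg (f x) ∘ₗ differential hf x := by
  classical
  refine Submodule.linearMap_qext _ (DirectSum.linearMap_ext ℝ fun φ => LinearMap.ext fun v => ?_)
  refine (differentialAux_plotVector (hg.comp hf) φ v).trans ?_
  refine Eq.trans ?_ (congrArg (differential hg (f x)) (differentialAux_plotVector hf φ v)).symm
  exact (differentialAux_plotVector hg (φ.map hf) v).symm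

theorem internalTangentMap_comp (hg : DSmooth g) (hf : DSmooth f) (v : InternalTangentBundle X) :
    internalTangentMap (hg.comp hf) v = internalTangentMap hg (internalTangentMap hf v) :=
  congrArg (Sigma.mk (g (f v.1))) (LinearMap.congr_fun (differential_comp hg hf v.1) v.2)

end Functoriality

theorem exists_map_of_rightUnique {α β γ : Type*} {f : α → β} {g : α → γ} {R : β → γ → Prop}
    (hf : Function.Surjective f) (hR : ∀ a, R (f a) (g a)) (hunique : Relator.RightUnique R) :
    ∃ push : β → γ, (∀ v w, w = push v ↔ R v w) ∧ ∀ a, push (f a) = g a := by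
  have hpush : ∀ v, R v (g (Function.surjInv hf v)) := fun v => by
    simpa only [Function.surjInv_eq] using hR (Function.surjInv hf v)
  exact ⟨fun v => g (Function.surjInv hf v),
    fun v w => ⟨fun h => h ▸ hpush v, fun h => hunique h (hpush v)⟩,
    fun a => hunique (hpush (f a)) (hR a)⟩

section Tower

variable {E EB EF M B F : Type*}
  [NormedAddCommGroup E] [NormedSpace ℝ E] [NormedAddCommGroup EB] [NormedSpace ℝ EB]
  [NormedAddCommGroup EF] [NormedSpace ℝ EF]
  [TopologicalSpace M] [ChartedSpace E M] [TopologicalSpace B] [ChartedSpace EB B]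
  [TopologicalSpace F] [ChartedSpace EF F] {π : B → M}

theorem jetProj_surjective {l k : ℕ} (h : l ≤ k) :
    Function.Surjective (jetProj E EB EF π h) := fun θ =>
  have ⟨γ, hγ⟩ := germToJet_surjective l θ
  ⟨germToJet E EB EF π k γ, ((germToJetInf E EB EF π γ).2 l k h).trans hγ⟩

theorem jetInfProj_surjective (k : ℕ) : Function.Surjective (jetInfProj E EB EF π k) := fun θ =>
  have ⟨γ, hγ⟩ := germToJet_surjective k θ
  ⟨germToJetInf E EB EF π γ, hγ⟩

variable [IsManifold 𝓘(ℝ, E) ∞ M] [IsManifold 𝓘(ℝ, EB) ∞ B]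

-- Borel's lemma on the surjectivity of `π^{∞,g}` is avoided: the components of a field in the image
-- of `𝔭^∞` come from the finite jet spaces, onto which germs surject trivially.
theorem jetInfFields_ext {V W : JetInfFields E EB EF π}
    (h : V.1 ∘ germToJetInf E EB EF π = W.1 ∘ germToJetInf E EB EF π) : V = W := by
  obtain ⟨_, X, rfl⟩ := V
  obtain ⟨_, Y, rfl⟩ := W
  refine Subtype.ext (funext fun θ => funext fun k => ?_)
  have hk : jetProlongation k X.1 ∘ germToJet E EB EF π k =
      jetProlongation k Y.1 ∘ germToJet E EB EF π k :=
    funext fun γ => congrFun (congrFun h γ) k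
  exact congrFun ((germToJet_surjective k).injective_comp_right hk) (jetInfProj E EB EF π k θ)

theorem exists_pushforward_jetInfProj (k : ℕ) :
    ∃ push : JetInfFields E EB EF π → JetFields E EB EF π k,
      (∀ V W, W = push V ↔ ∀ θ, V.1 θ k = W.1 (jetInfProj E EB EF π k θ)) ∧
      ∀ X : AutonomousField E EB π,
        push ⟨jetInfProlongation X.1, X, rfl⟩ = ⟨jetProlongation k X.1, X, rfl⟩ :=
  exists_map_of_rightUnique Set.rangeFactorization_surjective (fun _ _ => rfl)
    fun _ _ _ h h' => Subtype.ext ((jetInfProj_surjective k).injective_comp_right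
      (funext fun θ => (h θ).symm.trans (h' θ)))

variable [T2Space M] [T2Space B] [CompleteSpace E] [CompleteSpace EB]
  [IsManifold 𝓘(ℝ, EF) ∞ F] (hπ : IsFibreBundle E EB EF F π)
include hπ

theorem jetInfProlongation_mem (X : ProjectableField E EB π) (θ : JetInf E EB EF π) :
    jetInfProlongation X θ ∈ jetInfTangent E EB EF π := fun l k h =>
  (internalTangentMap_jetProj hπ X h (θ.1 k)).trans (congrArg (jetProlongation l X) (θ.2 l k h))

theorem jetInfTangentComparison_germToJetInf (X : ProjectableField E EB π) :
    jetInfTangentComparison E EB EF π ∘ internalTangentMap dSmooth_germToJetInf ∘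
      germProlongation X = jetInfProlongation X ∘ germToJetInf E EB EF π :=
  funext fun γ => funext fun k =>
    (internalTangentMap_comp (dSmooth_jetInfProj E EB EF π k) dSmooth_germToJetInf _).symm.trans
      (internalTangentMap_germToJet hπ X k γ)

theorem toTangentBundle_germProlongation (X : ProjectableField E EB π) (γ : Germ E EB π) :
    toTangentBundle (internalTangentMap ((hπ.dSmooth_jetValue 0).comp (dSmooth_germToJet 0))
        (germProlongation X γ)) =
      (⟨jetValue (germToJet E EB EF π 0 γ), X.total 0 (jetValue (germToJet E EB EF π 0 γ))⟩ :
        TangentBundle 𝓘(ℝ, EB) B) := by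
  rw [internalTangentMap_comp _ (dSmooth_germToJet 0), internalTangentMap_germToJet hπ]
  exact toTangentBundle_jetProlongation hπ X 0 _

theorem exists_pushforward_germToJetInf :
    ∃ push : GermFields E EB π → JetInfFields E EB EF π,
      (∀ V W, W = push V ↔
        jetInfTangentComparison E EB EF π ∘ internalTangentMap dSmooth_germToJetInf ∘ V.1 =
          W.1 ∘ germToJetInf E EB EF π) ∧
      ∀ X : AutonomousField E EB π,
        push ⟨germProlongation X.1, X, rfl⟩ = ⟨jetInfProlongation X.1, X, rfl⟩ :=
  exists_map_of_rightUnique Set.rangeFactorization_surjective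
    (fun X => jetInfTangentComparison_germToJetInf hπ X.1)
    fun _ _ _ h h' => jetInfFields_ext (h.symm.trans h')

theorem exists_pushforward_germToJet (k : ℕ) :
    ∃ push : GermFields E EB π → JetFields E EB EF π k,
      (∀ V W, W = push V ↔
        internalTangentMap (dSmooth_germToJet k) ∘ V.1 = W.1 ∘ germToJet E EB EF π k) ∧
      ∀ X : AutonomousField E EB π,
        push ⟨germProlongation X.1, X, rfl⟩ = ⟨jetProlongation k X.1, X, rfl⟩ :=
  exists_map_of_rightUnique Set.rangeFactorization_surjective
    (fun X => funext (internalTangentMap_germToJet hπ X.1 k))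
    fun _ _ _ h h' =>
      Subtype.ext ((germToJet_surjective k).injective_comp_right (h.symm.trans h'))

theorem exists_pushforward_jetProj {l k : ℕ} (h : l ≤ k) :
    ∃ push : JetFields E EB EF π k → JetFields E EB EF π l,
      (∀ V W, W = push V ↔
        internalTangentMap (dSmooth_jetProj E EB EF π h) ∘ V.1 = W.1 ∘ jetProj E EB EF π h) ∧
      ∀ X : AutonomousField E EB π,
        push ⟨jetProlongation k X.1, X, rfl⟩ = ⟨jetProlongation l X.1, X, rfl⟩ :=
  exists_map_of_rightUnique Set.rangeFactorization_surjective
    (fun X => funext (internalTangentMap_jetProj hπ X.1 h))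
    fun _ _ _ hW hW' =>
      Subtype.ext ((jetProj_surjective h).injective_comp_right (hW.symm.trans hW'))

theorem exists_pushforward_jetValue :
    ∃ push : JetFields E EB EF π 0 → AutonomousField E EB π,
      (∀ V W, W = push V ↔
        ∀ θ, toTangentBundle (internalTangentMap (hπ.dSmooth_jetValue 0) (V.1 θ)) =
          (⟨jetValue θ, W.1.total 0 (jetValue θ)⟩ : TangentBundle 𝓘(ℝ, EB) B)) ∧
      ∀ X, push ⟨jetProlongation 0 X.1, X, rfl⟩ = X := by
  refine exists_map_of_rightUnique Set.rangeFactorization_surjective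
    (fun X => toTangentBundle_jetProlongation hπ X.1 0)
    fun _ _ _ h h' => AutonomousField.ext_total_zero hπ.surjective (funext fun b => ?_)
  obtain ⟨θ, rfl⟩ := hπ.jetValue_surjective 0 b
  exact eq_of_heq (Bundle.TotalSpace.mk.inj ((h θ).symm.trans (h' θ))).2

end Tower

end GermBundle

theorem proposition3_general {E EB EF M B F : Type*}
    [NormedAddCommGroup E] [NormedSpace ℝ E] [CompleteSpace E]
    [NormedAddCommGroup EB] [NormedSpace ℝ EB] [CompleteSpace EB]
    [NormedAddCommGroup EF] [NormedSpace ℝ EF]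
    [TopologicalSpace M] [ChartedSpace E M] [IsManifold 𝓘(ℝ, E) ∞ M] [T2Space M]
    [TopologicalSpace B] [ChartedSpace EB B] [IsManifold 𝓘(ℝ, EB) ∞ B] [T2Space B]
    [TopologicalSpace F] [ChartedSpace EF F] [IsManifold 𝓘(ℝ, EF) ∞ F]
    (π : B → M) (hπ : IsFibreBundle E EB EF F π) :
    ∃ (hg : ∀ k : ℕ, DSmooth (germToJet E EB EF π k))
      (hinf : DSmooth (germToJetInf E EB EF π))
      (hB : DSmooth (jetValue : Jet E EB EF π 0 → AsDiffeological EB B)),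
    (∀ (X : ProjectableField E EB π) (p : PointedSection E EB π),
      (∀ᶠ t in 𝓝 (0 : ℝ), IsTransport X p t (transport X p t)) ∧
      IsSmoothCurveAt (fun t => germ (transport X p t)) (germ p) ∧
      germProlongation X (germ p) =
        ⟨germ p, velocityAt (germ p) (fun t => germ (transport X p t))⟩ ∧
      ∀ k : ℕ, IsSmoothCurveAt (fun t => jet EF k (transport X p t)) (jet EF k p) ∧
        jetProlongation k X (jet EF k p) =
          ⟨jet EF k p, velocityAt (jet EF k p) (fun t => jet EF k (transport X p t))⟩) ∧
    (∀ (X : ProjectableField E EB π) (θ : JetInf E EB EF π),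
      jetInfProlongation X θ ∈ jetInfTangent E EB EF π) ∧
    (∀ (X : ProjectableField E EB π) (k : ℕ),
      internalTangentMap (hg k) ∘ germProlongation X =
        jetProlongation k X ∘ germToJet E EB EF π k) ∧
    (∀ X : ProjectableField E EB π,
      jetInfTangentComparison E EB EF π ∘ internalTangentMap hinf ∘ germProlongation X =
        jetInfProlongation X ∘ germToJetInf E EB EF π) ∧
    (∀ (X : ProjectableField E EB π) (γ : Germ E EB π),
      toTangentBundle (internalTangentMap (hB.comp (hg 0)) (germProlongation X γ)) =
        (⟨jetValue (germToJet E EB EF π 0 γ), X.total 0 (jetValue (germToJet E EB EF π 0 γ))⟩ :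
          TangentBundle 𝓘(ℝ, EB) B)) ∧
    ∃ (pushInf : GermFields E EB π → JetInfFields E EB EF π)
      (push : ∀ k, GermFields E EB π → JetFields E EB EF π k)
      (jetPushInf : ∀ k, JetInfFields E EB EF π → JetFields E EB EF π k)
      (jetPush : ∀ (l k : ℕ), l ≤ k → JetFields E EB EF π k → JetFields E EB EF π l)
      (pushB : JetFields E EB EF π 0 → AutonomousField E EB π),
      (∀ V W, W = pushInf V ↔
        jetInfTangentComparison E EB EF π ∘ internalTangentMap hinf ∘ V.1 =
          W.1 ∘ germToJetInf E EB EF π) ∧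
      (∀ k V W, W = push k V ↔ internalTangentMap (hg k) ∘ V.1 = W.1 ∘ germToJet E EB EF π k) ∧
      (∀ k V W, W = jetPushInf k V ↔ ∀ θ, V.1 θ k = W.1 (jetInfProj E EB EF π k θ)) ∧
      (∀ l k (h : l ≤ k) V W, W = jetPush l k h V ↔
        internalTangentMap (dSmooth_jetProj E EB EF π h) ∘ V.1 = W.1 ∘ jetProj E EB EF π h) ∧
      (∀ V W, W = pushB V ↔ ∀ θ, toTangentBundle (internalTangentMap hB (V.1 θ)) =
        (⟨jetValue θ, W.1.total 0 (jetValue θ)⟩ : TangentBundle 𝓘(ℝ, EB) B)) ∧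
      (∀ k, jetPushInf k ∘ pushInf = push k) ∧
      (∀ l k (h : l ≤ k), jetPush l k h ∘ push k = push l) ∧
      (∀ l k (h : l ≤ k), jetPush l k h ∘ jetPushInf k = jetPushInf l) ∧
      (∀ j l k (h : j ≤ l) (h' : l ≤ k),
        jetPush j l h ∘ jetPush l k h' = jetPush j k (h.trans h')) ∧
      (∀ X : AutonomousField E EB π,
        pushInf ⟨germProlongation X.1, X, rfl⟩ = ⟨jetInfProlongation X.1, X, rfl⟩ ∧
        (∀ k, push k ⟨germProlongation X.1, X, rfl⟩ = ⟨jetProlongation k X.1, X, rfl⟩) ∧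
        (∀ k, jetPushInf k ⟨jetInfProlongation X.1, X, rfl⟩ = ⟨jetProlongation k X.1, X, rfl⟩) ∧
        (∀ l k (h : l ≤ k), jetPush l k h ⟨jetProlongation k X.1, X, rfl⟩ =
          ⟨jetProlongation l X.1, X, rfl⟩) ∧
        pushB ⟨jetProlongation 0 X.1, X, rfl⟩ = X) := by
  choose push hpush hpush_apply using exists_pushforward_germToJet hπ
  choose jetPushInf hjetPushInf hjetPushInf_apply using
    exists_pushforward_jetInfProj (E := E) (EB := EB) (EF := EF) (π := π)
  choose jetPush hjetPush hjetPush_apply using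
    fun (l k : ℕ) (h : l ≤ k) => exists_pushforward_jetProj hπ h
  obtain ⟨pushInf, hpushInf, hpushInf_apply⟩ := exists_pushforward_germToJetInf hπ
  obtain ⟨pushB, hpushB, hpushB_apply⟩ := exists_pushforward_jetValue hπ
  refine ⟨dSmooth_germToJet, dSmooth_germToJetInf, hπ.dSmooth_jetValue 0,
    fun X p => ⟨eventually_isTransport_transport hπ.smooth X p,
      isSmoothCurveAt_germ_transport hπ.smooth X p, germProlongation_germ hπ.smooth X p,
      fun k => ⟨isSmoothCurveAt_jet_transport hπ.smooth X k p, jetProlongation_jet hπ X k p⟩⟩,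
    jetInfProlongation_mem hπ, fun X k => funext (internalTangentMap_germToJet hπ X k),
    jetInfTangentComparison_germToJetInf hπ, toTangentBundle_germProlongation hπ,
    pushInf, push, jetPushInf, jetPush, pushB, hpushInf, hpush, hjetPushInf, hjetPush, hpushB,
    fun k => funext ?_, fun l k h => funext ?_, fun l k h => funext ?_, fun j l k h h' => funext ?_,
    fun X => ⟨hpushInf_apply X, fun k => hpush_apply k X, fun k => hjetPushInf_apply k X,
      fun l k h => hjetPush_apply l k h X, hpushB_apply X⟩⟩
  all_goals
    rintro ⟨_, X, rfl⟩
    simp only [Function.comp_apply, hpushInf_apply, hpush_apply, hjetPushInf_apply, hjetPush_apply]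

theorem proposition3 {E EB EF M B F : Type*}
    [NormedAddCommGroup E] [NormedSpace ℝ E] [FiniteDimensional ℝ E]
    [NormedAddCommGroup EB] [NormedSpace ℝ EB] [FiniteDimensional ℝ EB]
    [NormedAddCommGroup EF] [NormedSpace ℝ EF] [FiniteDimensional ℝ EF]
    [TopologicalSpace M] [ChartedSpace E M] [IsManifold 𝓘(ℝ, E) ∞ M] [T2Space M]
    [TopologicalSpace B] [ChartedSpace EB B] [IsManifold 𝓘(ℝ, EB) ∞ B] [T2Space B]
    [TopologicalSpace F] [ChartedSpace EF F] [IsManifold 𝓘(ℝ, EF) ∞ F] [T2Space F]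
    (π : B → M) (hπ : IsFibreBundle E EB EF F π) :
    -- the projections of the tower are smooth
    ∃ (hg : ∀ k : ℕ, DSmooth (germToJet E EB EF π k))
      (hinf : DSmooth (germToJetInf E EB EF π))
      (hB : DSmooth (jetValue : Jet E EB EF π 0 → AsDiffeological EB B)),
    -- the curves of germs and of jets defining the prolongations of a possibly time-dependent
    -- projectable field are given by the flows, are smooth, and define the prolongations
    -- independently of the chosen sections
    (∀ (X : ProjectableField E EB π) (p : PointedSection E EB π),
      (∀ᶠ t in 𝓝 (0 : ℝ), IsTransport X p t (transport X p t)) ∧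
      IsSmoothCurveAt (fun t => germ (transport X p t)) (germ p) ∧
      germProlongation X (germ p) =
        ⟨germ p, velocityAt (germ p) (fun t => germ (transport X p t))⟩ ∧
      ∀ k : ℕ, IsSmoothCurveAt (fun t => jet EF k (transport X p t)) (jet EF k p) ∧
        jetProlongation k X (jet EF k p) =
          ⟨jet EF k p, velocityAt (jet EF k p) (fun t => jet EF k (transport X p t))⟩) ∧
    (∀ (X : ProjectableField E EB π) (θ : JetInf E EB EF π),
      jetInfProlongation X θ ∈ jetInfTangent E EB EF π) ∧
    -- `dπ^{k,g} ∘ 𝔭ᵍ(X) = 𝔭ᵏ(X) ∘ π^{k,g}` for finite `k`, for `k = ∞`, and on `Γ_0(π) = B`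
    (∀ (X : ProjectableField E EB π) (k : ℕ),
      internalTangentMap (hg k) ∘ germProlongation X = jetProlongation k X ∘ germToJet E EB EF π k) ∧
    (∀ X : ProjectableField E EB π,
      jetInfTangentComparison E EB EF π ∘ internalTangentMap hinf ∘ germProlongation X =
        jetInfProlongation X ∘ germToJetInf E EB EF π) ∧
    (∀ (X : ProjectableField E EB π) (γ : Germ E EB π),
      toTangentBundle (internalTangentMap (hB.comp (hg 0)) (germProlongation X γ)) =
        (⟨jetValue (germToJet E EB EF π 0 γ), X.total 0 (jetValue (germToJet E EB EF π 0 γ))⟩ :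
          TangentBundle 𝓘(ℝ, EB) B)) ∧
    -- the tower of pushforward maps
    ∃ (pushInf : GermFields E EB π → JetInfFields E EB EF π)
      (push : ∀ k, GermFields E EB π → JetFields E EB EF π k)
      (jetPushInf : ∀ k, JetInfFields E EB EF π → JetFields E EB EF π k)
      (jetPush : ∀ (l k : ℕ), l ≤ k → JetFields E EB EF π k → JetFields E EB EF π l)
      (pushB : JetFields E EB EF π 0 → AutonomousField E EB π),
      -- each map sends a field to the unique field to which it projects
      (∀ V W, W = pushInf V ↔
        jetInfTangentComparison E EB EF π ∘ internalTangentMap hinf ∘ V.1 =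
          W.1 ∘ germToJetInf E EB EF π) ∧
      (∀ k V W, W = push k V ↔ internalTangentMap (hg k) ∘ V.1 = W.1 ∘ germToJet E EB EF π k) ∧
      (∀ k V W, W = jetPushInf k V ↔ ∀ θ, V.1 θ k = W.1 (jetInfProj E EB EF π k θ)) ∧
      (∀ l k (h : l ≤ k) V W, W = jetPush l k h V ↔
        internalTangentMap (dSmooth_jetProj E EB EF π h) ∘ V.1 = W.1 ∘ jetProj E EB EF π h) ∧
      (∀ V W, W = pushB V ↔ ∀ θ, toTangentBundle (internalTangentMap hB (V.1 θ)) =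
        (⟨jetValue θ, W.1.total 0 (jetValue θ)⟩ : TangentBundle 𝓘(ℝ, EB) B)) ∧
      -- the maps of the tower are compatible with each other
      (∀ k, jetPushInf k ∘ pushInf = push k) ∧
      (∀ l k (h : l ≤ k), jetPush l k h ∘ push k = push l) ∧
      (∀ l k (h : l ≤ k), jetPush l k h ∘ jetPushInf k = jetPushInf l) ∧
      (∀ j l k (h : j ≤ l) (h' : l ≤ k),
        jetPush j l h ∘ jetPush l k h' = jetPush j k (h.trans h')) ∧
      -- and with the prolongation operators
      (∀ X : AutonomousField E EB π,
        pushInf ⟨germProlongation X.1, X, rfl⟩ = ⟨jetInfProlongation X.1, X, rfl⟩ ∧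
        (∀ k, push k ⟨germProlongation X.1, X, rfl⟩ = ⟨jetProlongation k X.1, X, rfl⟩) ∧
        (∀ k, jetPushInf k ⟨jetInfProlongation X.1, X, rfl⟩ = ⟨jetProlongation k X.1, X, rfl⟩) ∧
        (∀ l k (h : l ≤ k), jetPush l k h ⟨jetProlongation k X.1, X, rfl⟩ =
          ⟨jetProlongation l X.1, X, rfl⟩) ∧
        pushB ⟨jetProlongation 0 X.1, X, rfl⟩ = X) := by
  have := FiniteDimensional.complete ℝ E
  have := FiniteDimensional.complete ℝ EB
  exact proposition3_general π hπ
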